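/- Let $\pi_j:\mathbb R^3\to\mathbb R^2$ ($j=1,2,3$) be the projection $\pi_j(x)=\hat x_j$ omitting the $j$-th coordinate. For $\lambda\in\mathbb R\setminus\{0\}$, $\psi\in C_0^\infty(\mathbb R^3)$ (complex valued) and a real-valued function $S$ that is real analytic in a neighborhood of $\operatorname{supp}\psi$, put $$\Lambda_3(f_1,f_2,f_3)=\int_{\mathbb R^3}e^{i\lambda S(x)}\,\psi(x)\prod_{j=1}^3 f_j(\hat x_j)\,dx ,\qquad D_3S=\partial_{x_1}\partial_{x_2}\partial_{x_3}S .$$ Let $\mu>0$ and $C_1,C_2>0$. Suppose that $\Lambda_3$ satisfies the local estimate hypotheses with parameter $\mu$ in all three variables, i.e. there are $b_1,b_2,b_3>0$ such that for each $j=1,2,3$: 1. the support of $\psi$ lies in a slab $\{a_j\le x_j\le a_j+b_j\}$ of width $b_j$ in the $x_j$-direction; 2. $|\partial_{x_j}^n\psi(x)|\le C_1b_j^{-n}$ for all $x\in\mathbb R^3$ and $n=0,1,2$; 3. on the support of $\psi$, $|D_3S|\ge\mu$, $|\partial_{x_j}D_3S|\le C_2\mu b_j^{-1}$ and $|\partial_{x_j}^2D_3S|\le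 C_2\mu b_j^{-2}$. Then there is a constant $C>0$, depending only on $C_1$ and $C_2$ (in particular not on $\lambda,\mu,b_1,b_2,b_3,S,\psi$ or the $f_j$), such that for all $f_1,f_2,f_3\in L^{8/3}(\mathbb R^2)$ the integral defining $\Lambda_3(f_1,f_2,f_3)$ converges absolutely and $$|\Lambda_3(f_1,f_2,f_3)|\le C\,(|\lambda|\mu)^{-1/4}\,\|f_1\|_{L^{8/3}}\|f_2\|_{L^{8/3}}\|f_3\|_{L^{8/3}} .$$ -/

import Mathlib

open MeasureTheory
open scoped ContDiff

noncomputable section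

/-- The projection `x ↦ x̂_j`, `ℝ^{n+1} → ℝ^n`, which omits the `j`-th coordinate. -/
def hatProj {n : ℕ} (j : Fin (n + 1)) (x : Fin (n + 1) → ℝ) : Fin n → ℝ :=
  fun i => x (j.succAbove i)

/-- The first order partial derivative `∂g/∂x_j`. -/
def pderivAt {d : ℕ} {F : Type*} [NormedAddCommGroup F] [NormedSpace ℝ F]
    (j : Fin d) (g : (Fin d → ℝ) → F) : (Fin d → ℝ) → F :=
  fun x => fderiv ℝ g x (Pi.single j 1)

/-- The full mixed derivative `D_d S = ∂_{x_1} ∂_{x_2} ⋯ ∂_{x_d} S`. -/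
def mixedDeriv {d : ℕ} (S : (Fin d → ℝ) → ℝ) : (Fin d → ℝ) → ℝ :=
  (List.finRange d).foldr pderivAt S

/-- The integrand `e^{iλS(x)} ψ(x) ∏_j f_j(x̂_j)` of the Loomis-Whitney form, in dimension
`d = n + 1`. -/
def oscIntegrand {n : ℕ} (lam : ℝ) (S : (Fin (n + 1) → ℝ) → ℝ) (ψ : (Fin (n + 1) → ℝ) → ℂ)
    (f : Fin (n + 1) → (Fin n → ℝ) → ℂ) (x : Fin (n + 1) → ℝ) : ℂ :=
  Complex.exp (Complex.I * lam * S x) * ψ x * ∏ j, f j (hatProj j x)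

/-- The oscillatory Loomis-Whitney form `Λ_d(f_1, …, f_d)`, in dimension `d = n + 1`. -/
def oscForm {n : ℕ} (lam : ℝ) (S : (Fin (n + 1) → ℝ) → ℝ) (ψ : (Fin (n + 1) → ℝ) → ℂ)
    (f : Fin (n + 1) → (Fin n → ℝ) → ℂ) : ℂ :=
  ∫ x, oscIntegrand lam S ψ f x

/-- The local estimate hypotheses in `x_j` with parameter `μ`, width `b = b_j` and constants
`C₁`, `C₂`, for the phase `S` and the cutoff `ψ`. -/
structure LocalEstimateHyp {d : ℕ} (S : (Fin d → ℝ) → ℝ) (ψ : (Fin d → ℝ) → ℂ)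
    (j : Fin d) (μ b C₁ C₂ : ℝ) : Prop where
  width_pos : 0 < b
  supported : ∃ a : ℝ, ∀ x ∈ tsupport ψ, x j ∈ Set.Icc a (a + b)
  cutoff_bound : ∀ n ≤ 2, ∀ x, ‖((pderivAt j)^[n] ψ) x‖ ≤ C₁ * (b ^ n)⁻¹
  mixed_lower : ∀ x ∈ tsupport ψ, μ ≤ |mixedDeriv S x|
  mixed_upper_one : ∀ x ∈ tsupport ψ, |pderivAt j (mixedDeriv S) x| ≤ C₂ * μ * b⁻¹
  mixed_upper_two : ∀ x ∈ tsupport ψ,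
    |pderivAt j (pderivAt j (mixedDeriv S)) x| ≤ C₂ * μ * (b ^ 2)⁻¹

end

open scoped ENNReal

open scoped ComplexConjugate

/-! Write the coordinates as `x, y, z`. The argument has a local half, on boxes contained in the
support of `ψ`, and a global half, which exhausts the support by dyadic grids.

On a box, put `E = e^{iλS}·amplitude` and let `H(x,y)` be the `z`-integral of `E f₁(y,z) f₂(x,z)`.
Cauchy-Schwarz against `f₃` reduces matters to the `L²` norm of `H`. Opening the square in `z`, then
applying Cauchy-Schwarz in `x` and `TT*` in `y`, leaves an `x`-integral of four factors `E`, whose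
phase is the double difference of `S` in `(y,z)`. By two applications of the mean value theorem its
`x`-derivative is `D₃S` at an intermediate point times `(y-y')(z-z')`, so two integrations by parts
give decay (`norm_fourfold_integral_le`). The mass of the resulting kernel in `y'` is a constant
times `(|λ|μ|z-z'|)⁻¹`, with no trace of the box size. Schur's test and the Hardy-Littlewood-Sobolev
inequality with kernel `|z-z'|^{-1/2}` then bound `H` by mixed `L⁴(L^{8/3})` norms of `f₁` and `f₂`
(`lintegral_enorm_integral_kernel_sq_le`). Dividing `f₁`, `f₂` by weights of one variable and
transferring the weights to `f₃` turns this into the `L^{8/3}` bound (`enorm_trilinear_le`), with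
the factor `(|λ|μ)^{-1/4}`.

The mean value theorem needs a whole box on which `D₃S` is controlled, whereas the control is given
on `supp ψ`, a set of arbitrary shape. So take, for `N = 2^k`, a smooth partition of unity on a grid
with spacing `b_j/N`, and split it as `P_k + Q_k`, where `P_k` collects the boxes inside `supp ψ`
and `Q_k` the others. A box of the second kind contains a zero of `ψ`, hence `|ψ| ≲ 1/N` there. On
`supp ψ` one has `P_{k+1} - P_k = Q_k P_{k+1} - Q_{k+1} P_k`, so each increment is a sum over good
boxes with amplitude `O(1/N)`. Summing the box estimates by the discrete Loomis-Whitney inequality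
costs only `(N+1)^{3/4}`, and the increments are `O(N^{-1/4})`: a convergent geometric series
(`norm_integral_le_of_bounded`).

The remainder `ψ Q_k` tends to zero uniformly, which suffices for bounded `f_j`. Absolute
convergence for general `f_j` comes from the Loomis-Whitney inequality, since `L^{8/3}` lies in `L²`
on bounded sets, and the estimate passes to general `f_j` by truncation. -/

theorem lintegral_mul_le_sqrt_mul_sqrt {α : Type*} [MeasurableSpace α] (μ : Measure α)
    {f g : α → ℝ≥0∞} (hf : AEMeasurable f μ) (hg : AEMeasurable g μ) :
    ∫⁻ a, f a * g a ∂μ ≤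
      (∫⁻ a, f a ^ 2 ∂μ) ^ (1 / 2 : ℝ) * (∫⁻ a, g a ^ 2 ∂μ) ^ (1 / 2 : ℝ) := by
  have h := ENNReal.lintegral_mul_le_Lp_mul_Lq μ Real.HolderConjugate.two_two hf hg
  simpa using h

theorem ENNReal.rpow_half_sq (a : ℝ≥0∞) : (a ^ (1 / 2 : ℝ)) ^ 2 = a := by
  rw [← ENNReal.rpow_natCast, ← ENNReal.rpow_mul]; norm_num

theorem ENNReal.sq_rpow_half (a : ℝ≥0∞) : (a ^ 2) ^ (1 / 2 : ℝ) = a := by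
  rw [← ENNReal.rpow_natCast, ← ENNReal.rpow_mul]; norm_num

/-! ### The Loomis-Whitney inequality -/

/-- The Loomis-Whitney inequality in three dimensions. -/
theorem loomis_whitney_three {α β γ : Type*} [MeasurableSpace α] [MeasurableSpace β]
    [MeasurableSpace γ] (μ : Measure α) (ν : Measure β) (ρ : Measure γ) [SFinite μ] [SFinite ν]
    [SFinite ρ] {f : β × γ → ℝ≥0∞} {g : α × γ → ℝ≥0∞} {h : α × β → ℝ≥0∞}
    (hf : Measurable f) (hg : Measurable g) (hh : Measurable h) :
    ∫⁻ x, ∫⁻ y, ∫⁻ z, f (y, z) * g (x, z) * h (x, y) ∂ρ ∂ν ∂μ ≤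
      (∫⁻ y, ∫⁻ z, f (y, z) ^ 2 ∂ρ ∂ν) ^ (1 / 2 : ℝ) *
        (∫⁻ x, ∫⁻ z, g (x, z) ^ 2 ∂ρ ∂μ) ^ (1 / 2 : ℝ) *
        (∫⁻ x, ∫⁻ y, h (x, y) ^ 2 ∂ν ∂μ) ^ (1 / 2 : ℝ) := by
  set F : β → ℝ≥0∞ := fun y => ∫⁻ z, f (y, z) ^ 2 ∂ρ
  set G : α → ℝ≥0∞ := fun x => ∫⁻ z, g (x, z) ^ 2 ∂ρ
  have hF : Measurable F := (hf.pow_const 2).lintegral_prod_right'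
  have hG : Measurable G := (hg.pow_const 2).lintegral_prod_right'
  -- Cauchy-Schwarz in `z` with `x`, `y` frozen. A second Cauchy-Schwarz in `(x, y)` then suffices,
  -- because the square of the bound is the tensor product `F y * G x` and its integral factors.
  have h1 : ∀ x y, ∫⁻ z, f (y, z) * g (x, z) * h (x, y) ∂ρ ≤
      (F y ^ (1 / 2 : ℝ) * G x ^ (1 / 2 : ℝ)) * h (x, y) := fun x y => by
    rw [lintegral_mul_const _ (by fun_prop)]
    gcongr
    exact lintegral_mul_le_sqrt_mul_sqrt ρ (by fun_prop) (by fun_prop)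
  calc ∫⁻ x, ∫⁻ y, ∫⁻ z, f (y, z) * g (x, z) * h (x, y) ∂ρ ∂ν ∂μ
      ≤ ∫⁻ x, ∫⁻ y, (F y ^ (1 / 2 : ℝ) * G x ^ (1 / 2 : ℝ)) * h (x, y) ∂ν ∂μ := by
        gcongr with x y; exact h1 x y
    _ = ∫⁻ p, (F p.2 ^ (1 / 2 : ℝ) * G p.1 ^ (1 / 2 : ℝ)) * h p ∂(μ.prod ν) := by
        rw [lintegral_prod _ (by fun_prop)]
    _ ≤ (∫⁻ p, (F p.2 ^ (1 / 2 : ℝ) * G p.1 ^ (1 / 2 : ℝ)) ^ 2 ∂(μ.prod ν)) ^ (1 / 2 : ℝ) *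
          (∫⁻ p, h p ^ 2 ∂(μ.prod ν)) ^ (1 / 2 : ℝ) :=
        lintegral_mul_le_sqrt_mul_sqrt _ (by fun_prop) (by fun_prop)
    _ = _ := by
        rw [lintegral_prod _ (by fun_prop), lintegral_prod _ (by fun_prop)]
        congr 1
        rw [← ENNReal.mul_rpow_of_nonneg _ _ (by norm_num)]
        congr 1
        simp_rw [mul_pow, ENNReal.rpow_half_sq]
        simp_rw [lintegral_mul_const _ hF]
        rw [lintegral_const_mul _ hG]

/-! ### The Hardy-Littlewood-Sobolev inequality on the line -/

theorem lintegral_comp_abs_le (h : ℝ → ℝ≥0∞) (hh : Measurable h) :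
    ∫⁻ u, h |u| ≤ 2 * ∫⁻ u in Set.Ioi 0, h u := by
  have hm : Measurable ((Set.Ioi (0 : ℝ)).indicator h) := hh.indicator measurableSet_Ioi
  calc ∫⁻ u, h |u|
      ≤ ∫⁻ u, ((Set.Ioi (0 : ℝ)).indicator h u + (Set.Ioi (0 : ℝ)).indicator h (-u)) := by
        refine lintegral_mono_ae ?_
        have : ∀ᵐ u : ℝ, u ≠ 0 := by simp [ae_iff]
        filter_upwards [this] with u hu
        rcases lt_or_gt_of_ne hu with h0 | h0
        · simp [Set.indicator, h0, abs_of_neg h0]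
        · simp [Set.indicator, h0, abs_of_pos h0]
    _ = _ := by
        rw [lintegral_add_left hm, lintegral_neg_eq_self (μ := volume)
          ((Set.Ioi (0 : ℝ)).indicator h), lintegral_indicator measurableSet_Ioi, two_mul]

/-- The kernel `|z - w|^{-1/2}` is integrable at its singularity; this serves the part of the
potential near `z`. -/
theorem lintegral_abs_rpow_neg_half_near (r : ℝ) (hr : 0 < r) (z : ℝ) :
    ∫⁻ w in {w | |z - w| < r}, ENNReal.ofReal |z - w| ^ (-(1 / 2) : ℝ) ≤
      4 * ENNReal.ofReal r ^ (1 / 2 : ℝ) := by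
  have hms : MeasurableSet {w : ℝ | |z - w| < r} :=
    measurableSet_lt (by fun_prop) measurable_const
  rw [← lintegral_indicator hms]
  set h : ℝ → ℝ≥0∞ := (Set.Iio r).indicator fun u => ENNReal.ofReal u ^ (-(1 / 2) : ℝ)
  have hm : Measurable h := Measurable.indicator (by fun_prop) measurableSet_Iio
  have e : ∀ w, ({w : ℝ | |z - w| < r}.indicator
      (fun w => ENNReal.ofReal |z - w| ^ (-(1 / 2) : ℝ)) w) = h |z - w| := fun w => by
    simp [h, Set.indicator]
  simp_rw [e]
  rw [lintegral_sub_left_eq_self (μ := volume) (fun u => h |u|) z]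
  refine (lintegral_comp_abs_le h hm).trans ?_
  rw [setLIntegral_indicator measurableSet_Iio]
  have e2 : Set.Iio r ∩ Set.Ioi 0 = Set.Ioo 0 r := by ext; simp [and_comm]
  rw [e2]
  have e3 : ∫⁻ u in Set.Ioo 0 r, ENNReal.ofReal u ^ (-(1 / 2) : ℝ) =
      ∫⁻ u in Set.Ioo 0 r, ENNReal.ofReal (u ^ (-(1 / 2) : ℝ)) := by
    refine setLIntegral_congr_fun measurableSet_Ioo fun u hu => ?_
    exact ENNReal.ofReal_rpow_of_pos hu.1
  have hint : IntervalIntegrable (fun u : ℝ => u ^ (-(1 / 2) : ℝ)) volume 0 r :=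
    intervalIntegral.intervalIntegrable_rpow' (by norm_num)
  rw [e3, ← ofReal_integral_eq_lintegral_ofReal, ← integral_Ioc_eq_integral_Ioo,
    ← intervalIntegral.integral_of_le hr.le, integral_rpow (Or.inl (by norm_num))]
  · rw [ENNReal.ofReal_rpow_of_pos hr, show (2 : ℝ≥0∞) = ENNReal.ofReal 2 by simp,
      show (4 : ℝ≥0∞) = ENNReal.ofReal 4 by simp, ← ENNReal.ofReal_mul (by norm_num),
      ← ENNReal.ofReal_mul (by norm_num)]
    refine ENNReal.ofReal_le_ofReal (le_of_eq ?_)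
    norm_num
    ring
  · exact ((intervalIntegrable_iff_integrableOn_Ioo_of_le hr.le).1 hint)
  · filter_upwards [ae_restrict_mem measurableSet_Ioo] with u hu
    exact Real.rpow_nonneg hu.1.le _

/-- The exponent `-2` is that of the fourth power of `|z - w|^{-1/2}`, which is what Hölder with
exponents `4/3` and `4` produces away from `z`. -/
theorem lintegral_abs_rpow_neg_two_far (r : ℝ) (hr : 0 < r) (z : ℝ) :
    ∫⁻ w in {w | r ≤ |z - w|}, ENNReal.ofReal |z - w| ^ (-2 : ℝ) ≤
      2 * ENNReal.ofReal r ^ (-1 : ℝ) := by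
  have hms : MeasurableSet {w : ℝ | r ≤ |z - w|} :=
    measurableSet_le measurable_const (by fun_prop)
  rw [← lintegral_indicator hms]
  set h : ℝ → ℝ≥0∞ := (Set.Ici r).indicator fun u => ENNReal.ofReal u ^ (-2 : ℝ)
  have hm : Measurable h := Measurable.indicator (by fun_prop) measurableSet_Ici
  have e : ∀ w, ({w : ℝ | r ≤ |z - w|}.indicator
      (fun w => ENNReal.ofReal |z - w| ^ (-2 : ℝ)) w) = h |z - w| := fun w => by
    simp [h, Set.indicator]
  simp_rw [e]
  rw [lintegral_sub_left_eq_self (μ := volume) (fun u => h |u|) z]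
  refine (lintegral_comp_abs_le h hm).trans ?_
  rw [setLIntegral_indicator measurableSet_Ici]
  have e2 : Set.Ici r ∩ Set.Ioi 0 = Set.Ici r := by
    ext x; simp only [Set.mem_inter_iff, Set.mem_Ici, Set.mem_Ioi]
    constructor
    · exact fun h => h.1
    · exact fun h => ⟨h, hr.trans_le h⟩
  rw [e2, setLIntegral_congr Ioi_ae_eq_Ici.symm]
  have e3 : ∫⁻ u in Set.Ioi r, ENNReal.ofReal u ^ (-2 : ℝ) =
      ∫⁻ u in Set.Ioi r, ENNReal.ofReal (u ^ (-2 : ℝ)) := by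
    refine setLIntegral_congr_fun measurableSet_Ioi fun u hu => ?_
    exact ENNReal.ofReal_rpow_of_pos (hr.trans hu)
  rw [e3, ← ofReal_integral_eq_lintegral_ofReal, integral_Ioi_rpow_of_lt (by norm_num) hr]
  · rw [ENNReal.ofReal_rpow_of_pos hr, show (2 : ℝ≥0∞) = ENNReal.ofReal 2 by simp,
      ← ENNReal.ofReal_mul (by norm_num), ← ENNReal.ofReal_mul (by norm_num)]
    refine ENNReal.ofReal_le_ofReal (le_of_eq ?_)
    norm_num
  · exact integrableOn_Ioi_rpow_of_lt (by norm_num) hr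
  · filter_upwards [ae_restrict_mem measurableSet_Ioi] with u hu
    exact Real.rpow_nonneg (hr.trans hu).le _

/-- Hardy-Littlewood-Sobolev potential estimate with a truncated source. -/
theorem lintegral_truncated_potential_le {μ : Measure ℝ} (hμ : μ ≤ volume) {g : ℝ → ℝ≥0∞}
    (hg : Measurable g) (z : ℝ) (hz : g z ≠ ⊤) (hG : ∫⁻ w, g w ^ (4 / 3 : ℝ) ∂μ ≠ ⊤)
    (hG0 : ∫⁻ w, g w ^ (4 / 3 : ℝ) ∂μ ≠ 0) :
    g z * ∫⁻ w in {w | g w ≤ g z}, g w * ENNReal.ofReal |z - w| ^ (-(1 / 2) : ℝ) ∂μ ≤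
      6 * (∫⁻ w, g w ^ (4 / 3 : ℝ) ∂μ) ^ (1 / 2 : ℝ) * g z ^ (4 / 3 : ℝ) := by
  rcases eq_or_ne (g z) 0 with h0 | h0
  · simp [h0]
  set G := ∫⁻ w, g w ^ (4 / 3 : ℝ) ∂μ with hGdef
  -- The radius at which the near and far contributions have the same order `G^{1/2} (g z)^{1/3}`.
  set r : ℝ≥0∞ := G / g z ^ (4 / 3 : ℝ) with hr
  have hgz0 : g z ^ (4 / 3 : ℝ) ≠ 0 := by simp [h0, hz]
  have hgzt : g z ^ (4 / 3 : ℝ) ≠ ⊤ := by simp [h0, hz]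
  have hrt : r ≠ ⊤ := ENNReal.div_ne_top hG hgz0
  have hr0 : r ≠ 0 := by simp [hr, hG0, hgzt]
  have hrr : ENNReal.ofReal r.toReal = r := ENNReal.ofReal_toReal hrt
  have hrp : 0 < r.toReal := ENNReal.toReal_pos hr0 hrt
  set k : ℝ → ℝ≥0∞ := fun w => ENNReal.ofReal |z - w| ^ (-(1 / 2) : ℝ)
  have hk : Measurable k := by fun_prop
  have hA : MeasurableSet {w | g w ≤ g z} := measurableSet_le hg measurable_const
  have hN : MeasurableSet {w : ℝ | |z - w| < r.toReal} :=
    measurableSet_lt (by fun_prop) measurable_const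
  have hNc : {w : ℝ | |z - w| < r.toReal}ᶜ = {w : ℝ | r.toReal ≤ |z - w|} := by
    ext; simp
  -- Near `z` the truncation `g w ≤ g z` allows `g w` to be replaced by the constant `g z`.
  have near : ∫⁻ w in {w | |z - w| < r.toReal}, {w | g w ≤ g z}.indicator
      (fun w => g w * k w) w ∂μ ≤ g z * (4 * r ^ (1 / 2 : ℝ)) := by
    calc _ ≤ ∫⁻ w in {w | |z - w| < r.toReal}, g z * k w ∂μ := by
          gcongr with w
          simp only [Set.indicator, Set.mem_ofPred_eq]
          split_ifs with hw
          · gcongr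
          · simp
      _ = g z * ∫⁻ w in {w | |z - w| < r.toReal}, k w ∂μ := lintegral_const_mul _ hk
      _ ≤ g z * ∫⁻ w in {w | |z - w| < r.toReal}, k w := by gcongr
      _ ≤ _ := by
        gcongr
        have := lintegral_abs_rpow_neg_half_near r.toReal hrp z
        rwa [hrr] at this
  have far : ∫⁻ w in {w | |z - w| < r.toReal}ᶜ, {w | g w ≤ g z}.indicator
      (fun w => g w * k w) w ∂μ ≤ G ^ (3 / 4 : ℝ) * (2 * r ^ (-1 : ℝ)) ^ (1 / 4 : ℝ) := by
    rw [hNc]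
    calc _ ≤ ∫⁻ w in {w | r.toReal ≤ |z - w|}, (g * k) w ∂μ := by
          gcongr with w
          exact Set.indicator_le_self _ _ _
      _ ≤ _ := ENNReal.lintegral_mul_le_Lp_mul_Lq _
            (p := 4 / 3) (q := 4) ⟨by norm_num, by norm_num, by norm_num⟩ hg.aemeasurable
            hk.aemeasurable
      _ ≤ _ := by
        gcongr
        · rw [show (1 / (4 / 3) : ℝ) = 3 / 4 by norm_num]
          gcongr
          exact setLIntegral_le_lintegral _ _
        · have := lintegral_abs_rpow_neg_two_far r.toReal hrp z
          rw [hrr] at this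
          refine le_trans ?_ this
          calc _ ≤ ∫⁻ w in {w | r.toReal ≤ |z - w|}, k w ^ (4 : ℝ) := by gcongr
            _ = _ := by
              refine lintegral_congr fun w => ?_
              rw [← ENNReal.rpow_mul]; norm_num
  rw [← lintegral_indicator hA, ← lintegral_add_compl _ hN]
  refine (mul_le_mul_right (add_le_add near far) _).trans ?_
  have hgz : ∀ a : ℝ, (g z ^ (4 / 3 : ℝ)) ^ a = g z ^ (4 / 3 * a) := fun a => by
    rw [ENNReal.rpow_mul]
  have e1 : g z * (4 * r ^ (1 / 2 : ℝ)) = 4 * G ^ (1 / 2 : ℝ) * g z ^ (1 / 3 : ℝ) := by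
    rw [hr, ENNReal.div_rpow_of_nonneg _ _ (by norm_num), hgz, div_eq_mul_inv,
      ← ENNReal.rpow_neg]
    rw [show g z * (4 * (G ^ (1 / 2 : ℝ) * g z ^ (-(4 / 3 * (1 / 2)) : ℝ))) =
      4 * G ^ (1 / 2 : ℝ) * (g z ^ (1 : ℝ) * g z ^ (-(4 / 3 * (1 / 2)) : ℝ)) by
        rw [ENNReal.rpow_one]; ring, ← ENNReal.rpow_add _ _ h0 hz]
    norm_num
  have e2 : G ^ (3 / 4 : ℝ) * (2 * r ^ (-1 : ℝ)) ^ (1 / 4 : ℝ) ≤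
      2 * G ^ (1 / 2 : ℝ) * g z ^ (1 / 3 : ℝ) := by
    rw [ENNReal.mul_rpow_of_nonneg _ _ (by norm_num), ← ENNReal.rpow_mul, hr,
      ENNReal.div_eq_inv_mul, ENNReal.mul_rpow_of_ne_zero (by simp [hgzt]) hG0,
      ENNReal.inv_rpow, hgz, ← ENNReal.rpow_neg]
    rw [show G ^ (3 / 4 : ℝ) * (2 ^ (1 / 4 : ℝ) * (g z ^ (-(4 / 3 * (-1 * (1 / 4))) : ℝ) *
      G ^ (-1 * (1 / 4) : ℝ))) = 2 ^ (1 / 4 : ℝ) * (G ^ (3 / 4 : ℝ) * G ^ (-1 * (1 / 4) : ℝ)) *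
        g z ^ (-(4 / 3 * (-1 * (1 / 4))) : ℝ) by ring, ← ENNReal.rpow_add _ _ hG0 hG]
    have : (2 : ℝ≥0∞) ^ (1 / 4 : ℝ) ≤ 2 := by
      conv_rhs => rw [← ENNReal.rpow_one 2]
      exact ENNReal.rpow_le_rpow_of_exponent_le (by norm_num) (by norm_num)
    norm_num at this ⊢
    gcongr
  calc g z * (g z * (4 * r ^ (1 / 2 : ℝ)) + G ^ (3 / 4 : ℝ) * (2 * r ^ (-1 : ℝ)) ^ (1 / 4 : ℝ))
      ≤ g z * (4 * G ^ (1 / 2 : ℝ) * g z ^ (1 / 3 : ℝ) +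
          2 * G ^ (1 / 2 : ℝ) * g z ^ (1 / 3 : ℝ)) := by rw [e1]; gcongr
    _ = 6 * G ^ (1 / 2 : ℝ) * (g z ^ (1 : ℝ) * g z ^ (1 / 3 : ℝ)) := by
        rw [ENNReal.rpow_one]; ring
    _ = _ := by rw [← ENNReal.rpow_add _ _ h0 hz]; norm_num

/-- The Hardy-Littlewood-Sobolev inequality on the line with kernel `|z - w|^{-1/2}`. -/
theorem lintegral_lintegral_mul_abs_rpow_neg_half_le {μ : Measure ℝ} [SFinite μ]
    (hμ : μ ≤ volume) {g : ℝ → ℝ≥0∞} (hg : Measurable g) (hgt : ∀ z, g z ≠ ⊤) :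
    ∫⁻ z, ∫⁻ w, g z * g w * ENNReal.ofReal |z - w| ^ (-(1 / 2) : ℝ) ∂μ ∂μ ≤
      12 * (∫⁻ w, g w ^ (4 / 3 : ℝ) ∂μ) ^ (3 / 2 : ℝ) := by
  set G := ∫⁻ w, g w ^ (4 / 3 : ℝ) ∂μ with hG
  rcases eq_or_ne G 0 with h0 | h0
  · have : ∀ᵐ w ∂μ, g w = 0 := by
      rw [hG, lintegral_eq_zero_iff (by fun_prop)] at h0
      filter_upwards [h0] with w hw
      have := hw
      simp only [Pi.zero_apply, ENNReal.rpow_eq_zero_iff] at this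
      rcases this with h | h
      · exact h.1
      · exact absurd h.1 (hgt w)
    have e : ∫⁻ z, ∫⁻ w, g z * g w * ENNReal.ofReal |z - w| ^ (-(1 / 2) : ℝ) ∂μ ∂μ =
        ∫⁻ z, 0 ∂μ := by
      refine lintegral_congr_ae ?_
      filter_upwards [this] with z hz
      simp [hz]
    rw [e]; simp
  rcases eq_or_ne G ⊤ with ht | ht
  · rw [ht]; simp
  -- By symmetry of the kernel it is enough to integrate over pairs with `g w ≤ g z`, at the cost of
  -- a factor two. This is what lets the truncated potential bound apply without any maximal
  -- function.
  set h : ℝ → ℝ → ℝ≥0∞ := fun z w => {w | g w ≤ g z}.indicator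
    (fun w => g z * (g w * ENNReal.ofReal |z - w| ^ (-(1 / 2) : ℝ))) w with hh
  have hhm : Measurable (Function.uncurry h) := by
    have : Function.uncurry h = {p : ℝ × ℝ | g p.2 ≤ g p.1}.indicator
      (fun p => g p.1 * (g p.2 * ENNReal.ofReal |p.1 - p.2| ^ (-(1 / 2) : ℝ))) := by
      ext p; simp [h, Set.indicator, Function.uncurry]
    rw [this]
    exact Measurable.indicator (by fun_prop) (measurableSet_le (by fun_prop) (by fun_prop))
  have hle : ∀ z w, g z * g w * ENNReal.ofReal |z - w| ^ (-(1 / 2) : ℝ) ≤ h z w + h w z := by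
    intro z w
    rcases le_total (g w) (g z) with hc | hc
    · refine le_add_right (le_of_eq ?_)
      simp [h, Set.indicator, hc, mul_assoc]
    · refine le_add_left (le_of_eq ?_)
      simp only [h, Set.indicator, Set.mem_ofPred_eq, hc, if_true]
      rw [abs_sub_comm, ← mul_assoc, mul_comm (g z)]
  have hone : ∫⁻ z, ∫⁻ w, h z w ∂μ ∂μ ≤ 6 * G ^ (3 / 2 : ℝ) := by
    calc _ ≤ ∫⁻ z, 6 * G ^ (1 / 2 : ℝ) * g z ^ (4 / 3 : ℝ) ∂μ := by
          gcongr with z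
          have := lintegral_truncated_potential_le hμ hg z (hgt z) ht h0
          refine le_trans (le_of_eq ?_) this
          have hA : MeasurableSet {w | g w ≤ g z} := measurableSet_le hg measurable_const
          rw [← lintegral_const_mul _ (by fun_prop), lintegral_indicator hA]
      _ = 6 * G ^ (1 / 2 : ℝ) * G := lintegral_const_mul _ (by fun_prop)
      _ = 6 * (G ^ (1 / 2 : ℝ) * G ^ (1 : ℝ)) := by rw [ENNReal.rpow_one, mul_assoc]
      _ = _ := by rw [← ENNReal.rpow_add _ _ h0 ht]; norm_num
  calc _ ≤ ∫⁻ z, ∫⁻ w, (h z w + h w z) ∂μ ∂μ := by gcongr with z w; exact hle z w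
    _ = ∫⁻ z, ∫⁻ w, h z w ∂μ ∂μ + ∫⁻ z, ∫⁻ w, h w z ∂μ ∂μ := by
      rw [← lintegral_add_left hhm.lintegral_prod_right]
      refine lintegral_congr fun z => ?_
      rw [lintegral_add_left hhm.of_uncurry_left]
    _ = ∫⁻ z, ∫⁻ w, h z w ∂μ ∂μ + ∫⁻ z, ∫⁻ w, h z w ∂μ ∂μ := by
      congr 1
      exact lintegral_lintegral_swap (hhm.comp measurable_swap).aemeasurable
    _ ≤ 6 * G ^ (3 / 2 : ℝ) + 6 * G ^ (3 / 2 : ℝ) := add_le_add hone hone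
    _ = _ := by rw [← add_mul]; norm_num

/-! ### The `TT*` method, Schur's test and the oscillatory kernel -/

theorem integrable_of_forall_norm_le {α : Type*} [MeasurableSpace α] {μ : Measure α}
    [IsFiniteMeasure μ] {f : α → ℂ} (hf : Measurable f) {B : ℝ} (hB : ∀ x, ‖f x‖ ≤ B) :
    Integrable f μ :=
  Integrable.of_bound hf.aestronglyMeasurable B (Filter.Eventually.of_forall hB)

/-- The `TT*` inequality. -/
theorem lintegral_enorm_integral_sq_le {α β : Type*} [MeasurableSpace α] [MeasurableSpace β]
    (μ : Measure α) (ν : Measure β) [IsFiniteMeasure μ] [IsFiniteMeasure ν] {k : α → β → ℂ}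
    (hk : Measurable (Function.uncurry k)) {B : ℝ} (hB : ∀ x y, ‖k x y‖ ≤ B) :
    ∫⁻ x, ‖∫ y, k x y ∂ν‖ₑ ^ 2 ∂μ ≤
      ∫⁻ y, ∫⁻ y', ‖∫ x, k x y * conj (k x y') ∂μ‖ₑ ∂ν ∂ν := by
  set H : α → ℂ := fun x => ∫ y, k x y ∂ν
  have hH : Measurable H := hk.stronglyMeasurable.integral_prod_right.measurable
  have hprod : ∀ x, H x * conj (H x) = ∫ p, k x p.1 * conj (k x p.2) ∂(ν.prod ν) := fun x => by
    rw [integral_prod_mul (fun y => k x y) (fun y => conj (k x y)), integral_conj]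
  have hkm : Measurable (fun q : α × β × β => k q.1 q.2.1 * conj (k q.1 q.2.2)) := by
    have h1 : Measurable (fun q : α × β × β => k q.1 q.2.1) :=
      hk.comp (f := fun q : α × β × β => (q.1, q.2.1)) (by fun_prop)
    have h2 : Measurable (fun q : α × β × β => k q.1 q.2.2) :=
      hk.comp (f := fun q : α × β × β => (q.1, q.2.2)) (by fun_prop)
    exact h1.mul (Complex.continuous_conj.measurable.comp h2)
  have hkb : ∀ q : α × β × β, ‖k q.1 q.2.1 * conj (k q.1 q.2.2)‖ ≤ B * B := fun q => by
    rw [norm_mul, RCLike.norm_conj]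
    exact mul_le_mul (hB _ _) (hB _ _) (norm_nonneg _) ((norm_nonneg _).trans (hB q.1 q.2.1))
  have hI := integrable_of_forall_norm_le (μ := μ.prod (ν.prod ν)) hkm hkb
  have hswap : ∫ x, H x * conj (H x) ∂μ =
      ∫ p, ∫ x, k x p.1 * conj (k x p.2) ∂μ ∂(ν.prod ν) := by
    simp_rw [hprod]
    exact integral_integral_swap hI
  -- The iterated integral is a nonnegative real number, so its norm is the square integral itself;
  -- moduli enter only after Fubini, which keeps the cancellation in the `x`-integral.
  have hsq : ∀ x, H x * conj (H x) = ((‖H x‖ ^ 2 : ℝ) : ℂ) := fun x => by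
    rw [Complex.mul_conj, Complex.normSq_eq_norm_sq]
  have hHI : Integrable (fun x => ((‖H x‖ ^ 2 : ℝ) : ℂ)) μ := by
    simp_rw [← hsq, hprod]
    exact hI.integral_prod_left
  have hHr : Integrable (fun x => ‖H x‖ ^ 2) μ := by
    have := hHI.norm
    simpa using this
  have e1 : ∫⁻ x, ‖H x‖ₑ ^ 2 ∂μ = ‖∫ x, H x * conj (H x) ∂μ‖ₑ := by
    simp_rw [hsq]
    rw [integral_complex_ofReal, ← ofReal_norm, Complex.norm_real, Real.norm_of_nonneg
      (integral_nonneg fun x => by positivity), ofReal_integral_eq_lintegral_ofReal hHr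
      (Filter.Eventually.of_forall fun x => by positivity)]
    refine lintegral_congr fun x => ?_
    rw [← ofReal_norm, ENNReal.ofReal_pow (norm_nonneg _)]
  rw [e1, hswap]
  refine (enorm_integral_le_lintegral_enorm _).trans (le_of_eq ?_)
  have hm : Measurable fun p : β × β => ∫ x, k x p.1 * conj (k x p.2) ∂μ :=
    hkm.stronglyMeasurable.integral_prod_left'.measurable
  rw [lintegral_prod _ hm.enorm.aemeasurable]

/-- Schur's test for a symmetric kernel. -/
theorem lintegral_lintegral_mul_kernel_le {α : Type*} [MeasurableSpace α] (μ : Measure α)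
    [SFinite μ] {k : α → α → ℝ≥0∞} (hk : Measurable (Function.uncurry k))
    (hsymm : ∀ x y, k x y = k y x) {A : ℝ≥0∞} (hA : ∀ x, ∫⁻ y, k x y ∂μ ≤ A)
    {F : α → ℝ≥0∞} (hF : Measurable F) :
    ∫⁻ x, ∫⁻ y, F x * F y * k x y ∂μ ∂μ ≤ 2 * A * ∫⁻ x, F x ^ 2 ∂μ := by
  have hle : ∀ a b : ℝ≥0∞, a * b ≤ a ^ 2 + b ^ 2 := fun a b => by
    rcases le_total a b with h | h
    · exact le_add_left (by rw [sq]; gcongr)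
    · exact le_add_right (by rw [sq]; gcongr)
  have hkx : ∀ x, Measurable (k x) := fun x => hk.of_uncurry_left
  have h1 : ∫⁻ x, ∫⁻ y, F x ^ 2 * k x y ∂μ ∂μ ≤ A * ∫⁻ x, F x ^ 2 ∂μ := by
    rw [← lintegral_const_mul _ (by fun_prop)]
    gcongr with x
    rw [lintegral_const_mul _ (hkx x), mul_comm]
    gcongr
    exact hA x
  calc _ ≤ ∫⁻ x, ∫⁻ y, (F x ^ 2 * k x y + F y ^ 2 * k y x) ∂μ ∂μ := by
        gcongr with x y
        rw [hsymm y x, ← add_mul]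
        gcongr
        exact hle _ _
    _ = ∫⁻ x, ∫⁻ y, F x ^ 2 * k x y ∂μ ∂μ + ∫⁻ x, ∫⁻ y, F y ^ 2 * k y x ∂μ ∂μ := by
      have hm : Measurable (Function.uncurry fun x y => F x ^ 2 * k x y) := by
        exact ((hF.comp measurable_fst).pow_const 2).mul hk
      rw [← lintegral_add_left hm.lintegral_prod_right]
      refine lintegral_congr fun x => ?_
      rw [lintegral_add_left]
      exact hm.of_uncurry_left
    _ = ∫⁻ x, ∫⁻ y, F x ^ 2 * k x y ∂μ ∂μ + ∫⁻ x, ∫⁻ y, F x ^ 2 * k x y ∂μ ∂μ := by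
      congr 1
      have hm : Measurable (Function.uncurry fun x y => F y ^ 2 * k y x) :=
        ((hF.comp measurable_snd).pow_const 2).mul (hk.comp measurable_swap)
      exact lintegral_lintegral_swap hm.aemeasurable
    _ ≤ A * ∫⁻ x, F x ^ 2 ∂μ + A * ∫⁻ x, F x ^ 2 ∂μ := add_le_add h1 h1
    _ = _ := by ring

/-- The decaying kernel produced by two integrations by parts. -/
noncomputable def cauchyKernel (l θ s t : ℝ) : ℝ := l / (1 + (θ * l * |s| * |t|) ^ 2)

/-- The substitution `u ↦ θ l |t| u` cancels the factor `l` in the numerator, so the mass does not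
depend on the scale `l`; this is why no box size survives in the final estimate. At `t = 0` the
right side is `⊤`. -/
theorem lintegral_cauchyKernel_le {l θ : ℝ} (hl : 0 < l) (hθ : 0 < θ) (t y : ℝ) {μ : Measure ℝ}
    (hμ : μ ≤ volume) :
    ∫⁻ y', ENNReal.ofReal (cauchyKernel l θ (y - y') t) ∂μ ≤
      ENNReal.ofReal (Real.pi / θ) * (ENNReal.ofReal |t|) ^ (-1 : ℝ) := by
  rcases eq_or_ne t 0 with rfl | ht
  · have h0 : (0 : ℝ) < Real.pi / θ := by positivity
    simp [ENNReal.rpow_neg_one, ENNReal.mul_top, h0]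
  refine (lintegral_mono' hμ le_rfl).trans ?_
  rw [lintegral_sub_left_eq_self (μ := volume)
    (fun u => ENNReal.ofReal (cauchyKernel l θ u t)) y]
  set c := θ * l * |t| with hc
  have hcp : 0 < c := by positivity
  have e : ∀ u, cauchyKernel l θ u t = l * (1 + (c * u) ^ 2)⁻¹ := fun u => by
    rw [cauchyKernel, div_eq_mul_inv, hc]
    congr 3
    rw [show (θ * l * |u| * |t|) ^ 2 = (θ * l * |t|) ^ 2 * |u| ^ 2 by ring, sq_abs u]
    ring
  have hint : Integrable (fun u : ℝ => l * (1 + (c * u) ^ 2)⁻¹) :=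
    ((integrable_inv_one_add_sq.comp_mul_left' hcp.ne').const_mul l)
  simp_rw [e]
  rw [← ofReal_integral_eq_lintegral_ofReal hint
    (Filter.Eventually.of_forall fun u => by positivity), integral_const_mul,
    Measure.integral_comp_mul_left (fun u : ℝ => (1 + u ^ 2)⁻¹) c, integral_univ_inv_one_add_sq,
    ENNReal.ofReal_rpow_of_pos (abs_pos.2 ht), ← ENNReal.ofReal_mul (by positivity)]
  refine ENNReal.ofReal_le_ofReal (le_of_eq ?_)
  rw [abs_of_pos (by positivity), Real.rpow_neg_one, hc, smul_eq_mul]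
  field_simp

/-! ### The square function estimate -/

/-- Square function estimate for a kernel satisfying a fourfold orthogonality bound. -/
theorem lintegral_enorm_integral_kernel_sq_le (μ ν ρ : Measure ℝ) [IsFiniteMeasure μ]
    [IsFiniteMeasure ν] [IsFiniteMeasure ρ] (hν : ν ≤ volume) (hρ : ρ ≤ volume)
    {E : ℝ → ℝ → ℝ → ℂ} (hE : Measurable fun p : ℝ × ℝ × ℝ => E p.1 p.2.1 p.2.2) {B : ℝ}
    (hB : ∀ x y z, ‖E x y z‖ ≤ B) {A l θ : ℝ} (hA : 0 ≤ A) (hl : 0 < l) (hθ : 0 < θ)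
    (hK : ∀ y y' z z', ‖∫ x, E x y z * conj (E x y z') * conj (E x y' z * conj (E x y' z')) ∂μ‖ ≤
      A * cauchyKernel l θ (y - y') (z - z'))
    {g₁ g₂ : ℝ → ℝ → ℂ} (hg₁ : Measurable (Function.uncurry g₁))
    (hg₂ : Measurable (Function.uncurry g₂)) {B₁ B₂ : ℝ} (hB₁ : ∀ y z, ‖g₁ y z‖ ≤ B₁)
    (hB₂ : ∀ x z, ‖g₂ x z‖ ≤ B₂) :
    ∫⁻ x, ∫⁻ y, ‖∫ z, E x y z * g₁ y z * g₂ x z ∂ρ‖ₑ ^ 2 ∂ν ∂μ ≤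
      12 * ENNReal.ofReal (2 * Real.pi * A / θ) ^ (1 / 2 : ℝ) *
        (∫⁻ y, (∫⁻ z, ‖g₁ y z‖ₑ ^ (8 / 3 : ℝ) ∂ρ) ^ (3 / 2 : ℝ) ∂ν) ^ (1 / 2 : ℝ) *
        (∫⁻ x, (∫⁻ z, ‖g₂ x z‖ₑ ^ (8 / 3 : ℝ) ∂ρ) ^ (3 / 2 : ℝ) ∂μ) ^ (1 / 2 : ℝ) := by
  have hEc : ∀ {γ : Type} [MeasurableSpace γ] {a b c : γ → ℝ}, Measurable a → Measurable b →
      Measurable c → Measurable fun p => E (a p) (b p) (c p) := fun ha hb hc =>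
    hE.comp (ha.prodMk (hb.prodMk hc))
  have hg₁c : ∀ {γ : Type} [MeasurableSpace γ] {a b : γ → ℝ}, Measurable a → Measurable b →
      Measurable fun p => g₁ (a p) (b p) := fun ha hb => hg₁.comp (ha.prodMk hb)
  have hg₂c : ∀ {γ : Type} [MeasurableSpace γ] {a b : γ → ℝ}, Measurable a → Measurable b →
      Measurable fun p => g₂ (a p) (b p) := fun ha hb => hg₂.comp (ha.prodMk hb)
  have hconj : Measurable (fun w : ℂ => conj w) := Complex.continuous_conj.measurable
  have hB0 : 0 ≤ B := (norm_nonneg _).trans (hB 0 0 0)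
  have hB10 : 0 ≤ B₁ := (norm_nonneg _).trans (hB₁ 0 0)
  have hB20 : 0 ≤ B₂ := (norm_nonneg _).trans (hB₂ 0 0)
  -- the inner form, for fixed `z` and `z'`
  set L : ℝ → ℝ → ℝ → ℂ := fun z z' x =>
    ∫ y, E x y z * conj (E x y z') * (g₁ y z * conj (g₁ y z')) ∂ν with hL
  set a₁ : ℝ → ℝ → ℝ≥0∞ := fun z z' => ∫⁻ y, ‖g₁ y z‖ₑ ^ 2 * ‖g₁ y z'‖ₑ ^ 2 ∂ν with ha₁
  set a₂ : ℝ → ℝ → ℝ≥0∞ := fun z z' => ∫⁻ x, ‖g₂ x z‖ₑ ^ 2 * ‖g₂ x z'‖ₑ ^ 2 ∂μ with ha₂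
  set P := ENNReal.ofReal (2 * Real.pi * A / θ) with hP
  set κ : ℝ → ℝ → ℝ≥0∞ := fun z z' => ENNReal.ofReal |z - z'| ^ (-(1 / 2) : ℝ) with hκ
  -- `TT*` in `y` for fixed `z, z'` brings in the fourfold integral of `hK`; Schur's test then costs
  -- the mass of the Cauchy kernel, which is the source of `|z - z'|⁻¹`.
  have hinner : ∀ z z', ∫⁻ x, ‖L z z' x‖ₑ ^ 2 ∂μ ≤
      P * ENNReal.ofReal |z - z'| ^ (-1 : ℝ) * a₁ z z' := by
    intro z z'
    have hm : Measurable (Function.uncurry fun x y =>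
        E x y z * conj (E x y z') * (g₁ y z * conj (g₁ y z'))) := by
      have h1 : Measurable fun p : ℝ × ℝ => E p.1 p.2 z := hEc (by fun_prop) (by fun_prop) (by fun_prop)
      have h2 : Measurable fun p : ℝ × ℝ => E p.1 p.2 z' := hEc (by fun_prop) (by fun_prop) (by fun_prop)
      have h3 : Measurable fun p : ℝ × ℝ => g₁ p.2 z := hg₁c (by fun_prop) (by fun_prop)
      have h4 : Measurable fun p : ℝ × ℝ => g₁ p.2 z' := hg₁c (by fun_prop) (by fun_prop)
      exact (h1.mul (hconj.comp h2)).mul (h3.mul (hconj.comp h4))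
    have hb : ∀ x y, ‖E x y z * conj (E x y z') * (g₁ y z * conj (g₁ y z'))‖ ≤
        B * B * (B₁ * B₁) := fun x y => by
      simp only [norm_mul, RCLike.norm_conj]
      gcongr <;> first | exact hB _ _ _ | exact hB₁ _ _
    refine (lintegral_enorm_integral_sq_le μ ν hm hb).trans ?_
    set F : ℝ → ℝ≥0∞ := fun y => ‖g₁ y z‖ₑ * ‖g₁ y z'‖ₑ with hF
    have hFm : Measurable F := by
      have h3 : Measurable fun y : ℝ => g₁ y z := hg₁c (by fun_prop) (by fun_prop)
      have h4 : Measurable fun y : ℝ => g₁ y z' := hg₁c (by fun_prop) (by fun_prop)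
      exact h3.enorm.mul h4.enorm
    set k : ℝ → ℝ → ℝ≥0∞ := fun y y' => ENNReal.ofReal (A * cauchyKernel l θ (y - y') (z - z'))
    have hkm : Measurable (Function.uncurry k) := by
      simp only [k, cauchyKernel, Function.uncurry_def]
      fun_prop
    have hks : ∀ y y', k y y' = k y' y := fun y y' => by
      simp only [k, cauchyKernel]
      rw [abs_sub_comm]
    have hkA : ∀ y, ∫⁻ y', k y y' ∂ν ≤ ENNReal.ofReal A *
        (ENNReal.ofReal (Real.pi / θ) * (ENNReal.ofReal |z - z'|) ^ (-1 : ℝ)) := fun y => by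
      simp only [k]
      simp_rw [ENNReal.ofReal_mul hA]
      rw [lintegral_const_mul _ (by unfold cauchyKernel; fun_prop)]
      gcongr
      exact lintegral_cauchyKernel_le hl hθ _ _ hν
    have hpt : ∀ y y', ‖∫ x, E x y z * conj (E x y z') * (g₁ y z * conj (g₁ y z')) *
        conj (E x y' z * conj (E x y' z') * (g₁ y' z * conj (g₁ y' z'))) ∂μ‖ₑ ≤
        F y * F y' * k y y' := by
      intro y y'
      have e : ∀ x, E x y z * conj (E x y z') * (g₁ y z * conj (g₁ y z')) *
        conj (E x y' z * conj (E x y' z') * (g₁ y' z * conj (g₁ y' z'))) =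
        (g₁ y z * conj (g₁ y z') * conj (g₁ y' z * conj (g₁ y' z'))) *
        (E x y z * conj (E x y z') * conj (E x y' z * conj (E x y' z'))) := fun x => by
        simp only [map_mul]; ring
      simp_rw [e]
      rw [integral_const_mul, enorm_mul]
      refine mul_le_mul' (le_of_eq ?_) ?_
      · simp only [enorm_mul, RCLike.enorm_conj, hF]
      · rw [← ofReal_norm]
        exact ENNReal.ofReal_le_ofReal (hK y y' z z')
    refine (lintegral_mono fun y => lintegral_mono fun y' => hpt y y').trans ?_
    refine (lintegral_lintegral_mul_kernel_le ν hkm hks hkA hFm).trans (le_of_eq ?_)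
    simp only [hF, mul_pow, ha₁]
    rw [hP, show 2 * Real.pi * A / θ = 2 * (A * (Real.pi / θ)) by ring,
      ENNReal.ofReal_mul (by norm_num), ENNReal.ofReal_mul hA]
    simp only [ENNReal.ofReal_ofNat]
    ring
  have ha₁m : Measurable (Function.uncurry a₁) := by
    have : Measurable fun q : (ℝ × ℝ) × ℝ => ‖g₁ q.2 q.1.1‖ₑ ^ 2 * ‖g₁ q.2 q.1.2‖ₑ ^ 2 :=
      ((hg₁c (by fun_prop) (by fun_prop)).enorm.pow_const 2).mul
        ((hg₁c (by fun_prop) (by fun_prop)).enorm.pow_const 2)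
    exact this.lintegral_prod_right'
  have ha₂m : Measurable (Function.uncurry a₂) := by
    have : Measurable fun q : (ℝ × ℝ) × ℝ => ‖g₂ q.2 q.1.1‖ₑ ^ 2 * ‖g₂ q.2 q.1.2‖ₑ ^ 2 :=
      ((hg₂c (by fun_prop) (by fun_prop)).enorm.pow_const 2).mul
        ((hg₂c (by fun_prop) (by fun_prop)).enorm.pow_const 2)
    exact this.lintegral_prod_right'
  have hκm : Measurable (Function.uncurry κ) := by
    simp only [κ, Function.uncurry_def]; fun_prop
  -- Hardy-Littlewood-Sobolev on each line
  have hHLS : ∀ (g : ℝ → ℝ → ℂ) (τ : Measure ℝ) [IsFiniteMeasure τ],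
      Measurable (Function.uncurry g) →
      ∫⁻ p, κ p.1 p.2 * (∫⁻ y, ‖g y p.1‖ₑ ^ 2 * ‖g y p.2‖ₑ ^ 2 ∂τ) ∂(ρ.prod ρ) ≤
        12 * ∫⁻ y, (∫⁻ z, ‖g y z‖ₑ ^ (8 / 3 : ℝ) ∂ρ) ^ (3 / 2 : ℝ) ∂τ := by
    intro g τ _ hg
    have hgc : ∀ {γ : Type} [MeasurableSpace γ] {a b : γ → ℝ}, Measurable a → Measurable b →
      Measurable fun p => g (a p) (b p) := fun ha hb => hg.comp (ha.prodMk hb)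
    have hm : Measurable fun q : (ℝ × ℝ) × ℝ =>
        κ q.1.1 q.1.2 * (‖g q.2 q.1.1‖ₑ ^ 2 * ‖g q.2 q.1.2‖ₑ ^ 2) :=
      (hκm.comp measurable_fst).mul (((hgc (by fun_prop) (by fun_prop)).enorm.pow_const 2).mul
        ((hgc (by fun_prop) (by fun_prop)).enorm.pow_const 2))
    calc _ = ∫⁻ p, ∫⁻ y, κ p.1 p.2 * (‖g y p.1‖ₑ ^ 2 * ‖g y p.2‖ₑ ^ 2) ∂τ ∂(ρ.prod ρ) := by
          refine lintegral_congr fun p => ?_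
          rw [lintegral_const_mul]
          exact ((hgc (by fun_prop) (by fun_prop)).enorm.pow_const 2).mul
            ((hgc (by fun_prop) (by fun_prop)).enorm.pow_const 2)
      _ = ∫⁻ y, ∫⁻ p, κ p.1 p.2 * (‖g y p.1‖ₑ ^ 2 * ‖g y p.2‖ₑ ^ 2) ∂(ρ.prod ρ) ∂τ :=
          lintegral_lintegral_swap hm.aemeasurable
      _ ≤ ∫⁻ y, 12 * (∫⁻ z, ‖g y z‖ₑ ^ (8 / 3 : ℝ) ∂ρ) ^ (3 / 2 : ℝ) ∂τ := by
          gcongr with y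
          have hy : Measurable fun z => ‖g y z‖ₑ ^ 2 :=
            (hgc (by fun_prop) (by fun_prop)).enorm.pow_const 2
          have hmy : Measurable fun p : ℝ × ℝ =>
              κ p.1 p.2 * (‖g y p.1‖ₑ ^ 2 * ‖g y p.2‖ₑ ^ 2) :=
            hm.comp (f := fun p : ℝ × ℝ => (p, y)) (by fun_prop)
          rw [lintegral_prod _ hmy.aemeasurable]
          have := lintegral_lintegral_mul_abs_rpow_neg_half_le hρ hy (fun z => by simp)
          refine le_trans (le_of_eq ?_) (this.trans (le_of_eq ?_))
          · refine lintegral_congr fun z => lintegral_congr fun w => ?_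
            simp only [κ]; ring
          · congr 3
            ext z
            rw [← ENNReal.rpow_natCast, ← ENNReal.rpow_mul]; norm_num
      _ = _ := by
          rw [lintegral_const_mul]
          have : Measurable fun q : ℝ × ℝ => ‖g q.1 q.2‖ₑ ^ (8 / 3 : ℝ) :=
            hg.enorm.pow_const _
          exact this.lintegral_prod_right'.pow_const _
  -- opening the square in `z`
  have hkm : Measurable (Function.uncurry fun (p : ℝ × ℝ) z =>
      E p.1 p.2 z * g₁ p.2 z * g₂ p.1 z) :=
    ((hEc (by fun_prop) (by fun_prop) (by fun_prop)).mul
      (hg₁c (by fun_prop) (by fun_prop))).mul (hg₂c (by fun_prop) (by fun_prop))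
  have hkb : ∀ (p : ℝ × ℝ) z, ‖E p.1 p.2 z * g₁ p.2 z * g₂ p.1 z‖ ≤ B * B₁ * B₂ :=
    fun p z => by
      simp only [norm_mul]
      gcongr
      · exact hB _ _ _
      · exact hB₁ _ _
      · exact hB₂ _ _
  -- The functions `g₂` do not depend on `y`, so they come out of the `y`-integral and are separated
  -- from `L z z'` by Cauchy-Schwarz in `x`.
  have hpair : ∀ z z', ‖∫ p, (E p.1 p.2 z * g₁ p.2 z * g₂ p.1 z) *
      conj (E p.1 p.2 z' * g₁ p.2 z' * g₂ p.1 z') ∂(μ.prod ν)‖ₑ ≤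
      a₂ z z' ^ (1 / 2 : ℝ) * (P * ENNReal.ofReal |z - z'| ^ (-1 : ℝ) * a₁ z z') ^ (1 / 2 : ℝ) := by
    intro z z'
    have hkmz : ∀ z, Measurable fun p : ℝ × ℝ => E p.1 p.2 z * g₁ p.2 z * g₂ p.1 z :=
      fun z => ((hEc (by fun_prop) (by fun_prop) (by fun_prop)).mul
        (hg₁c (by fun_prop) (by fun_prop))).mul (hg₂c (by fun_prop) (by fun_prop))
    have hI : Integrable (fun p : ℝ × ℝ => (E p.1 p.2 z * g₁ p.2 z * g₂ p.1 z) *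
        conj (E p.1 p.2 z' * g₁ p.2 z' * g₂ p.1 z')) (μ.prod ν) := by
      refine integrable_of_forall_norm_le (B := (B * B₁ * B₂) * (B * B₁ * B₂))
        ((hkmz z).mul (hconj.comp (hkmz z'))) fun p => ?_
      rw [norm_mul, RCLike.norm_conj]
      gcongr
      · exact hkb _ _
      · exact hkb _ _
    rw [integral_prod _ hI]
    have e : ∀ x, ∫ y, (E x y z * g₁ y z * g₂ x z) * conj (E x y z' * g₁ y z' * g₂ x z') ∂ν =
        (g₂ x z * conj (g₂ x z')) * L z z' x := fun x => by
      rw [hL, ← integral_const_mul]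
      congr 1
      ext y
      simp only [map_mul]; ring
    simp only [e]
    refine (enorm_integral_le_lintegral_enorm _).trans ?_
    simp only [enorm_mul, RCLike.enorm_conj]
    have hLm : Measurable (L z z') := by
      have h : Measurable fun q : ℝ × ℝ =>
          E q.1 q.2 z * conj (E q.1 q.2 z') * (g₁ q.2 z * conj (g₁ q.2 z')) :=
        ((hEc (by fun_prop) (by fun_prop) (by fun_prop)).mul (hconj.comp
          (hEc (by fun_prop) (by fun_prop) (by fun_prop)))).mul
          ((hg₁c (by fun_prop) (by fun_prop)).mul
            (hconj.comp (hg₁c (by fun_prop) (by fun_prop))))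
      exact h.stronglyMeasurable.integral_prod_right'.measurable
    have hgm : Measurable fun x => ‖g₂ x z‖ₑ * ‖g₂ x z'‖ₑ :=
      (hg₂c (by fun_prop) (by fun_prop)).enorm.mul (hg₂c (by fun_prop) (by fun_prop)).enorm
    refine (lintegral_mul_le_sqrt_mul_sqrt μ hgm.aemeasurable hLm.enorm.aemeasurable).trans ?_
    gcongr
    · exact le_of_eq (by simp only [ha₂, mul_pow])
    · exact hinner z z'
  have hsquare := lintegral_enorm_integral_sq_le (μ.prod ν) ρ hkm hkb
  have hHm : Measurable fun p : ℝ × ℝ => ‖∫ z, E p.1 p.2 z * g₁ p.2 z * g₂ p.1 z ∂ρ‖ₑ ^ 2 :=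
    (hkm.stronglyMeasurable.integral_prod_right.measurable.enorm).pow_const 2
  rw [lintegral_prod _ hHm.aemeasurable] at hsquare
  refine hsquare.trans ((lintegral_mono fun z => lintegral_mono fun z' => hpair z z').trans ?_)
  -- The singularity is now `|z - z'|^{-1/2}`. It is shared equally between `a₁` and `a₂`, so that
  -- after Cauchy-Schwarz in `(z, z')` each factor carries the full kernel `κ` needed for
  -- Hardy-Littlewood-Sobolev.
  have hsplit : ∀ z z', a₂ z z' ^ (1 / 2 : ℝ) *
      (P * ENNReal.ofReal |z - z'| ^ (-1 : ℝ) * a₁ z z') ^ (1 / 2 : ℝ) =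
      P ^ (1 / 2 : ℝ) * ((κ z z' * a₁ z z') ^ (1 / 2 : ℝ) * (κ z z' * a₂ z z') ^ (1 / 2 : ℝ)) := by
    intro z z'
    simp only [ENNReal.mul_rpow_of_nonneg _ _ (show (0 : ℝ) ≤ 1 / 2 by norm_num), hκ]
    rw [show (ENNReal.ofReal |z - z'| ^ (-1 : ℝ)) ^ (1 / 2 : ℝ) =
      (ENNReal.ofReal |z - z'| ^ (-(1 / 2) : ℝ)) ^ (1 / 2 : ℝ) *
      (ENNReal.ofReal |z - z'| ^ (-(1 / 2) : ℝ)) ^ (1 / 2 : ℝ) by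
        rw [← sq, ENNReal.rpow_half_sq, ← ENNReal.rpow_mul]
        norm_num]
    ring
  simp only [hsplit]
  have hmp : ∀ {a : ℝ → ℝ → ℝ≥0∞}, Measurable (Function.uncurry a) →
      Measurable fun p : ℝ × ℝ => (κ p.1 p.2 * a p.1 p.2) ^ (1 / 2 : ℝ) := fun h =>
    (hκm.mul h).pow_const _
  calc ∫⁻ z, ∫⁻ z', P ^ (1 / 2 : ℝ) * ((κ z z' * a₁ z z') ^ (1 / 2 : ℝ) *
        (κ z z' * a₂ z z') ^ (1 / 2 : ℝ)) ∂ρ ∂ρ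
      = ∫⁻ p, P ^ (1 / 2 : ℝ) * ((κ p.1 p.2 * a₁ p.1 p.2) ^ (1 / 2 : ℝ) *
        (κ p.1 p.2 * a₂ p.1 p.2) ^ (1 / 2 : ℝ)) ∂(ρ.prod ρ) := by
        rw [lintegral_prod]
        exact (((hmp ha₁m).mul (hmp ha₂m)).const_mul _).aemeasurable
    _ = P ^ (1 / 2 : ℝ) * ∫⁻ p, (κ p.1 p.2 * a₁ p.1 p.2) ^ (1 / 2 : ℝ) *
        (κ p.1 p.2 * a₂ p.1 p.2) ^ (1 / 2 : ℝ) ∂(ρ.prod ρ) :=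
        lintegral_const_mul _ ((hmp ha₁m).mul (hmp ha₂m))
    _ ≤ P ^ (1 / 2 : ℝ) * ((12 * ∫⁻ y, (∫⁻ z, ‖g₁ y z‖ₑ ^ (8 / 3 : ℝ) ∂ρ) ^ (3 / 2 : ℝ) ∂ν) ^
        (1 / 2 : ℝ) *
        (12 * ∫⁻ y, (∫⁻ z, ‖g₂ y z‖ₑ ^ (8 / 3 : ℝ) ∂ρ) ^ (3 / 2 : ℝ) ∂μ) ^ (1 / 2 : ℝ)) := by
        refine mul_le_mul_right ((lintegral_mul_le_sqrt_mul_sqrt _ (hmp ha₁m).aemeasurable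
          (hmp ha₂m).aemeasurable).trans ?_) _
        simp only [ENNReal.rpow_half_sq]
        gcongr
        · exact hHLS g₁ ν hg₁
        · exact hHLS g₂ μ hg₂
    _ = _ := by
        simp only [ENNReal.mul_rpow_of_nonneg _ _ (show (0 : ℝ) ≤ 1 / 2 by norm_num)]
        have : (12 : ℝ≥0∞) ^ (1 / 2 : ℝ) * 12 ^ (1 / 2 : ℝ) = 12 := by
          rw [← sq, ENNReal.rpow_half_sq]
        conv_rhs => rw [← this]
        ring

/-! ### From mixed norms to isotropic norms -/

/-- The weight which balances a mixed norm against the isotropic one. -/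
noncomputable def balancingWeight (ρ : Measure ℝ) (f : ℝ → ℝ → ℂ) (ε : ℝ≥0∞) (x : ℝ) : ℝ≥0∞ :=
  (∫⁻ z, ‖f x z‖ₑ ^ (8 / 3 : ℝ) ∂ρ + ε) ^ (1 / 8 : ℝ)

section balancing

variable {ρ : Measure ℝ} {f : ℝ → ℝ → ℂ} {ε : ℝ≥0∞}

theorem measurable_balancingWeight [SFinite ρ] (hf : Measurable (Function.uncurry f)) :
    Measurable (balancingWeight ρ f ε) := by
  have : Measurable fun q : ℝ × ℝ => ‖f q.1 q.2‖ₑ ^ (8 / 3 : ℝ) := hf.enorm.pow_const _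
  exact ((this.lintegral_prod_right').add_const _).pow_const _

theorem lintegral_enorm_rpow_le {B : ℝ} (hB : ∀ x z, ‖f x z‖ ≤ B) (x : ℝ) :
    ∫⁻ z, ‖f x z‖ₑ ^ (8 / 3 : ℝ) ∂ρ ≤ ENNReal.ofReal B ^ (8 / 3 : ℝ) * ρ Set.univ := by
  rw [← lintegral_const]
  gcongr with z
  rw [← ofReal_norm]
  exact ENNReal.ofReal_le_ofReal (hB x z)

theorem balancingWeight_ne_top [IsFiniteMeasure ρ] {B : ℝ} (hB : ∀ x z, ‖f x z‖ ≤ B) (hε : ε ≠ ⊤) (x : ℝ) :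
    balancingWeight ρ f ε x ≠ ⊤ := by
  refine ENNReal.rpow_ne_top_of_nonneg (by norm_num) (ENNReal.add_ne_top.2 ⟨?_, hε⟩)
  exact ne_top_of_le_ne_top (ENNReal.mul_ne_top
    (ENNReal.rpow_ne_top_of_nonneg (by norm_num) ENNReal.ofReal_ne_top) (measure_ne_top _ _))
    (lintegral_enorm_rpow_le hB x)

theorem le_balancingWeight (x : ℝ) : ε ^ (1 / 8 : ℝ) ≤ balancingWeight ρ f ε x := by
  unfold balancingWeight
  gcongr
  exact le_add_self

theorem balancingWeight_ne_zero (hε : ε ≠ 0) (x : ℝ) : balancingWeight ρ f ε x ≠ 0 := by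
  simp [balancingWeight, hε]

/-- With `F x` the inner integral, dividing by the weight multiplies it by `(F + ε)^{-1/3}`, and
`F^{3/2} (F + ε)^{-1/2} ≤ F`. The exponent `1/8` of the weight is chosen for this. The summand `ε`
keeps the weight away from zero, so that the quotients stay bounded. -/
theorem lintegral_div_balancingWeight_le [IsFiniteMeasure ρ] (hf : Measurable (Function.uncurry f)) (hε : ε ≠ 0)
    (hε' : ε ≠ ⊤) {B : ℝ} (hB : ∀ x z, ‖f x z‖ ≤ B) (μ : Measure ℝ) :
    ∫⁻ x, (∫⁻ z, (‖f x z‖ₑ / balancingWeight ρ f ε x) ^ (8 / 3 : ℝ) ∂ρ) ^ (3 / 2 : ℝ) ∂μ ≤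
      ∫⁻ x, ∫⁻ z, ‖f x z‖ₑ ^ (8 / 3 : ℝ) ∂ρ ∂μ := by
  refine lintegral_mono fun x => ?_
  set W := balancingWeight ρ f ε x with hW
  set F := ∫⁻ z, ‖f x z‖ₑ ^ (8 / 3 : ℝ) ∂ρ with hF
  have hfx : Measurable fun z => ‖f x z‖ₑ ^ (8 / 3 : ℝ) := hf.of_uncurry_left.enorm.pow_const _
  have e : ∫⁻ z, (‖f x z‖ₑ / W) ^ (8 / 3 : ℝ) ∂ρ = F * (W ^ (8 / 3 : ℝ))⁻¹ := by
    rw [hF, ← lintegral_mul_const _ hfx]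
    refine lintegral_congr fun z => ?_
    rw [ENNReal.div_rpow_of_nonneg _ _ (by norm_num), ENNReal.div_eq_inv_mul, mul_comm]
  rw [e]
  have hWe : (W ^ (8 / 3 : ℝ))⁻¹ = (F + ε) ^ (-(1 / 3) : ℝ) := by
    rw [hW, balancingWeight, ← ENNReal.rpow_mul, ← ENNReal.rpow_neg, ← hF]
    norm_num
  have h0 : F + ε ≠ 0 := by simp [hε]
  have ht : F + ε ≠ ⊤ := ENNReal.add_ne_top.2 ⟨ne_top_of_le_ne_top (ENNReal.mul_ne_top
    (ENNReal.rpow_ne_top_of_nonneg (by norm_num) ENNReal.ofReal_ne_top) (measure_ne_top _ _))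
    (lintegral_enorm_rpow_le hB x), hε'⟩
  rw [hWe, ENNReal.mul_rpow_of_nonneg _ _ (by norm_num), ← ENNReal.rpow_mul]
  calc F ^ (3 / 2 : ℝ) * (F + ε) ^ (-(1 / 3) * (3 / 2) : ℝ)
      = F * (F ^ (1 / 2 : ℝ) * (F + ε) ^ (-(1 / 2) : ℝ)) := by
        rw [show (3 / 2 : ℝ) = 1 + 1 / 2 by norm_num,
          ENNReal.rpow_add_of_nonneg _ _ (by norm_num) (by norm_num), ENNReal.rpow_one, mul_assoc]
        norm_num
    _ ≤ F * ((F + ε) ^ (1 / 2 : ℝ) * (F + ε) ^ (-(1 / 2) : ℝ)) := by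
        gcongr; exact le_self_add
    _ = F := by rw [← ENNReal.rpow_add _ _ h0 ht]; simp

theorem lintegral_balancingWeight_rpow (μ : Measure ℝ) :
    ∫⁻ x, balancingWeight ρ f ε x ^ (8 : ℝ) ∂μ =
      ∫⁻ x, ∫⁻ z, ‖f x z‖ₑ ^ (8 / 3 : ℝ) ∂ρ ∂μ + ε * μ Set.univ := by
  simp_rw [balancingWeight, ← ENNReal.rpow_mul]
  norm_num

end balancing

/-- Provides the regularisation `ε` of a weight: positive, yet small enough that its contribution
over a space of mass `m` at most doubles `N`. For `N = 0` no positive `ε` could work in general, and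
any value will do. -/
theorem exists_add_mul_le_two_mul (N m : ℝ≥0∞) (hN : N ≠ ⊤) (hm : m ≠ ⊤) :
    ∃ ε : ℝ≥0∞, ε ≠ 0 ∧ ε ≠ ⊤ ∧ (N ≠ 0 → N + ε * m ≤ 2 * N) := by
  rcases eq_or_ne N 0 with h | h
  · exact ⟨1, by simp, by simp, fun h' => absurd h h'⟩
  · refine ⟨N / (m + 1), by simp [h, hm], ENNReal.div_ne_top hN (by simp), fun _ => ?_⟩
    rw [two_mul]
    gcongr
    calc N / (m + 1) * m ≤ N / (m + 1) * (m + 1) := by gcongr; exact le_self_add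
      _ = N := ENNReal.div_mul_cancel (by simp) (by simp [hm])

/-- The trilinear `L^{8/3}` estimate for a kernel with a fourfold orthogonality bound. -/
theorem enorm_trilinear_le (μ ν ρ : Measure ℝ) [IsFiniteMeasure μ]
    [IsFiniteMeasure ν] [IsFiniteMeasure ρ] (hν : ν ≤ volume) (hρ : ρ ≤ volume)
    {E : ℝ → ℝ → ℝ → ℂ} (hE : Measurable fun p : ℝ × ℝ × ℝ => E p.1 p.2.1 p.2.2) {B : ℝ}
    (hB : ∀ x y z, ‖E x y z‖ ≤ B) {A l θ : ℝ} (hA : 0 ≤ A) (hl : 0 < l) (hθ : 0 < θ)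
    (hK : ∀ y y' z z', ‖∫ x, E x y z * conj (E x y z') * conj (E x y' z * conj (E x y' z')) ∂μ‖ ≤
      A * cauchyKernel l θ (y - y') (z - z'))
    {f₁ f₂ f₃ : ℝ → ℝ → ℂ} (hf₁ : Measurable (Function.uncurry f₁))
    (hf₂ : Measurable (Function.uncurry f₂)) (hf₃ : Measurable (Function.uncurry f₃))
    {B₁ B₂ B₃ : ℝ} (hB₁ : ∀ y z, ‖f₁ y z‖ ≤ B₁) (hB₂ : ∀ x z, ‖f₂ x z‖ ≤ B₂)
    (hB₃ : ∀ x y, ‖f₃ x y‖ ≤ B₃) :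
    ‖∫ x, ∫ y, ∫ z, E x y z * f₁ y z * f₂ x z * f₃ x y ∂ρ ∂ν ∂μ‖ₑ ≤
      8 * ENNReal.ofReal (2 * Real.pi * A / θ) ^ (1 / 4 : ℝ) *
        (∫⁻ y, ∫⁻ z, ‖f₁ y z‖ₑ ^ (8 / 3 : ℝ) ∂ρ ∂ν) ^ (3 / 8 : ℝ) *
        (∫⁻ x, ∫⁻ z, ‖f₂ x z‖ₑ ^ (8 / 3 : ℝ) ∂ρ ∂μ) ^ (3 / 8 : ℝ) *
        (∫⁻ x, ∫⁻ y, ‖f₃ x y‖ₑ ^ (8 / 3 : ℝ) ∂ν ∂μ) ^ (3 / 8 : ℝ) := by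
  set N₁ := ∫⁻ y, ∫⁻ z, ‖f₁ y z‖ₑ ^ (8 / 3 : ℝ) ∂ρ ∂ν with hN₁
  set N₂ := ∫⁻ x, ∫⁻ z, ‖f₂ x z‖ₑ ^ (8 / 3 : ℝ) ∂ρ ∂μ with hN₂
  set N₃ := ∫⁻ x, ∫⁻ y, ‖f₃ x y‖ₑ ^ (8 / 3 : ℝ) ∂ν ∂μ with hN₃
  have hfin : ∀ (f : ℝ → ℝ → ℂ) (b : ℝ) (σ τ : Measure ℝ) [IsFiniteMeasure σ]
      [IsFiniteMeasure τ], (∀ x y, ‖f x y‖ ≤ b) →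
      ∫⁻ x, ∫⁻ y, ‖f x y‖ₑ ^ (8 / 3 : ℝ) ∂σ ∂τ ≠ ⊤ := by
    intro f b σ τ _ _ hb
    refine ne_top_of_le_ne_top ?_ (lintegral_mono fun x => lintegral_enorm_rpow_le hb x)
    rw [lintegral_const]
    exact ENNReal.mul_ne_top (ENNReal.mul_ne_top
      (ENNReal.rpow_ne_top_of_nonneg (by norm_num) ENNReal.ofReal_ne_top) (measure_ne_top _ _))
      (measure_ne_top _ _)
  have hN₁t : N₁ ≠ ⊤ := hfin f₁ B₁ ρ ν hB₁
  have hN₂t : N₂ ≠ ⊤ := hfin f₂ B₂ ρ μ hB₂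
  have hN₃t : N₃ ≠ ⊤ := hfin f₃ B₃ ν μ hB₃
  obtain ⟨ε₁, h1, h1', h1N⟩ := exists_add_mul_le_two_mul N₁ (ν Set.univ) hN₁t (measure_ne_top _ _)
  obtain ⟨ε₂, h2, h2', h2N⟩ := exists_add_mul_le_two_mul N₂ (μ Set.univ) hN₂t (measure_ne_top _ _)
  set V := balancingWeight ρ f₁ ε₁
  set U := balancingWeight ρ f₂ ε₂
  have hVm : Measurable V := measurable_balancingWeight hf₁
  have hUm : Measurable U := measurable_balancingWeight hf₂
  have hVt : ∀ y, V y ≠ ⊤ := balancingWeight_ne_top hB₁ h1'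
  have hUt : ∀ x, U x ≠ ⊤ := balancingWeight_ne_top hB₂ h2'
  have hV0 : ∀ y, V y ≠ 0 := balancingWeight_ne_zero h1
  have hU0 : ∀ x, U x ≠ 0 := balancingWeight_ne_zero h2
  have henorm : ∀ w : ℝ≥0∞, w ≠ ⊤ → ‖((w.toReal : ℝ) : ℂ)‖ₑ = w := fun w hw => by
    rw [← ofReal_norm, Complex.norm_real, Real.norm_of_nonneg ENNReal.toReal_nonneg,
      ENNReal.ofReal_toReal hw]
  set g₁ : ℝ → ℝ → ℂ := fun y z => f₁ y z / ((V y).toReal : ℂ) with hg₁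
  set g₂ : ℝ → ℝ → ℂ := fun x z => f₂ x z / ((U x).toReal : ℂ) with hg₂
  set h : ℝ → ℝ → ℂ := fun x y => f₃ x y * ((U x).toReal : ℂ) * ((V y).toReal : ℂ) with hh
  have hg₁m : Measurable (Function.uncurry g₁) := by
    have : Measurable fun p : ℝ × ℝ => ((V p.1).toReal : ℂ) := by fun_prop
    exact hf₁.div this
  have hg₂m : Measurable (Function.uncurry g₂) := by
    have : Measurable fun p : ℝ × ℝ => ((U p.1).toReal : ℂ) := by fun_prop
    exact hf₂.div this
  have hhm : Measurable (Function.uncurry h) := by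
    have hu : Measurable fun p : ℝ × ℝ => ((U p.1).toReal : ℂ) := by fun_prop
    have hv : Measurable fun p : ℝ × ℝ => ((V p.2).toReal : ℂ) := by fun_prop
    exact (hf₃.mul hu).mul hv
  have hge : ∀ (f : ℝ → ℝ → ℂ) (W : ℝ → ℝ≥0∞), (∀ x, W x ≠ ⊤) → (∀ x, W x ≠ 0) → ∀ x z,
      ‖f x z / ((W x).toReal : ℂ)‖ₑ = ‖f x z‖ₑ / W x := fun f W ht h0 x z => by
    rw [div_eq_mul_inv, enorm_mul, enorm_inv, henorm _ (ht x), div_eq_mul_inv]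
    simpa using ENNReal.toReal_ne_zero.2 ⟨h0 x, ht x⟩
  have hgb : ∀ (f : ℝ → ℝ → ℂ) (b : ℝ) (ε : ℝ≥0∞), ε ≠ 0 → ε ≠ ⊤ → (∀ x z, ‖f x z‖ ≤ b) →
      ∀ x z, ‖f x z / ((balancingWeight ρ f ε x).toReal : ℂ)‖ ≤ b / (ε ^ (1 / 8 : ℝ)).toReal := by
    intro f b ε h0 ht hb x z
    have hεp : 0 < (ε ^ (1 / 8 : ℝ)).toReal :=
      ENNReal.toReal_pos (by simp [h0]) (ENNReal.rpow_ne_top_of_nonneg (by norm_num) ht)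
    rw [norm_div, Complex.norm_real, Real.norm_of_nonneg ENNReal.toReal_nonneg]
    refine div_le_div₀ ((norm_nonneg _).trans (hb x z)) (hb x z) hεp ?_
    exact ENNReal.toReal_mono (balancingWeight_ne_top hb ht x) (le_balancingWeight x)
  have hkey := lintegral_enorm_integral_kernel_sq_le μ ν ρ hν hρ hE hB hA hl hθ hK hg₁m hg₂m
    (hgb f₁ B₁ ε₁ h1 h1' hB₁) (hgb f₂ B₂ ε₂ h2 h2' hB₂)
  set P := ENNReal.ofReal (2 * Real.pi * A / θ)
  have hS : ∫⁻ x, ∫⁻ y, ‖∫ z, E x y z * g₁ y z * g₂ x z ∂ρ‖ₑ ^ 2 ∂ν ∂μ ≤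
      12 * P ^ (1 / 2 : ℝ) * N₁ ^ (1 / 2 : ℝ) * N₂ ^ (1 / 2 : ℝ) := by
    refine hkey.trans ?_
    gcongr
    · simp only [hg₁, hge f₁ V hVt hV0]
      exact lintegral_div_balancingWeight_le hf₁ h1 h1' hB₁ ν
    · simp only [hg₂, hge f₂ U hUt hU0]
      exact lintegral_div_balancingWeight_le hf₂ h2 h2' hB₂ μ
  -- Hölder with exponents `4/3` and `4` turns `|f₃|²` into `|f₃|^{8/3}` and the squared weights
  -- into eighth powers, whose integrals are again isotropic.
  have hT : ∫⁻ p, ‖h p.1 p.2‖ₑ ^ 2 ∂(μ.prod ν) ≤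
      N₃ ^ (3 / 4 : ℝ) * ((N₂ + ε₂ * μ Set.univ) * (N₁ + ε₁ * ν Set.univ)) ^ (1 / 4 : ℝ) := by
    have e : ∀ p : ℝ × ℝ, ‖h p.1 p.2‖ₑ ^ 2 =
        ((fun p : ℝ × ℝ => ‖f₃ p.1 p.2‖ₑ ^ 2) * fun p : ℝ × ℝ => U p.1 ^ 2 * V p.2 ^ 2) p :=
      fun p => by
        simp only [hh, enorm_mul, henorm _ (hUt _), henorm _ (hVt _), Pi.mul_apply]; ring
    have hf₃m : Measurable fun p : ℝ × ℝ => ‖f₃ p.1 p.2‖ₑ ^ 2 := hf₃.enorm.pow_const 2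
    simp_rw [e]
    refine (ENNReal.lintegral_mul_le_Lp_mul_Lq (μ.prod ν) (p := 4 / 3) (q := 4)
      ⟨by norm_num, by norm_num, by norm_num⟩ hf₃m.aemeasurable
      (by fun_prop)).trans (le_of_eq ?_)
    rw [show (1 / (4 / 3) : ℝ) = 3 / 4 by norm_num, lintegral_prod _ (by fun_prop),
      lintegral_prod _ (by fun_prop)]
    congr 2
    · refine lintegral_congr fun x => lintegral_congr fun y => ?_
      rw [← ENNReal.rpow_natCast, ← ENNReal.rpow_mul]; norm_num
    · rw [← lintegral_balancingWeight_rpow, ← lintegral_balancingWeight_rpow]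
      have e2 : ∀ x y, (U x ^ 2 * V y ^ 2) ^ (4 : ℝ) = U x ^ (8 : ℝ) * V y ^ (8 : ℝ) :=
        fun x y => by
          rw [ENNReal.mul_rpow_of_nonneg _ _ (by norm_num), ← ENNReal.rpow_natCast,
            ← ENNReal.rpow_mul, ← ENNReal.rpow_natCast, ← ENNReal.rpow_mul]; norm_num
      simp only [e2]
      simp_rw [lintegral_const_mul _ (hVm.pow_const (8 : ℝ))]
      rw [lintegral_mul_const _ (hUm.pow_const (8 : ℝ))]
  have hmain : ‖∫ x, ∫ y, ∫ z, E x y z * f₁ y z * f₂ x z * f₃ x y ∂ρ ∂ν ∂μ‖ₑ ≤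
      (N₃ ^ (3 / 4 : ℝ) * ((N₂ + ε₂ * μ Set.univ) * (N₁ + ε₁ * ν Set.univ)) ^ (1 / 4 : ℝ)) ^
        (1 / 2 : ℝ) * (12 * P ^ (1 / 2 : ℝ) * N₁ ^ (1 / 2 : ℝ) * N₂ ^ (1 / 2 : ℝ)) ^
        (1 / 2 : ℝ) := by
    have e : ∀ x y, ∫ z, E x y z * f₁ y z * f₂ x z * f₃ x y ∂ρ =
        h x y * ∫ z, E x y z * g₁ y z * g₂ x z ∂ρ := fun x y => by
      rw [← integral_const_mul]
      congr 1
      ext z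
      have hu : ((U x).toReal : ℂ) ≠ 0 := by
        simpa using ENNReal.toReal_ne_zero.2 ⟨hU0 x, hUt x⟩
      have hv : ((V y).toReal : ℂ) ≠ 0 := by
        simpa using ENNReal.toReal_ne_zero.2 ⟨hV0 y, hVt y⟩
      simp only [hg₁, hg₂, hh]
      field_simp
    have hHm : Measurable fun p : ℝ × ℝ => ∫ z, E p.1 p.2 z * g₁ p.2 z * g₂ p.1 z ∂ρ := by
      have h1 : Measurable fun q : (ℝ × ℝ) × ℝ => E q.1.1 q.1.2 q.2 :=
        hE.comp (f := fun q : (ℝ × ℝ) × ℝ => (q.1.1, q.1.2, q.2)) (by fun_prop)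
      have h2 : Measurable fun q : (ℝ × ℝ) × ℝ => g₁ q.1.2 q.2 :=
        hg₁m.comp (f := fun q : (ℝ × ℝ) × ℝ => (q.1.2, q.2)) (by fun_prop)
      have h3 : Measurable fun q : (ℝ × ℝ) × ℝ => g₂ q.1.1 q.2 :=
        hg₂m.comp (f := fun q : (ℝ × ℝ) × ℝ => (q.1.1, q.2)) (by fun_prop)
      exact ((h1.mul h2).mul h3).stronglyMeasurable.integral_prod_right'.measurable
    have hhm' : Measurable fun p : ℝ × ℝ => h p.1 p.2 := hhm
    simp_rw [e]
    calc _ ≤ ∫⁻ x, ∫⁻ y, ‖h x y‖ₑ * ‖∫ z, E x y z * g₁ y z * g₂ x z ∂ρ‖ₑ ∂ν ∂μ := by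
          refine (enorm_integral_le_lintegral_enorm _).trans (lintegral_mono fun x => ?_)
          refine (enorm_integral_le_lintegral_enorm _).trans (lintegral_mono fun y => ?_)
          rw [enorm_mul]
      _ = ∫⁻ p, ‖h p.1 p.2‖ₑ * ‖∫ z, E p.1 p.2 z * g₁ p.2 z * g₂ p.1 z ∂ρ‖ₑ ∂(μ.prod ν) := by
          rw [lintegral_prod]
          exact (hhm'.enorm.mul hHm.enorm).aemeasurable
      _ ≤ _ := lintegral_mul_le_sqrt_mul_sqrt _ hhm'.enorm.aemeasurable hHm.enorm.aemeasurable
      _ ≤ _ := by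
          rw [lintegral_prod (fun p : ℝ × ℝ => ‖∫ z, E p.1 p.2 z * g₁ p.2 z * g₂ p.1 z ∂ρ‖ₑ ^ 2)
            (hHm.enorm.pow_const 2).aemeasurable]
          gcongr
  refine hmain.trans ?_
  -- If `N₁` or `N₂` vanishes, the square function factor in `hmain` is already zero; the control of
  -- `ε` is available only in the remaining case.
  rcases eq_or_ne N₁ 0 with hz | hz1
  · simp [hz]
  rcases eq_or_ne N₂ 0 with hz | hz2
  · simp [hz]
  have hhalf : (0 : ℝ) ≤ 1 / 2 := by norm_num
  have hqu : (0 : ℝ) ≤ 1 / 4 := by norm_num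
  have h4 : (4 : ℝ≥0∞) ^ (1 / 8 : ℝ) ≤ 2 := by
    calc (4 : ℝ≥0∞) ^ (1 / 8 : ℝ) ≤ 4 ^ (1 / 2 : ℝ) :=
          ENNReal.rpow_le_rpow_of_exponent_le (by norm_num) (by norm_num)
      _ = (2 ^ 2) ^ (1 / 2 : ℝ) := by norm_num
      _ = 2 := ENNReal.sq_rpow_half 2
  have h12 : (12 : ℝ≥0∞) ^ (1 / 2 : ℝ) ≤ 4 := by
    calc (12 : ℝ≥0∞) ^ (1 / 2 : ℝ) ≤ (4 ^ 2) ^ (1 / 2 : ℝ) := by gcongr; norm_num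
      _ = 4 := ENNReal.sq_rpow_half 4
  calc _ ≤ (N₃ ^ (3 / 4 : ℝ) * ((2 * N₂) * (2 * N₁)) ^ (1 / 4 : ℝ)) ^
        (1 / 2 : ℝ) * (12 * P ^ (1 / 2 : ℝ) * N₁ ^ (1 / 2 : ℝ) * N₂ ^ (1 / 2 : ℝ)) ^
        (1 / 2 : ℝ) := by gcongr; exacts [h2N hz2, h1N hz1]
    -- Both `N₁` and `N₂` receive `1/8` from the weights and `1/4` from the square function, which
    -- add up to `3/8`.
    _ = 4 ^ (1 / 8 : ℝ) * 12 ^ (1 / 2 : ℝ) * P ^ (1 / 4 : ℝ) *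
          (N₁ ^ (1 / 8 : ℝ) * N₁ ^ (1 / 4 : ℝ)) * (N₂ ^ (1 / 8 : ℝ) * N₂ ^ (1 / 4 : ℝ)) *
          N₃ ^ (3 / 8 : ℝ) := by
        rw [show 2 * N₂ * (2 * N₁) = 4 * (N₂ * N₁) by ring]
        simp only [ENNReal.mul_rpow_of_nonneg _ _ hhalf, ENNReal.mul_rpow_of_nonneg _ _ hqu,
          ← ENNReal.rpow_mul]
        norm_num
        ring
    _ ≤ 2 * 4 * P ^ (1 / 4 : ℝ) *
          (N₁ ^ (1 / 8 : ℝ) * N₁ ^ (1 / 4 : ℝ)) * (N₂ ^ (1 / 8 : ℝ) * N₂ ^ (1 / 4 : ℝ)) *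
          N₃ ^ (3 / 8 : ℝ) := by gcongr
    _ = _ := by
        rw [← ENNReal.rpow_add_of_nonneg _ _ (by norm_num) (by norm_num),
          ← ENNReal.rpow_add_of_nonneg _ _ (by norm_num) (by norm_num)]
        norm_num

/-! ### Amplitudes at a given scale and integration by parts -/

/-- `A` is twice continuously differentiable with bounds adapted to the length scale `l`. -/
structure ScaleBound (A : ℝ → ℂ) (M l : ℝ) : Prop where
  contDiff : ContDiff ℝ 2 A
  bound_zero : ∀ t, ‖A t‖ ≤ M
  bound_one : ∀ t, ‖deriv A t‖ ≤ M / l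
  bound_two : ∀ t, ‖deriv (deriv A) t‖ ≤ M / l ^ 2

namespace ScaleBound

variable {A B : ℝ → ℂ} {M N l : ℝ}

theorem nonneg (h : ScaleBound A M l) : 0 ≤ M := (norm_nonneg _).trans (h.bound_zero 0)

theorem hasDerivAt (h : ContDiff ℝ 2 A) (t : ℝ) : HasDerivAt A (deriv A t) t :=
  (h.differentiable (by norm_num) t).hasDerivAt

theorem contDiff_deriv (h : ContDiff ℝ 2 A) : ContDiff ℝ 1 (deriv A) :=
  ((contDiff_succ_iff_deriv (n := 1)).1 h).2.2

theorem hasDerivAt_deriv (h : ContDiff ℝ 2 A) (t : ℝ) :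
    HasDerivAt (deriv A) (deriv (deriv A) t) t :=
  ((contDiff_deriv h).differentiable (by norm_num) t).hasDerivAt

theorem deriv_mul_eq (hA : ContDiff ℝ 2 A) (hB : ContDiff ℝ 2 B) :
    deriv (fun t => A t * B t) = fun t => deriv A t * B t + A t * deriv B t := by
  ext t
  exact ((hasDerivAt hA t).mul (hasDerivAt hB t)).deriv

theorem deriv_deriv_mul_eq (hA : ContDiff ℝ 2 A) (hB : ContDiff ℝ 2 B) (t : ℝ) :
    deriv (deriv fun t => A t * B t) t =
      deriv (deriv A) t * B t + 2 * (deriv A t * deriv B t) + A t * deriv (deriv B) t := by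
  rw [deriv_mul_eq hA hB]
  have h := ((hasDerivAt_deriv hA t).mul (hasDerivAt hB t)).add
    ((hasDerivAt hA t).mul (hasDerivAt_deriv hB t))
  refine h.deriv.trans ?_
  ring

/-- Products, where the first factor only needs its bounds where the second does not vanish to
second order. -/
theorem mul_of_forall (hA : ContDiff ℝ 2 A) (hB : ScaleBound B N l) (hM : 0 ≤ M) (hl : 0 < l)
    (h : ∀ t, (B t = 0 ∧ deriv B t = 0 ∧ deriv (deriv B) t = 0) ∨
      (‖A t‖ ≤ M ∧ ‖deriv A t‖ ≤ M / l ∧ ‖deriv (deriv A) t‖ ≤ M / l ^ 2)) :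
    ScaleBound (fun t => A t * B t) (4 * (M * N)) l := by
  have hN := hB.nonneg
  have hMN : 0 ≤ M * N := mul_nonneg hM hN
  refine ⟨hA.mul hB.contDiff, fun t => ?_, fun t => ?_, fun t => ?_⟩
  · rcases h t with h | ⟨h0, -, -⟩
    · rw [h.1, mul_zero, norm_zero]; positivity
    · rw [norm_mul]
      calc _ ≤ M * N := mul_le_mul h0 (hB.bound_zero t) (norm_nonneg _) hM
        _ ≤ _ := by linarith
  · rw [deriv_mul_eq hA hB.contDiff]
    beta_reduce
    rcases h t with h | ⟨h0, h1, -⟩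
    · rw [h.1, h.2.1, mul_zero, mul_zero, add_zero, norm_zero]; positivity
    · calc _ ≤ ‖deriv A t‖ * ‖B t‖ + ‖A t‖ * ‖deriv B t‖ :=
            (norm_add_le _ _).trans (by simp only [norm_mul, le_refl])
        _ ≤ M / l * N + M * (N / l) := by
            gcongr
            · exact hB.bound_zero t
            · exact hB.bound_one t
        _ = 2 * (M * N) / l := by ring
        _ ≤ _ := by gcongr; linarith
  · rw [deriv_deriv_mul_eq hA hB.contDiff]
    rcases h t with h | ⟨h0, h1, h2⟩
    · rw [h.1, h.2.1, h.2.2]; simp only [mul_zero, add_zero, norm_zero]; positivity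
    · calc _ ≤ ‖deriv (deriv A) t‖ * ‖B t‖ + 2 * (‖deriv A t‖ * ‖deriv B t‖) +
              ‖A t‖ * ‖deriv (deriv B) t‖ :=
            (norm_add₃_le).trans (by simp only [norm_mul, RCLike.norm_ofNat, le_refl])
        -- The coefficients `1, 2, 1` of the second order Leibniz rule account for the constant `4`.
        _ ≤ M / l ^ 2 * N + 2 * (M / l * (N / l)) + M * (N / l ^ 2) := by
            gcongr
            · exact hB.bound_zero t
            · exact hB.bound_one t
            · exact hB.bound_two t
        _ = _ := by field_simp; ring

theorem mul (hA : ScaleBound A M l) (hB : ScaleBound B N l) (hl : 0 < l) :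
    ScaleBound (fun t => A t * B t) (4 * (M * N)) l :=
  mul_of_forall hA.contDiff hB hA.nonneg hl fun t =>
    Or.inr ⟨hA.bound_zero t, hA.bound_one t, hA.bound_two t⟩

theorem deriv_conj_eq (hA : ContDiff ℝ 1 A) :
    deriv (fun t => conj (A t)) = fun t => conj (deriv A t) := by
  ext t
  have h := (hA.differentiable (by norm_num) t).hasDerivAt
  exact (Complex.conjCLE.toContinuousLinearMap.hasFDerivAt.comp_hasDerivAt t h).deriv

theorem conjugate (hA : ScaleBound A M l) : ScaleBound (fun t => conj (A t)) M l := by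
  refine ⟨Complex.conjCLE.contDiff.comp hA.contDiff, fun t => ?_, fun t => ?_, fun t => ?_⟩
  · rw [RCLike.norm_conj]; exact hA.bound_zero t
  · rw [deriv_conj_eq (hA.contDiff.of_le (by norm_num)), RCLike.norm_conj]
    exact hA.bound_one t
  · rw [deriv_conj_eq (hA.contDiff.of_le (by norm_num)), deriv_conj_eq (contDiff_deriv hA.contDiff),
      RCLike.norm_conj]
    exact hA.bound_two t

end ScaleBound

/-- On each open outer half-line the derivative vanishes, and continuity carries this to the
endpoints `c` and `d`. The endpoints matter: the boundary terms of the second integration by parts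
involve `deriv A` there. -/
theorem deriv_eq_zero_of_forall_Ioo {A : ℝ → ℂ} (hA : ContDiff ℝ 1 A) {c d : ℝ}
    (h : ∀ x, x ∉ Set.Ioo c d → A x = 0) : ∀ x, x ∉ Set.Ioo c d → deriv A x = 0 := by
  have hc : Continuous (deriv A) := hA.continuous_deriv (by norm_num)
  have hopen : ∀ s : Set ℝ, IsOpen s → (∀ x ∈ s, A x = 0) → ∀ x ∈ closure s, deriv A x = 0 := by
    intro s hs h0 x hx
    refine closure_minimal (fun y hy => ?_) (isClosed_eq hc continuous_const) hx
    have : A =ᶠ[nhds y] fun _ => 0 := by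
      filter_upwards [hs.mem_nhds hy] with w hw using h0 w hw
    simp [this.deriv_eq]
  intro x hx
  rw [Set.mem_Ioo, not_and_or, not_lt, not_lt] at hx
  rcases hx with hx | hx
  · refine hopen (Set.Iio c) isOpen_Iio (fun y hy => h y fun hy' => ?_) x (by simpa using hx)
    exact lt_asymm hy'.1 hy
  · refine hopen (Set.Ioi d) isOpen_Ioi (fun y hy => h y fun hy' => ?_) x (by simpa using hx)
    exact lt_asymm hy'.2 hy

section vanDerCorput

variable {c d θ : ℝ} {Q q₁ q₂ q₃ : ℝ → ℝ}

theorem hasDerivAt_exp_phase {x : ℝ} (hQ : HasDerivAt Q (q₁ x) x) :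
    HasDerivAt (fun x => Complex.exp (Complex.I * θ * Q x))
      (Complex.I * θ * q₁ x * Complex.exp (Complex.I * θ * Q x)) x := by
  have h := (hQ.ofReal_comp.const_mul (Complex.I * θ)).cexp
  convert h using 1
  ring

theorem norm_exp_phase (θ q : ℝ) : ‖Complex.exp (Complex.I * θ * q)‖ = 1 := by
  rw [show Complex.I * θ * q = ((θ * q : ℝ) : ℂ) * Complex.I by push_cast; ring]
  exact Complex.norm_exp_ofReal_mul_I _

/-- One integration by parts against an oscillating exponential. -/
theorem integral_exp_phase_mul_eq (hcd : c ≤ d) (hθ : θ ≠ 0)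
    (hQ : ∀ x ∈ Set.Icc c d, HasDerivAt Q (q₁ x) x) (hq₁ : ContinuousOn q₁ (Set.Icc c d))
    {u u' : ℝ → ℂ} (hu : ∀ x ∈ Set.Icc c d, HasDerivAt u (u' x) x)
    (hu' : ContinuousOn u' (Set.Icc c d)) (huc : u c = 0) (hud : u d = 0) :
    ∫ x in c..d, Complex.exp (Complex.I * θ * Q x) * (q₁ x * u x) =
      (Complex.I / θ) * ∫ x in c..d, Complex.exp (Complex.I * θ * Q x) * u' x := by
  have hI : Set.uIcc c d = Set.Icc c d := Set.uIcc_of_le hcd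
  have hexp : ContinuousOn (fun x => Complex.exp (Complex.I * θ * Q x)) (Set.Icc c d) :=
    fun x hx => (hasDerivAt_exp_phase (hQ x hx)).continuousAt.continuousWithinAt
  have hq₁c : ContinuousOn (fun x => (q₁ x : ℂ)) (Set.Icc c d) :=
    Complex.continuous_ofReal.comp_continuousOn hq₁
  have h := intervalIntegral.integral_mul_deriv_eq_deriv_mul (a := c) (b := d)
    (u := u) (u' := u') (v := fun x => Complex.exp (Complex.I * θ * Q x))
    (v' := fun x => Complex.I * θ * q₁ x * Complex.exp (Complex.I * θ * Q x))
    (by rw [hI]; exact hu) (by rw [hI]; exact fun x hx => hasDerivAt_exp_phase (hQ x hx))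
    (ContinuousOn.intervalIntegrable (by rw [hI]; exact hu'))
    (ContinuousOn.intervalIntegrable (by
      rw [hI]; exact (continuousOn_const.mul hq₁c).mul hexp))
  rw [huc, hud, zero_mul, zero_mul, sub_zero, zero_sub] at h
  have hθ' : (θ : ℂ) ≠ 0 := by exact_mod_cast hθ
  have e1 : ∫ x in c..d, Complex.exp (Complex.I * θ * Q x) * (q₁ x * u x) =
      (Complex.I * θ)⁻¹ * ∫ x in c..d,
        u x * (Complex.I * θ * q₁ x * Complex.exp (Complex.I * θ * Q x)) := by
    rw [← intervalIntegral.integral_const_mul]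
    refine intervalIntegral.integral_congr fun x _ => ?_
    field_simp
  have e2 : ∫ x in c..d, u' x * Complex.exp (Complex.I * θ * Q x) =
      ∫ x in c..d, Complex.exp (Complex.I * θ * Q x) * u' x := by
    simp_rw [mul_comm]
  rw [e1, h, e2, mul_neg, ← neg_mul]
  congr 1
  rw [mul_inv, Complex.inv_I, neg_mul, neg_neg, div_eq_mul_inv]

/-- Van der Corput type estimate by two integrations by parts. -/
theorem norm_integral_exp_phase_mul_le (hcd : c ≤ d) (hθ : θ ≠ 0)
    (hQ : ∀ x ∈ Set.Icc c d, HasDerivAt Q (q₁ x) x)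
    (hQ₁ : ∀ x ∈ Set.Icc c d, HasDerivAt q₁ (q₂ x) x)
    (hQ₂ : ∀ x ∈ Set.Icc c d, HasDerivAt q₂ (q₃ x) x) (hq₃ : ContinuousOn q₃ (Set.Icc c d))
    {A : ℝ → ℂ} {M l ν K : ℝ} (hA : ScaleBound A M l) (hA0 : ∀ x, x ∉ Set.Ioo c d → A x = 0)
    (hl : 0 < l) (hν : 0 < ν) (hK : 0 ≤ K) (h₁ : ∀ x ∈ Set.Icc c d, ν ≤ |q₁ x|)
    (h₂ : ∀ x ∈ Set.Icc c d, |q₂ x| ≤ K * ν / l)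
    (h₃ : ∀ x ∈ Set.Icc c d, |q₃ x| ≤ K * ν / l ^ 2) :
    ‖∫ x in c..d, Complex.exp (Complex.I * θ * Q x) * A x‖ ≤
      3 * (1 + K) ^ 2 * M / (θ * ν * l) ^ 2 * (d - c) := by
  have hM := hA.nonneg
  have hne : ∀ x ∈ Set.Icc c d, q₁ x ≠ 0 := fun x hx h0 => by
    have := h₁ x hx
    rw [h0, abs_zero] at this
    linarith
  have hq₁ : ContinuousOn q₁ (Set.Icc c d) := fun x hx =>
    (hQ₁ x hx).continuousAt.continuousWithinAt
  have hq₂ : ContinuousOn q₂ (Set.Icc c d) := fun x hx =>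
    (hQ₂ x hx).continuousAt.continuousWithinAt
  set w : ℝ → ℝ := fun x => (q₁ x)⁻¹ with hw
  set w₁ : ℝ → ℝ := fun x => -q₂ x * w x ^ 2 with hw₁
  set w₂ : ℝ → ℝ := fun x => -q₃ x * w x ^ 2 + 2 * q₂ x ^ 2 * w x ^ 3 with hw₂
  have hwd : ∀ x ∈ Set.Icc c d, HasDerivAt w (w₁ x) x := fun x hx => by
    refine ((hQ₁ x hx).inv (hne x hx)).congr_deriv ?_
    simp only [hw₁, hw, inv_pow, div_eq_mul_inv]
  have hwd₁ : ∀ x ∈ Set.Icc c d, HasDerivAt w₁ (w₂ x) x := fun x hx => by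
    refine ((hQ₂ x hx).neg.mul ((hwd x hx).pow 2)).congr_deriv ?_
    simp only [hw₂, hw₁, Pi.neg_apply, Pi.pow_apply]
    push_cast
    ring
  have hwc : ContinuousOn w (Set.Icc c d) := hq₁.inv₀ hne
  have hw₁c : ContinuousOn w₁ (Set.Icc c d) := hq₂.neg.mul (hwc.pow 2)
  have hw₂c : ContinuousOn w₂ (Set.Icc c d) :=
    (hq₃.neg.mul (hwc.pow 2)).add ((continuousOn_const.mul (hq₂.pow 2)).mul (hwc.pow 3))
  have hcast : ∀ {f : ℝ → ℝ}, ContinuousOn f (Set.Icc c d) →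
      ContinuousOn (fun x => (f x : ℂ)) (Set.Icc c d) := fun h =>
    Complex.continuous_ofReal.comp_continuousOn h
  have bw : ∀ x ∈ Set.Icc c d, |w x| ≤ 1 / ν := fun x hx => by
    rw [hw, abs_inv, one_div]
    exact inv_anti₀ hν (h₁ x hx)
  have bw₁ : ∀ x ∈ Set.Icc c d, |w₁ x| ≤ K / (ν * l) := fun x hx => by
    rw [hw₁]
    simp only [abs_mul, abs_neg, abs_pow]
    calc _ ≤ K * ν / l * (1 / ν) ^ 2 := by gcongr; exacts [h₂ x hx, bw x hx]
      _ = _ := by field_simp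
  have bw₂ : ∀ x ∈ Set.Icc c d, |w₂ x| ≤ (K + 2 * K ^ 2) / (ν * l ^ 2) := fun x hx => by
    rw [hw₂]
    calc _ ≤ |q₃ x| * |w x| ^ 2 + 2 * |q₂ x| ^ 2 * |w x| ^ 3 := by
          refine (abs_add_le _ _).trans (le_of_eq ?_)
          simp only [abs_mul, abs_neg, abs_pow, abs_two]
      _ ≤ K * ν / l ^ 2 * (1 / ν) ^ 2 + 2 * (K * ν / l) ^ 2 * (1 / ν) ^ 3 := by
          gcongr
          exacts [h₃ x hx, bw x hx, h₂ x hx, bw x hx]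
      _ = _ := by field_simp
  have hAc : Continuous A := hA.contDiff.continuous
  have hAc₁ : Continuous (deriv A) := (ScaleBound.contDiff_deriv hA.contDiff).continuous
  have hAc₂ : Continuous (deriv (deriv A)) :=
    (ScaleBound.contDiff_deriv hA.contDiff).continuous_deriv (by norm_num)
  have hA1 := deriv_eq_zero_of_forall_Ioo (hA.contDiff.of_le (by norm_num)) hA0
  have hcm : c ∉ Set.Ioo c d := by simp
  have hdm : d ∉ Set.Ioo c d := by simp
  set B : ℝ → ℂ := fun x => deriv A x * w x + A x * w₁ x with hB
  set B₁ : ℝ → ℂ := fun x => deriv (deriv A) x * w x + deriv A x * w₁ x +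
    (deriv A x * w₁ x + A x * w₂ x) with hB₁
  have hBd : ∀ x ∈ Set.Icc c d, HasDerivAt B (B₁ x) x := fun x hx =>
    ((ScaleBound.hasDerivAt_deriv hA.contDiff x).mul (hwd x hx).ofReal_comp).add
      ((ScaleBound.hasDerivAt hA.contDiff x).mul (hwd₁ x hx).ofReal_comp)
  have hBc : ContinuousOn B (Set.Icc c d) :=
    (hAc₁.continuousOn.mul (hcast hwc)).add (hAc.continuousOn.mul (hcast hw₁c))
  have hB₁c : ContinuousOn B₁ (Set.Icc c d) :=
    ((hAc₂.continuousOn.mul (hcast hwc)).add (hAc₁.continuousOn.mul (hcast hw₁c))).add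
      ((hAc₁.continuousOn.mul (hcast hw₁c)).add (hAc.continuousOn.mul (hcast hw₂c)))
  -- Inserting `q₁ w = 1` brings any integrand into the form to which one integration by parts
  -- applies.
  have hcancel : ∀ (v : ℝ → ℂ), ∫ x in c..d, Complex.exp (Complex.I * θ * Q x) * v x =
      ∫ x in c..d, Complex.exp (Complex.I * θ * Q x) * (q₁ x * (v x * w x)) := fun v => by
    refine intervalIntegral.integral_congr fun x hx => ?_
    rw [Set.uIcc_of_le hcd] at hx
    have : (q₁ x : ℂ) ≠ 0 := by exact_mod_cast hne x hx
    simp only [hw, Complex.ofReal_inv]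
    field_simp
  have step₁ := integral_exp_phase_mul_eq hcd hθ hQ hq₁ (u := fun x => A x * w x) (u' := B)
    (fun x hx => (ScaleBound.hasDerivAt hA.contDiff x).mul (hwd x hx).ofReal_comp) hBc
    (by simp [hA0 c hcm]) (by simp [hA0 d hdm])
  have step₂ := integral_exp_phase_mul_eq hcd hθ hQ hq₁ (u := fun x => B x * w x)
    (u' := fun x => B₁ x * w x + B x * w₁ x)
    (fun x hx => (hBd x hx).mul (hwd x hx).ofReal_comp)
    ((hB₁c.mul (hcast hwc)).add (hBc.mul (hcast hw₁c)))
    (by simp [hB, hA0 c hcm, hA1 c hcm]) (by simp [hB, hA0 d hdm, hA1 d hdm])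
  rw [hcancel A, step₁, hcancel B, step₂, norm_mul, norm_mul]
  have hIθ : ‖Complex.I / (θ : ℂ)‖ = 1 / |θ| := by simp
  have nw : ∀ x ∈ Set.Icc c d, ‖(w x : ℂ)‖ ≤ 1 / ν := fun x hx => by
    rw [Complex.norm_real]; exact bw x hx
  have nw₁ : ∀ x ∈ Set.Icc c d, ‖(w₁ x : ℂ)‖ ≤ K / (ν * l) := fun x hx => by
    rw [Complex.norm_real]; exact bw₁ x hx
  have nw₂ : ∀ x ∈ Set.Icc c d, ‖(w₂ x : ℂ)‖ ≤ (K + 2 * K ^ 2) / (ν * l ^ 2) := fun x hx => by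
    rw [Complex.norm_real]; exact bw₂ x hx
  have nB : ∀ x ∈ Set.Icc c d, ‖B x‖ ≤ M * (1 + K) / (ν * l) := fun x hx => by
    calc _ ≤ ‖deriv A x‖ * ‖(w x : ℂ)‖ + ‖A x‖ * ‖(w₁ x : ℂ)‖ :=
          (norm_add_le _ _).trans (by simp only [norm_mul, le_refl])
      _ ≤ M / l * (1 / ν) + M * (K / (ν * l)) := by
          gcongr
          exacts [hA.bound_one x, nw x hx, hA.bound_zero x, nw₁ x hx]
      _ = _ := by field_simp
  have nB₁ : ∀ x ∈ Set.Icc c d, ‖B₁ x‖ ≤ M * (1 + 3 * K + 2 * K ^ 2) / (ν * l ^ 2) :=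
    fun x hx => by
      calc _ ≤ ‖deriv (deriv A) x‖ * ‖(w x : ℂ)‖ + ‖deriv A x‖ * ‖(w₁ x : ℂ)‖ +
              (‖deriv A x‖ * ‖(w₁ x : ℂ)‖ + ‖A x‖ * ‖(w₂ x : ℂ)‖) := by
            refine (norm_add_le _ _).trans (add_le_add ?_ ?_) <;>
              exact (norm_add_le _ _).trans (by simp only [norm_mul, le_refl])
        _ ≤ M / l ^ 2 * (1 / ν) + M / l * (K / (ν * l)) +
              (M / l * (K / (ν * l)) + M * ((K + 2 * K ^ 2) / (ν * l ^ 2))) := by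
            gcongr
            exacts [hA.bound_two x, nw x hx, hA.bound_one x, nw₁ x hx, hA.bound_one x, nw₁ x hx,
              hA.bound_zero x, nw₂ x hx]
        _ = _ := by field_simp; ring
  have hfinal : ‖∫ x in c..d, Complex.exp (Complex.I * θ * Q x) * (B₁ x * w x + B x * w₁ x)‖ ≤
      3 * (1 + K) ^ 2 * M / (ν * l) ^ 2 * |d - c| := by
    refine intervalIntegral.norm_integral_le_of_norm_le_const fun x hx => ?_
    have hx : x ∈ Set.Icc c d := by
      rw [Set.uIoc_of_le hcd] at hx; exact Set.Ioc_subset_Icc_self hx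
    rw [norm_mul, norm_exp_phase, one_mul]
    calc _ ≤ ‖B₁ x‖ * ‖(w x : ℂ)‖ + ‖B x‖ * ‖(w₁ x : ℂ)‖ :=
          (norm_add_le _ _).trans (by simp only [norm_mul, le_refl])
      _ ≤ M * (1 + 3 * K + 2 * K ^ 2) / (ν * l ^ 2) * (1 / ν) +
            M * (1 + K) / (ν * l) * (K / (ν * l)) := by
          gcongr
          exacts [nB₁ x hx, nw x hx, nB x hx, nw₁ x hx]
      -- The polynomial equals `(1 + K)(1 + 3K)`, hence is at most `3(1 + K)²`.
      _ = (1 + 4 * K + 3 * K ^ 2) * M / (ν * l) ^ 2 := by field_simp; ring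
      _ ≤ _ := by gcongr; nlinarith
  rw [hIθ, abs_of_nonneg (by linarith : 0 ≤ d - c)] at *
  calc _ ≤ 1 / |θ| * (1 / |θ| * (3 * (1 + K) ^ 2 * M / (ν * l) ^ 2 * (d - c))) := by gcongr
    _ = 3 * (1 + K) ^ 2 * M / (|θ| ^ 2 * (ν * l) ^ 2) * (d - c) := by
      have := abs_pos.2 hθ; field_simp
    _ = _ := by rw [sq_abs]; ring

end vanDerCorput

/-! ### Mixed partial derivatives and double differences of the phase -/

section partials

variable {d : ℕ} {S T : (Fin d → ℝ) → ℝ}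

theorem AnalyticAt.pderivAt {x : Fin d → ℝ} (h : AnalyticAt ℝ S x) (j : Fin d) :
    AnalyticAt ℝ (pderivAt j S) x :=
  ((ContinuousLinearMap.apply ℝ ℝ (Pi.single j (1 : ℝ) : Fin d → ℝ)).analyticAt _).comp h.fderiv

theorem pderivAt_comm {x : Fin d → ℝ} (h : AnalyticAt ℝ S x) (i j : Fin d) :
    pderivAt i (pderivAt j S) x = pderivAt j (pderivAt i S) x := by
  have hd : DifferentiableAt ℝ (fderiv ℝ S) x := h.fderiv.differentiableAt
  have e : ∀ k l : Fin d, pderivAt k (pderivAt l S) x =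
      fderiv ℝ (fderiv ℝ S) x (Pi.single k 1) (Pi.single l 1) := fun k l => by
    unfold pderivAt
    rw [fderiv_clm_apply hd (by fun_prop)]
    simp
  rw [e, e]
  exact (h.contDiffAt (n := 2)).isSymmSndFDerivAt (by simp) _ _

theorem pderivAt_congr_of_isOpen {U : Set (Fin d → ℝ)} (hU : IsOpen U)
    (h : ∀ x ∈ U, S x = T x) (j : Fin d) : ∀ x ∈ U, pderivAt j S x = pderivAt j T x := by
  intro x hx
  have : S =ᶠ[nhds x] T := by filter_upwards [hU.mem_nhds hx] with y hy using h y hy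
  unfold pderivAt
  rw [this.fderiv_eq]

end partials

section slices

variable {g : (Fin 3 → ℝ) → ℝ} {S : (Fin 3 → ℝ) → ℝ}

theorem hasDerivAt_slice_zero {x y z : ℝ} (h : AnalyticAt ℝ g ![x, y, z]) :
    HasDerivAt (fun t => g ![t, y, z]) (pderivAt 0 g ![x, y, z]) x := by
  have hc : HasDerivAt (fun t : ℝ => ![t, y, z]) (Pi.single 0 1 : Fin 3 → ℝ) x := by
    rw [hasDerivAt_pi]
    intro i
    fin_cases i
    · exact hasDerivAt_id x
    · exact hasDerivAt_const x y
    · exact hasDerivAt_const x z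
  exact h.differentiableAt.hasFDerivAt.comp_hasDerivAt x hc

theorem hasDerivAt_slice_one {x y z : ℝ} (h : AnalyticAt ℝ g ![x, y, z]) :
    HasDerivAt (fun t => g ![x, t, z]) (pderivAt 1 g ![x, y, z]) y := by
  have hc : HasDerivAt (fun t : ℝ => ![x, t, z]) (Pi.single 1 1 : Fin 3 → ℝ) y := by
    rw [hasDerivAt_pi]
    intro i
    fin_cases i
    · exact hasDerivAt_const y x
    · exact hasDerivAt_id y
    · exact hasDerivAt_const y z
  exact h.differentiableAt.hasFDerivAt.comp_hasDerivAt y hc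

theorem hasDerivAt_slice_two {x y z : ℝ} (h : AnalyticAt ℝ g ![x, y, z]) :
    HasDerivAt (fun t => g ![x, y, t]) (pderivAt 2 g ![x, y, z]) z := by
  have hc : HasDerivAt (fun t : ℝ => ![x, y, t]) (Pi.single 2 1 : Fin 3 → ℝ) z := by
    rw [hasDerivAt_pi]
    intro i
    fin_cases i
    · exact hasDerivAt_const z x
    · exact hasDerivAt_const z y
    · exact hasDerivAt_id z
  exact h.differentiableAt.hasFDerivAt.comp_hasDerivAt z hc

theorem exists_sub_eq_deriv_mul_sub {f f' : ℝ → ℝ} {a b : ℝ}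
    (h : ∀ x ∈ Set.uIcc a b, HasDerivAt f (f' x) x) :
    ∃ ξ ∈ Set.uIcc a b, f b - f a = f' ξ * (b - a) := by
  have key : ∀ a b : ℝ, a < b → (∀ x ∈ Set.uIcc a b, HasDerivAt f (f' x) x) →
      ∃ ξ ∈ Set.uIcc a b, f b - f a = f' ξ * (b - a) := by
    intro a b hab h
    rw [Set.uIcc_of_le hab.le] at h ⊢
    obtain ⟨ξ, hξ, e⟩ := exists_hasDerivAt_eq_slope f f' hab
      (fun x hx => (h x hx).continuousAt.continuousWithinAt)
      (fun x hx => h x (Set.Ioo_subset_Icc_self hx))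
    refine ⟨ξ, Set.Ioo_subset_Icc_self hξ, ?_⟩
    rw [e, div_mul_cancel₀ _ (sub_ne_zero.2 hab.ne')]
  rcases lt_trichotomy a b with hab | rfl | hab
  · exact key a b hab h
  · exact ⟨a, by simp, by simp⟩
  · rw [Set.uIcc_comm] at h ⊢
    obtain ⟨ξ, hξ, e⟩ := key b a hab h
    exact ⟨ξ, hξ, by linarith⟩

/-- The double difference of `g` in the last two variables. -/
def doubleDiff (g : (Fin 3 → ℝ) → ℝ) (y y' z z' x : ℝ) : ℝ :=
  g ![x, y, z] - g ![x, y, z'] - (g ![x, y', z] - g ![x, y', z'])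

variable {J L : Set ℝ} {y y' z z' x : ℝ}

/-- Apply the mean value theorem in the second variable to the difference of two slices, then in the
third variable to `∂₁g` at the point `ξ` so found. The intermediate point may lie anywhere in the
rectangle, which is why control of the phase is required on full boxes. -/
theorem exists_doubleDiff_eq (hJ : J.OrdConnected) (hL : L.OrdConnected)
    (hg : ∀ y ∈ J, ∀ z ∈ L, AnalyticAt ℝ g ![x, y, z]) (hy : y ∈ J) (hy' : y' ∈ J) (hz : z ∈ L)
    (hz' : z' ∈ L) : ∃ ξ ∈ J, ∃ η ∈ L, doubleDiff g y y' z z' x =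
      pderivAt 2 (pderivAt 1 g) ![x, ξ, η] * ((y - y') * (z - z')) := by
  obtain ⟨ξ, hξ, e⟩ := exists_sub_eq_deriv_mul_sub (a := y') (b := y)
    (f := fun s => g ![x, s, z] - g ![x, s, z'])
    (f' := fun s => pderivAt 1 g ![x, s, z] - pderivAt 1 g ![x, s, z']) fun s hs => by
      have hs := hJ.uIcc_subset hy' hy hs
      exact (hasDerivAt_slice_one (hg s hs z hz)).sub (hasDerivAt_slice_one (hg s hs z' hz'))
  have hξ := hJ.uIcc_subset hy' hy hξ
  obtain ⟨η, hη, e'⟩ := exists_sub_eq_deriv_mul_sub (a := z') (b := z)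
    (f := fun t => pderivAt 1 g ![x, ξ, t])
    (f' := fun t => pderivAt 2 (pderivAt 1 g) ![x, ξ, t]) fun t ht =>
      hasDerivAt_slice_two ((hg ξ hξ t (hL.uIcc_subset hz' hz ht)).pderivAt 1)
  refine ⟨ξ, hξ, η, hL.uIcc_subset hz' hz hη, ?_⟩
  rw [doubleDiff, e, e']
  ring

/-- Double differences in the last two variables commute with `∂₀`, so successive derivatives of the
fourfold phase are double differences of `∂₀S`, `∂₀²S`, `∂₀³S`. -/
theorem hasDerivAt_doubleDiff (hg : ∀ y ∈ J, ∀ z ∈ L, AnalyticAt ℝ g ![x, y, z]) (hy : y ∈ J)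
    (hy' : y' ∈ J) (hz : z ∈ L) (hz' : z' ∈ L) :
    HasDerivAt (doubleDiff g y y' z z') (doubleDiff (pderivAt 0 g) y y' z z' x) x :=
  ((hasDerivAt_slice_zero (hg y hy z hz)).sub (hasDerivAt_slice_zero (hg y hy z' hz'))).sub
    ((hasDerivAt_slice_zero (hg y' hy' z hz)).sub (hasDerivAt_slice_zero (hg y' hy' z' hz')))

theorem mixedDeriv_three (S : (Fin 3 → ℝ) → ℝ) :
    mixedDeriv S = pderivAt 0 (pderivAt 1 (pderivAt 2 S)) := rfl

theorem isOpen_setOf_analyticAt (S : (Fin 3 → ℝ) → ℝ) : IsOpen {p | AnalyticAt ℝ S p} :=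
  isOpen_analyticAt ℝ S

/-- The mean value theorem produces the derivatives in the order opposite to that in `mixedDeriv`.
Commuting inner derivatives requires symmetry in a neighbourhood of the point, which the openness of
the set of analyticity supplies. -/
theorem pderivAt_two_one_zero_eq_mixedDeriv {p : Fin 3 → ℝ} (h : AnalyticAt ℝ S p) :
    pderivAt 2 (pderivAt 1 (pderivAt 0 S)) p = mixedDeriv S p := by
  have hU := isOpen_setOf_analyticAt S
  have e1 : pderivAt 2 (pderivAt 1 (pderivAt 0 S)) p = pderivAt 2 (pderivAt 0 (pderivAt 1 S)) p :=
    pderivAt_congr_of_isOpen hU (fun q hq => pderivAt_comm hq 1 0) 2 p h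
  have e2 : pderivAt 0 (pderivAt 2 (pderivAt 1 S)) p = pderivAt 0 (pderivAt 1 (pderivAt 2 S)) p :=
    pderivAt_congr_of_isOpen hU (fun q hq => pderivAt_comm hq 2 1) 0 p h
  rw [e1, pderivAt_comm (h.pderivAt 1), e2, mixedDeriv_three]

theorem pderivAt_two_one_zero_comm {p : Fin 3 → ℝ} (h : AnalyticAt ℝ S p) :
    pderivAt 2 (pderivAt 1 (pderivAt 0 S)) p = pderivAt 0 (pderivAt 2 (pderivAt 1 S)) p := by
  have hU := isOpen_setOf_analyticAt S
  have e1 : pderivAt 2 (pderivAt 1 (pderivAt 0 S)) p = pderivAt 2 (pderivAt 0 (pderivAt 1 S)) p :=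
    pderivAt_congr_of_isOpen hU (fun q hq => pderivAt_comm hq 1 0) 2 p h
  rw [e1, pderivAt_comm (h.pderivAt 1)]

theorem pderivAt_two_one_zero_zero_eq {p : Fin 3 → ℝ} (h : AnalyticAt ℝ S p) :
    pderivAt 2 (pderivAt 1 (pderivAt 0 (pderivAt 0 S))) p = pderivAt 0 (mixedDeriv S) p := by
  rw [pderivAt_two_one_zero_comm (h.pderivAt 0)]
  exact pderivAt_congr_of_isOpen (isOpen_setOf_analyticAt S)
    (fun q hq => pderivAt_two_one_zero_eq_mixedDeriv hq) 0 p h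

theorem pderivAt_two_one_zero_zero_zero_eq {p : Fin 3 → ℝ} (h : AnalyticAt ℝ S p) :
    pderivAt 2 (pderivAt 1 (pderivAt 0 (pderivAt 0 (pderivAt 0 S)))) p =
      pderivAt 0 (pderivAt 0 (mixedDeriv S)) p := by
  rw [pderivAt_two_one_zero_comm ((h.pderivAt 0).pderivAt 0)]
  exact pderivAt_congr_of_isOpen (isOpen_setOf_analyticAt S)
    (fun q hq => pderivAt_two_one_zero_zero_eq hq) 0 p h

end slices

/-! ### Fourfold orthogonality -/

/-- The fourfold orthogonality bound on a box where the mixed derivative of the phase is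
controlled. -/
theorem norm_fourfold_integral_le {S : (Fin 3 → ℝ) → ℝ} {c d l lam μ K M : ℝ} {J L : Set ℝ}
    (hJ : J.OrdConnected) (hL : L.OrdConnected) (hcd : d - c = 2 * l) (hl : 0 < l)
    (hlam : lam ≠ 0) (hμ : 0 < μ) (hK : 0 ≤ K)
    (hS : ∀ x ∈ Set.Icc c d, ∀ y ∈ J, ∀ z ∈ L, AnalyticAt ℝ S ![x, y, z])
    (h₁ : ∀ x ∈ Set.Icc c d, ∀ y ∈ J, ∀ z ∈ L, μ ≤ |mixedDeriv S ![x, y, z]|)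
    (h₂ : ∀ x ∈ Set.Icc c d, ∀ y ∈ J, ∀ z ∈ L,
      |pderivAt 0 (mixedDeriv S) ![x, y, z]| ≤ K * μ / l)
    (h₃ : ∀ x ∈ Set.Icc c d, ∀ y ∈ J, ∀ z ∈ L,
      |pderivAt 0 (pderivAt 0 (mixedDeriv S)) ![x, y, z]| ≤ K * μ / l ^ 2)
    {α : ℝ → ℝ → ℝ → ℂ} (hα : ∀ y z, ScaleBound (fun x => α x y z) M l)
    (hαx : ∀ x y z, x ∉ Set.Ioo c d → α x y z = 0) (hαy : ∀ x y z, y ∉ J → α x y z = 0)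
    (hαz : ∀ x y z, z ∉ L → α x y z = 0) {E : ℝ → ℝ → ℝ → ℂ}
    (hE : ∀ x y z, E x y z = Complex.exp (Complex.I * lam * S ![x, y, z]) * α x y z)
    (y y' z z' : ℝ) :
    ‖∫ x in Set.Icc c d, E x y z * conj (E x y z') * conj (E x y' z * conj (E x y' z'))‖ ≤
      768 * (1 + K) ^ 2 * M ^ 4 * cauchyKernel l (|lam| * μ) (y - y') (z - z') := by
  have hM : 0 ≤ M := (hα 0 0).nonneg
  have hker : 0 ≤ cauchyKernel l (|lam| * μ) (y - y') (z - z') := by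
    unfold cauchyKernel; positivity
  have hzero : (∀ x, E x y z * conj (E x y z') * conj (E x y' z * conj (E x y' z')) = 0) →
      ‖∫ x in Set.Icc c d, E x y z * conj (E x y z') * conj (E x y' z * conj (E x y' z'))‖ ≤
      768 * (1 + K) ^ 2 * M ^ 4 * cauchyKernel l (|lam| * μ) (y - y') (z - z') := fun h => by
    simp_rw [h]
    rw [integral_zero, norm_zero]
    positivity
  by_cases hy : y ∈ J
  swap
  · exact hzero fun x => by simp [hE, hαy x y z hy]
  by_cases hy' : y' ∈ J
  swap
  · exact hzero fun x => by simp [hE, hαy x y' z hy']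
  by_cases hz : z ∈ L
  swap
  · exact hzero fun x => by simp [hE, hαz x y z hz]
  by_cases hz' : z' ∈ L
  swap
  · exact hzero fun x => by simp [hE, hαz x y z' hz']
  have hcd' : c ≤ d := by linarith
  set A : ℝ → ℂ := fun x => α x y z * conj (α x y z') * (conj (α x y' z) * α x y' z') with hAdef
  -- Two levels of products, each multiplication costing a factor `4`: `4 · 4 · 4 = 64`.
  have hA : ScaleBound A (64 * M ^ 4) l := by
    have h := (((hα y z).mul (hα y z').conjugate hl).mul ((hα y' z).conjugate.mul (hα y' z') hl) hl)
    rw [show 64 * M ^ 4 = 4 * (4 * (M * M) * (4 * (M * M))) by ring]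
    exact h
  have hA0 : ∀ x, x ∉ Set.Ioo c d → A x = 0 := fun x hx => by simp [hAdef, hαx x y z hx]
  -- The pattern of conjugations gives the four phases the signs `+ - - +` of the double difference.
  set Q := doubleDiff S y y' z z' with hQ
  have hconjexp : ∀ q : ℝ, conj (Complex.exp (Complex.I * lam * q)) =
      Complex.exp (-(Complex.I * lam * q)) := fun q => by
    rw [← Complex.exp_conj]
    simp
  have hconjexp' : ∀ q : ℝ, conj (Complex.exp (-(Complex.I * lam * q))) =
      Complex.exp (Complex.I * lam * q) := fun q => by
    rw [← hconjexp, Complex.conj_conj]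
  have hint : ∀ x, E x y z * conj (E x y z') * conj (E x y' z * conj (E x y' z')) =
      Complex.exp (Complex.I * lam * Q x) * A x := fun x => by
    simp only [hE, map_mul, Complex.conj_conj, hconjexp, hconjexp', hAdef, hQ, doubleDiff]
    rw [show Complex.I * lam * ((S ![x, y, z] - S ![x, y, z'] - (S ![x, y', z] - S ![x, y', z']) :
      ℝ) : ℂ) = Complex.I * lam * S ![x, y, z] + -(Complex.I * lam * S ![x, y, z']) +
        (-(Complex.I * lam * S ![x, y', z]) + Complex.I * lam * S ![x, y', z']) by push_cast; ring,
      Complex.exp_add, Complex.exp_add, Complex.exp_add]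
    ring
  simp_rw [hint]
  rw [integral_Icc_eq_integral_Ioc, ← intervalIntegral.integral_of_le hcd']
  have htriv : ‖∫ x in c..d, Complex.exp (Complex.I * lam * Q x) * A x‖ ≤
      64 * M ^ 4 * |d - c| := by
    refine intervalIntegral.norm_integral_le_of_norm_le_const fun x _ => ?_
    rw [norm_mul, norm_exp_phase, one_mul]
    exact hA.bound_zero x
  rw [hcd, abs_of_pos (by positivity)] at htriv
  set s := |lam| * μ * l * |y - y'| * |z - z'| with hs
  have hs0 : 0 ≤ s := by positivity
  set V := ‖∫ x in c..d, Complex.exp (Complex.I * lam * Q x) * A x‖ with hV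
  -- Stated with `s ^ 2` on the left so that the degenerate case `y = y'` or `z = z'`, where there
  -- is no oscillation, is trivial.
  have hdecay : V * s ^ 2 ≤ 192 * (1 + K) ^ 2 * M ^ 4 * (2 * l) := by
    rcases eq_or_lt_of_le hs0 with h0 | hspos
    · rw [← h0, zero_pow two_ne_zero, mul_zero]; positivity
    have hw : 0 < |y - y'| * |z - z'| := by
      by_contra hcon
      have : |y - y'| * |z - z'| = 0 := le_antisymm (not_lt.1 hcon) (by positivity)
      rw [hs, mul_assoc, this, mul_zero] at hspos
      exact lt_irrefl _ hspos
    have hbd : ∀ (g : (Fin 3 → ℝ) → ℝ) (x : ℝ),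
        (∀ y ∈ J, ∀ z ∈ L, AnalyticAt ℝ g ![x, y, z]) → ∃ ξ ∈ J, ∃ η ∈ L,
        |doubleDiff g y y' z z' x| =
          |pderivAt 2 (pderivAt 1 g) ![x, ξ, η]| * (|y - y'| * |z - z'|) := fun g x hg => by
      obtain ⟨ξ, hξ, η, hη, e⟩ := exists_doubleDiff_eq hJ hL hg hy hy' hz hz'
      exact ⟨ξ, hξ, η, hη, by rw [e, abs_mul, abs_mul]⟩
    have hg₁ : ∀ x ∈ Set.Icc c d, ∀ y ∈ J, ∀ z ∈ L, AnalyticAt ℝ (pderivAt 0 S) ![x, y, z] :=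
      fun x hx y hy z hz => (hS x hx y hy z hz).pderivAt 0
    have hg₂ : ∀ x ∈ Set.Icc c d, ∀ y ∈ J, ∀ z ∈ L,
        AnalyticAt ℝ (pderivAt 0 (pderivAt 0 S)) ![x, y, z] :=
      fun x hx y hy z hz => (hg₁ x hx y hy z hz).pderivAt 0
    have hg₃ : ∀ x ∈ Set.Icc c d, ∀ y ∈ J, ∀ z ∈ L,
        AnalyticAt ℝ (pderivAt 0 (pderivAt 0 (pderivAt 0 S))) ![x, y, z] :=
      fun x hx y hy z hz => (hg₂ x hx y hy z hz).pderivAt 0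
    -- All derivatives of `Q` share the factor `|y - y'| |z - z'|`, so with `ν` equal to `μ` times
    -- this factor the ratio conditions hold with the same constant `K`.
    have h := norm_integral_exp_phase_mul_le hcd' hlam
      (fun x hx => hasDerivAt_doubleDiff (hS x hx) hy hy' hz hz')
      (fun x hx => hasDerivAt_doubleDiff (hg₁ x hx) hy hy' hz hz')
      (fun x hx => hasDerivAt_doubleDiff (hg₂ x hx) hy hy' hz hz')
      (fun x hx => (hasDerivAt_doubleDiff (hg₃ x hx) hy hy' hz hz').continuousAt.continuousWithinAt)
      hA hA0 hl (ν := μ * (|y - y'| * |z - z'|)) (by positivity) hK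
      (fun x hx => by
        obtain ⟨ξ, hξ, η, hη, e⟩ := hbd _ x (hg₁ x hx)
        rw [e, pderivAt_two_one_zero_eq_mixedDeriv (hS x hx ξ hξ η hη)]
        gcongr
        exact h₁ x hx ξ hξ η hη)
      (fun x hx => by
        obtain ⟨ξ, hξ, η, hη, e⟩ := hbd _ x (hg₂ x hx)
        rw [e, pderivAt_two_one_zero_zero_eq (hS x hx ξ hξ η hη)]
        calc _ ≤ K * μ / l * (|y - y'| * |z - z'|) := by gcongr; exact h₂ x hx ξ hξ η hη
          _ = _ := by ring)
      (fun x hx => by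
        obtain ⟨ξ, hξ, η, hη, e⟩ := hbd _ x (hg₃ x hx)
        rw [e, pderivAt_two_one_zero_zero_zero_eq (hS x hx ξ hξ η hη)]
        calc _ ≤ K * μ / l ^ 2 * (|y - y'| * |z - z'|) := by gcongr; exact h₃ x hx ξ hξ η hη
          _ = _ := by ring)
    have hsq : (lam * (μ * (|y - y'| * |z - z'|)) * l) ^ 2 = s ^ 2 := by
      rw [hs]; simp only [mul_pow, sq_abs]; ring
    rw [hsq, hcd] at h
    calc V * s ^ 2 ≤ 3 * (1 + K) ^ 2 * (64 * M ^ 4) / s ^ 2 * (2 * l) * s ^ 2 := by gcongr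
      _ = _ := by field_simp; ring
  have hKK : 1 ≤ (1 + K) ^ 2 := by nlinarith
  -- The trivial bound is used for the summand `1` and the decay for `s ^ 2`; together they give the
  -- Cauchy kernel.
  have hsum : V * (1 + s ^ 2) ≤ 768 * (1 + K) ^ 2 * M ^ 4 * l := by
    have : 64 * M ^ 4 * (2 * l) ≤ (1 + K) ^ 2 * (64 * M ^ 4 * (2 * l)) :=
      le_mul_of_one_le_left (by positivity) hKK
    have hp : 0 ≤ (1 + K) ^ 2 * M ^ 4 * l := by positivity
    nlinarith
  have hfin : V ≤ 768 * (1 + K) ^ 2 * M ^ 4 * l / (1 + s ^ 2) := by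
    rw [le_div_iff₀ (by positivity)]; exact hsum
  calc V ≤ _ := hfin
    _ = _ := by rw [cauchyKernel, hs]; ring

/-! ### Iterated integrals in coordinates and the estimate on one box -/

section coordinates

theorem lintegral_fin_two {G : (Fin 2 → ℝ) → ℝ≥0∞} (hG : Measurable G) :
    ∫⁻ w, G w = ∫⁻ y, ∫⁻ z, G ![y, z] := by
  rw [← (volume_preserving_finTwoArrow ℝ).symm.lintegral_comp hG]
  exact lintegral_prod _ (hG.comp (MeasurableEquiv.measurable _)).aemeasurable

theorem lintegral_fin_three {G : (Fin 3 → ℝ) → ℝ≥0∞} (hG : Measurable G) :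
    ∫⁻ v, G v = ∫⁻ x, ∫⁻ y, ∫⁻ z, G ![x, y, z] := by
  have e : ∀ p : ℝ × (Fin 2 → ℝ), (MeasurableEquiv.piFinSuccAbove (fun _ : Fin 3 => ℝ) 0).symm p =
      Matrix.vecCons p.1 p.2 := fun p => by
    simp [MeasurableEquiv.piFinSuccAbove, Matrix.vecCons, Fin.insertNthEquiv]
  have hm : Measurable fun p : ℝ × (Fin 2 → ℝ) => G (Matrix.vecCons p.1 p.2) := by
    simp_rw [← e]
    exact hG.comp (MeasurableEquiv.measurable _)
  rw [← (volume_preserving_piFinSuccAbove (fun _ : Fin 3 => ℝ) 0).symm.lintegral_comp hG]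
  simp_rw [e]
  refine (lintegral_prod _ hm.aemeasurable).trans (lintegral_congr fun x => ?_)
  exact lintegral_fin_two (hm.comp (f := fun w : Fin 2 → ℝ => (x, w)) (by fun_prop))

theorem integral_fin_three {G : (Fin 3 → ℝ) → ℂ} (hG : Integrable G) :
    ∫ v, G v = ∫ x, ∫ y, ∫ z, G ![x, y, z] := by
  have hmp := (volume_preserving_piFinSuccAbove (fun _ : Fin 3 => ℝ) 0).symm
  have e : ∀ p : ℝ × (Fin 2 → ℝ), (MeasurableEquiv.piFinSuccAbove (fun _ : Fin 3 => ℝ) 0).symm p =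
      Matrix.vecCons p.1 p.2 := fun p => by
    simp [MeasurableEquiv.piFinSuccAbove, Matrix.vecCons, Fin.insertNthEquiv]
  rw [← hmp.integral_comp' G]
  have hI : Integrable (fun p : ℝ × (Fin 2 → ℝ) => G (Matrix.vecCons p.1 p.2)) := by
    have := (hmp.integrable_comp_emb (MeasurableEquiv.measurableEmbedding _)).2 hG
    simpa only [Function.comp_def, e] using this
  simp_rw [e]
  refine (integral_prod _ hI).trans (integral_congr_ae ?_)
  filter_upwards [hI.prod_right_ae] with x hx
  have hmp2 := (volume_preserving_finTwoArrow ℝ).symm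
  rw [← hmp2.integral_comp' fun w => G (Matrix.vecCons x w)]
  exact integral_prod _ ((hmp2.integrable_comp_emb (MeasurableEquiv.measurableEmbedding _)).2 hx)

theorem Icc_vec_two (a b c d y z : ℝ) :
    ![y, z] ∈ Set.Icc (![a, b] : Fin 2 → ℝ) ![c, d] ↔ y ∈ Set.Icc a c ∧ z ∈ Set.Icc b d := by
  simp only [Set.mem_Icc, Pi.le_def, Fin.forall_fin_two]
  simp
  tauto

theorem setLIntegral_fin_two {G : (Fin 2 → ℝ) → ℝ≥0∞} (hG : Measurable G) (c d : Fin 2 → ℝ) :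
    ∫⁻ w in Set.Icc c d, G w =
      ∫⁻ y in Set.Icc (c 0) (d 0), ∫⁻ z in Set.Icc (c 1) (d 1), G ![y, z] := by
  rw [← lintegral_indicator measurableSet_Icc, lintegral_fin_two (hG.indicator measurableSet_Icc),
    ← lintegral_indicator measurableSet_Icc]
  refine lintegral_congr fun y => ?_
  by_cases hy : y ∈ Set.Icc (c 0) (d 0)
  · rw [Set.indicator_of_mem hy, ← lintegral_indicator measurableSet_Icc]
    refine lintegral_congr fun z => ?_
    have : ![y, z] ∈ Set.Icc c d ↔ z ∈ Set.Icc (c 1) (d 1) := by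
      have := Icc_vec_two (c 0) (c 1) (d 0) (d 1) y z
      rw [show ![c 0, c 1] = c by ext i; fin_cases i <;> rfl,
        show ![d 0, d 1] = d by ext i; fin_cases i <;> rfl] at this
      rw [this]; exact and_iff_right hy
    by_cases hz : z ∈ Set.Icc (c 1) (d 1)
    · rw [Set.indicator_of_mem hz, Set.indicator_of_mem (this.2 hz)]
    · rw [Set.indicator_of_notMem hz, Set.indicator_of_notMem (fun h => hz (this.1 h))]
  · rw [Set.indicator_of_notMem hy, ← lintegral_zero (μ := (volume : Measure ℝ))]
    refine lintegral_congr fun z => Set.indicator_of_notMem (fun h => hy ?_) _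
    exact ⟨h.1 0, h.2 0⟩

theorem hatProj_zero (x y z : ℝ) : hatProj 0 ![x, y, z] = ![y, z] := by
  ext i; fin_cases i <;> rfl

theorem hatProj_one (x y z : ℝ) : hatProj 1 ![x, y, z] = ![x, z] := by
  ext i; fin_cases i <;> rfl

theorem hatProj_two (x y z : ℝ) : hatProj 2 ![x, y, z] = ![x, y] := by
  ext i; fin_cases i <;> rfl

theorem measurable_hatProj {n : ℕ} (j : Fin (n + 1)) : Measurable (hatProj j) :=
  measurable_pi_lambda _ fun _ => measurable_pi_apply _

theorem measurable_vec_two {γ : Type*} [MeasurableSpace γ] {a b : γ → ℝ} (ha : Measurable a)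
    (hb : Measurable b) : Measurable fun p => ![a p, b p] := by
  refine measurable_pi_lambda _ fun i => ?_
  fin_cases i
  · exact ha
  · exact hb

theorem measurable_vec_three {γ : Type*} [MeasurableSpace γ] {a b c : γ → ℝ} (ha : Measurable a)
    (hb : Measurable b) (hc : Measurable c) : Measurable fun p => ![a p, b p, c p] := by
  refine measurable_pi_lambda _ fun i => ?_
  fin_cases i
  · exact ha
  · exact hb
  · exact hc

theorem Icc_vec_three (c d : Fin 3 → ℝ) (x y z : ℝ) :
    ![x, y, z] ∈ Set.Icc c d ↔
      x ∈ Set.Icc (c 0) (d 0) ∧ y ∈ Set.Icc (c 1) (d 1) ∧ z ∈ Set.Icc (c 2) (d 2) := by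
  simp only [Set.mem_Icc, Pi.le_def, Fin.forall_fin_succ]
  simp
  tauto

end coordinates

theorem integrable_of_bound_of_subset_Icc {c d : Fin 3 → ℝ} {F : (Fin 3 → ℝ) → ℂ}
    (hF : Measurable F) {B : ℝ} (hB : ∀ x, ‖F x‖ ≤ B) (h0 : ∀ x, x ∉ Set.Icc c d → F x = 0) :
    Integrable F := by
  have hsub : Function.support F ⊆ Set.Icc c d := fun x hx => by
    by_contra h
    exact hx (h0 x h)
  rw [← integrableOn_iff_integrable_of_support_subset hsub]
  have : IsFiniteMeasure (volume.restrict (Set.Icc c d)) :=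
    ⟨by rw [Measure.restrict_apply_univ]; exact isCompact_Icc.measure_lt_top⟩
  exact integrable_of_forall_norm_le hF hB

/-- The trilinear estimate on a box, for an amplitude adapted to the box. -/
theorem enorm_box_integral_le {S : (Fin 3 → ℝ) → ℝ} {c d : Fin 3 → ℝ} {l lam μ K M : ℝ}
    (hcd : d 0 - c 0 = 2 * l) (hl : 0 < l) (hlam : lam ≠ 0) (hμ : 0 < μ) (hK : 0 ≤ K)
    (hS : ∀ x ∈ Set.Icc c d, AnalyticAt ℝ S x)
    (h₁ : ∀ x ∈ Set.Icc c d, μ ≤ |mixedDeriv S x|)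
    (h₂ : ∀ x ∈ Set.Icc c d, |pderivAt 0 (mixedDeriv S) x| ≤ K * μ / l)
    (h₃ : ∀ x ∈ Set.Icc c d, |pderivAt 0 (pderivAt 0 (mixedDeriv S)) x| ≤ K * μ / l ^ 2)
    {α : (Fin 3 → ℝ) → ℂ} (hα : ∀ y z, ScaleBound (fun x => α ![x, y, z]) M l)
    (hα0 : ∀ x, x ∉ Set.Icc c d → α x = 0) (hαx : ∀ x, x 0 ∉ Set.Ioo (c 0) (d 0) → α x = 0)
    (hm : Measurable fun x => Complex.exp (Complex.I * lam * S x) * α x)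
    {f : Fin 3 → (Fin 2 → ℝ) → ℂ} (hf : ∀ j, Measurable (f j)) {B : ℝ}
    (hB : ∀ j w, ‖f j w‖ ≤ B) :
    ‖∫ x, Complex.exp (Complex.I * lam * S x) * α x * ∏ j, f j (hatProj j x)‖ₑ ≤
      8 * ENNReal.ofReal (2 * Real.pi * (768 * (1 + K) ^ 2 * M ^ 4) / (|lam| * μ)) ^ (1 / 4 : ℝ) *
        ∏ j, (∫⁻ w in Set.Icc (hatProj j c) (hatProj j d), ‖f j w‖ₑ ^ (8 / 3 : ℝ)) ^
          (3 / 8 : ℝ) := by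
  set E : ℝ → ℝ → ℝ → ℂ := fun x y z =>
    Complex.exp (Complex.I * lam * S ![x, y, z]) * α ![x, y, z] with hE
  have hmem := Icc_vec_three c d
  have hαb : ∀ x, ‖α x‖ ≤ M := fun x => by
    have := (hα (x 1) (x 2)).bound_zero (x 0)
    rwa [show ![x 0, x 1, x 2] = x by ext i; fin_cases i <;> rfl] at this
  have hM : 0 ≤ M := (hα 0 0).nonneg
  have hB0 : 0 ≤ B := (norm_nonneg _).trans (hB 0 0)
  have hEb : ∀ x, ‖Complex.exp (Complex.I * lam * S x) * α x‖ ≤ M := fun x => by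
    rw [norm_mul, norm_exp_phase, one_mul]; exact hαb x
  have hprodm : Measurable fun x : Fin 3 → ℝ => ∏ j, f j (hatProj j x) :=
    Finset.measurable_prod _ fun j _ => (hf j).comp (measurable_hatProj j)
  have hI : Integrable fun x => Complex.exp (Complex.I * lam * S x) * α x *
      ∏ j, f j (hatProj j x) := by
    refine integrable_of_bound_of_subset_Icc (c := c) (d := d) (B := M * ∏ _j : Fin 3, B)
      (hm.mul hprodm) (fun x => ?_) (fun x hx => by simp [hα0 x hx])
    rw [norm_mul, norm_prod]
    gcongr with j
    · exact hEb x
    · exact hB j _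
  have hfour := norm_fourfold_integral_le (J := Set.Icc (c 1) (d 1)) (L := Set.Icc (c 2) (d 2))
    Set.ordConnected_Icc Set.ordConnected_Icc hcd hl hlam hμ hK
    (fun x hx y hy z hz => hS _ ((hmem x y z).2 ⟨hx, hy, hz⟩))
    (fun x hx y hy z hz => h₁ _ ((hmem x y z).2 ⟨hx, hy, hz⟩))
    (fun x hx y hy z hz => h₂ _ ((hmem x y z).2 ⟨hx, hy, hz⟩))
    (fun x hx y hy z hz => h₃ _ ((hmem x y z).2 ⟨hx, hy, hz⟩))
    (α := fun x y z => α ![x, y, z]) hα (fun x y z hx => hαx _ hx)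
    (fun x y z hy => hα0 _ fun h => hy ((hmem x y z).1 h).2.1)
    (fun x y z hz => hα0 _ fun h => hz ((hmem x y z).1 h).2.2) (E := E) (fun x y z => rfl)
  have hfin : ∀ a b : ℝ, IsFiniteMeasure (volume.restrict (Set.Icc a b)) := fun a b =>
    ⟨by rw [Measure.restrict_apply_univ]; exact isCompact_Icc.measure_lt_top⟩
  have := hfin (c 0) (d 0)
  have := hfin (c 1) (d 1)
  have := hfin (c 2) (d 2)
  have hpair : ∀ j, Measurable (Function.uncurry fun y z => f j ![y, z]) := fun j =>
    (hf j).comp (measurable_vec_two measurable_fst measurable_snd)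
  have key := enorm_trilinear_le (volume.restrict (Set.Icc (c 0) (d 0)))
    (volume.restrict (Set.Icc (c 1) (d 1))) (volume.restrict (Set.Icc (c 2) (d 2)))
    Measure.restrict_le_self Measure.restrict_le_self (E := E)
    (hm.comp (measurable_vec_three (by fun_prop) (by fun_prop) (by fun_prop)))
    (fun x y z => hEb _) (A := 768 * (1 + K) ^ 2 * M ^ 4) (by positivity) hl
    (θ := |lam| * μ) (by positivity) hfour (hpair 0) (hpair 1) (hpair 2)
    (fun y z => hB 0 _) (fun x z => hB 1 _) (fun x y => hB 2 _)
  have hnorm : ∀ j, Measurable fun w => ‖f j w‖ₑ ^ (8 / 3 : ℝ) := fun j =>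
    (hf j).enorm.pow_const _
  have e : ∫ x, Complex.exp (Complex.I * lam * S x) * α x * ∏ j, f j (hatProj j x) =
      ∫ x in Set.Icc (c 0) (d 0), ∫ y in Set.Icc (c 1) (d 1), ∫ z in Set.Icc (c 2) (d 2),
        E x y z * f 0 ![y, z] * f 1 ![x, z] * f 2 ![x, y] := by
    rw [integral_fin_three hI]
    have e1 : ∀ x y z, Complex.exp (Complex.I * lam * S ![x, y, z]) * α ![x, y, z] *
        ∏ j, f j (hatProj j ![x, y, z]) = E x y z * f 0 ![y, z] * f 1 ![x, z] * f 2 ![x, y] :=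
      fun x y z => by
        rw [Fin.prod_univ_three, hatProj_zero, hatProj_one, hatProj_two]; ring
    simp_rw [e1]
    have hz : ∀ x y z, (x ∉ Set.Icc (c 0) (d 0) ∨ y ∉ Set.Icc (c 1) (d 1) ∨
        z ∉ Set.Icc (c 2) (d 2)) → E x y z = 0 := fun x y z h => by
      have : α ![x, y, z] = 0 := hα0 _ fun hh => by
        have := (hmem x y z).1 hh
        tauto
      simp [hE, this]
    rw [← setIntegral_eq_integral_of_forall_compl_eq_zero (s := Set.Icc (c 0) (d 0))
      fun x hx => by simp [hz x _ _ (Or.inl hx)]]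
    congr 1; ext x
    rw [← setIntegral_eq_integral_of_forall_compl_eq_zero (s := Set.Icc (c 1) (d 1))
      fun y hy => by simp [hz x y _ (Or.inr (Or.inl hy))]]
    congr 1; ext y
    rw [← setIntegral_eq_integral_of_forall_compl_eq_zero (s := Set.Icc (c 2) (d 2))
      fun z hz' => by simp [hz x y z (Or.inr (Or.inr hz'))]]
  rw [e]
  refine key.trans (le_of_eq ?_)
  rw [Fin.prod_univ_three, setLIntegral_fin_two (hnorm 0), setLIntegral_fin_two (hnorm 1),
    setLIntegral_fin_two (hnorm 2)]
  simp only [mul_assoc]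
  rfl

/-! ### Smooth partitions of unity on grids -/

/-- A smooth bump on the line whose integer translates sum to one. -/
noncomputable def unitBump (t : ℝ) : ℝ := Real.smoothTransition (t + 1) - Real.smoothTransition t

theorem contDiff_unitBump {n : ℕ∞} : ContDiff ℝ n unitBump :=
  (Real.smoothTransition.contDiff.comp (contDiff_id.add contDiff_const)).sub
    Real.smoothTransition.contDiff

theorem unitBump_eq_zero {t : ℝ} (h : t ∉ Set.Ioo (-1 : ℝ) 1) : unitBump t = 0 := by
  rw [Set.mem_Ioo, not_and_or, not_lt, not_lt] at h
  unfold unitBump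
  rcases h with h | h
  · rw [Real.smoothTransition.zero_of_nonpos (by linarith),
      Real.smoothTransition.zero_of_nonpos (by linarith), sub_zero]
  · rw [Real.smoothTransition.one_of_one_le (by linarith),
      Real.smoothTransition.one_of_one_le h, sub_self]

/-- The sum telescopes to `smoothTransition (t + 1) - smoothTransition (t - N)`, which is `1 - 0`
for `0 ≤ t ≤ N`. Both end nodes `0` and `N` are needed, hence `N + 1` bumps. -/
theorem sum_unitBump (N : ℕ) {t : ℝ} (h : t ∈ Set.Icc (0 : ℝ) N) :
    ∑ m : Fin (N + 1), unitBump (t - (m : ℕ)) = 1 := by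
  rw [Fin.sum_univ_eq_sum_range (fun m : ℕ => unitBump (t - m))]
  have e : ∀ m ∈ Finset.range (N + 1), unitBump (t - (m : ℕ)) =
      (fun m : ℕ => -Real.smoothTransition (t + 1 - m)) (m + 1) -
        (fun m : ℕ => -Real.smoothTransition (t + 1 - m)) m := fun m _ => by
    simp only [unitBump]
    push_cast
    rw [show t - (m : ℝ) + 1 = t + 1 - m by ring, show t + 1 - ((m : ℝ) + 1) = t - m by ring]
    ring
  rw [Finset.sum_congr rfl e,
    Finset.sum_range_sub (fun m : ℕ => -Real.smoothTransition (t + 1 - m)) (N + 1)]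
  push_cast
  rw [Real.smoothTransition.zero_of_nonpos (by linarith [h.2]),
    Real.smoothTransition.one_of_one_le (by linarith [h.1])]
  norm_num

theorem deriv_real_eq_zero_of_notMem_Ioo {g : ℝ → ℝ} (hg : ContDiff ℝ 1 g) {c d : ℝ}
    (h : ∀ x, x ∉ Set.Ioo c d → g x = 0) : ∀ x, x ∉ Set.Ioo c d → deriv g x = 0 := by
  intro x hx
  have h1 := deriv_eq_zero_of_forall_Ioo (A := fun t => (g t : ℂ))
    (Complex.ofRealCLM.contDiff.comp hg) (fun t ht => by simp [h t ht]) x hx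
  have h2 := ((hg.differentiable (by norm_num) x).hasDerivAt.ofReal_comp).deriv
  rw [h2] at h1
  exact_mod_cast h1

/-- A common bound for the bump and its first two derivatives. -/
theorem exists_unitBump_bound : ∃ C : ℝ, 1 ≤ C ∧ ∀ t, |unitBump t| ≤ C ∧
    |deriv unitBump t| ≤ C ∧ |deriv (deriv unitBump) t| ≤ C := by
  have hc : ContDiff ℝ 2 unitBump := contDiff_unitBump (n := 2)
  have hc1 : ContDiff ℝ 1 (deriv unitBump) := ((contDiff_succ_iff_deriv (n := 1)).1 hc).2.2
  have key : ∀ g : ℝ → ℝ, Continuous g → (∀ t, t ∉ Set.Ioo (-1 : ℝ) 1 → g t = 0) →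
      ∃ C, ∀ t, |g t| ≤ C := by
    intro g hg h0
    have hs : HasCompactSupport g := HasCompactSupport.intro isCompact_Icc fun t ht =>
      h0 t fun h => ht (Set.Ioo_subset_Icc_self h)
    obtain ⟨C, hC⟩ := hs.exists_bound_of_continuous hg
    exact ⟨C, hC⟩
  have z0 : ∀ t, t ∉ Set.Ioo (-1 : ℝ) 1 → unitBump t = 0 := fun t ht => unitBump_eq_zero ht
  have z1 := deriv_real_eq_zero_of_notMem_Ioo (hc.of_le (by norm_num)) z0
  have z2 := deriv_real_eq_zero_of_notMem_Ioo hc1 z1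
  obtain ⟨A, hA⟩ := key _ hc.continuous z0
  obtain ⟨B, hB⟩ := key _ hc1.continuous z1
  obtain ⟨D, hD⟩ := key _ (hc1.continuous_deriv (by norm_num)) z2
  refine ⟨max 1 (max A (max B D)), le_max_left _ _, fun t => ⟨?_, ?_, ?_⟩⟩
  · exact (hA t).trans ((le_max_left _ _).trans (le_max_right _ _))
  · exact (hB t).trans ((le_max_left _ _).trans ((le_max_right _ _).trans (le_max_right _ _)))
  · exact (hD t).trans ((le_max_right _ _).trans ((le_max_right _ _).trans (le_max_right _ _)))

/-- At most three of the nodes `0, …, N` are within distance one of a given point. -/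
theorem card_filter_near_le (N : ℕ) (t : ℝ) (s : Finset (Fin (N + 1)))
    (hs : ∀ m ∈ s, |t - (m : ℕ)| ≤ 1) : s.card ≤ 3 := by
  have hmap : ∀ m ∈ s, (((m : ℕ) : ℤ)) ∈ Finset.Icc (⌈t - 1⌉) (⌈t - 1⌉ + 2) := fun m hm => by
    have := abs_le.1 (hs m hm)
    rw [Finset.mem_Icc]
    constructor
    · rw [Int.ceil_le]; push_cast; linarith [this.2]
    · have h1 : ((m : ℕ) : ℝ) ≤ ⌈t - 1⌉ + 2 := by
        have := Int.le_ceil (t - 1)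
        linarith [(abs_le.1 (hs m hm)).1]
      exact_mod_cast h1
  have := Finset.card_le_card_of_injOn (fun m : Fin (N + 1) => ((m : ℕ) : ℤ)) hmap
    (fun a _ b _ h => by simpa [Fin.ext_iff] using h)
  rw [Int.card_Icc] at this
  lia

/-- Only the nodes within distance one of `t` contribute, and there are at most three; thus the
bound is independent of `N`. -/
theorem sum_near_le (N : ℕ) (t : ℝ) {g : ℝ → ℝ} {C : ℝ} (hC : 0 ≤ C) (hg : ∀ t, g t ≤ C)
    (h0 : ∀ t, t ∉ Set.Ioo (-1 : ℝ) 1 → g t = 0) :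
    ∑ m : Fin (N + 1), g (t - (m : ℕ)) ≤ 3 * C := by
  classical
  set s := Finset.univ.filter fun m : Fin (N + 1) => |t - (m : ℕ)| ≤ 1
  have e : ∑ m : Fin (N + 1), g (t - (m : ℕ)) = ∑ m ∈ s, g (t - (m : ℕ)) := by
    symm
    refine Finset.sum_subset (Finset.subset_univ _) fun m _ hm => h0 _ fun h => hm ?_
    simp only [s, Finset.mem_filter, Finset.mem_univ, true_and]
    exact abs_le.2 ⟨h.1.le, h.2.le⟩
  rw [e]
  calc _ ≤ ∑ m ∈ s, C := Finset.sum_le_sum fun m _ => hg _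
    _ = s.card * C := by simp
    _ ≤ 3 * C := by
      gcongr
      exact_mod_cast card_filter_near_le N t s fun m hm => (Finset.mem_filter.1 hm).2

/-- Over all multi-indices the sum factors into one-dimensional sums; nonnegativity permits passing
to an arbitrary subfamily, such as the good or the bad nodes. -/
theorem sum_prod_le_prod {ι κ : Type*} [Fintype ι] [DecidableEq ι] [Fintype κ] {h : ι → κ → ℝ}
    (hnn : ∀ j m, 0 ≤ h j m) {B : ι → ℝ} (hB : ∀ j, ∑ m, h j m ≤ B j) (s : Finset (ι → κ)) :
    ∑ m ∈ s, ∏ j, h j (m j) ≤ ∏ j, B j := by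
  have hp : ∀ m : ι → κ, 0 ≤ ∏ j, h j (m j) := fun m => Finset.prod_nonneg fun j _ => hnn j _
  have e := Finset.prod_univ_sum (fun _ : ι => (Finset.univ : Finset κ)) (fun j m => h j m)
  rw [Fintype.piFinset_univ] at e
  refine (Finset.sum_le_sum_of_subset_of_nonneg (Finset.subset_univ s) fun m _ _ => hp m).trans ?_
  rw [← e]
  exact Finset.prod_le_prod (fun j _ => Finset.sum_nonneg fun m _ => hnn j m) fun j _ => hB j

/-- The rescaled coordinate of a grid with spacing `b_j / N` based at `a`. -/
noncomputable def gridCoord (a b : Fin 3 → ℝ) (N : ℕ) (j : Fin 3) (t : ℝ) : ℝ :=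
  (t - a j) / (b j / N)

/-- The bump function attached to a node of the grid. -/
noncomputable def gridBump (a b : Fin 3 → ℝ) (N : ℕ) (m : Fin 3 → Fin (N + 1))
    (x : Fin 3 → ℝ) : ℝ :=
  ∏ j, unitBump (gridCoord a b N j (x j) - (m j : ℕ))

/-- Lower corner of the box attached to a node of the grid. -/
noncomputable def gridLower (a b : Fin 3 → ℝ) (N : ℕ) (m : Fin 3 → Fin (N + 1))
    (j : Fin 3) : ℝ := a j + ((m j : ℕ) - 1) * (b j / N)

/-- Upper corner of the box attached to a node of the grid. -/
noncomputable def gridUpper (a b : Fin 3 → ℝ) (N : ℕ) (m : Fin 3 → Fin (N + 1))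
    (j : Fin 3) : ℝ := a j + ((m j : ℕ) + 1) * (b j / N)

section grid

variable {a b : Fin 3 → ℝ} {N : ℕ} {m : Fin 3 → Fin (N + 1)}

theorem gridCoord_sub_mem_Ioo (hb : ∀ j, 0 < b j) (hN : 0 < N) (j : Fin 3) (t : ℝ) :
    gridCoord a b N j t - (m j : ℕ) ∈ Set.Ioo (-1 : ℝ) 1 ↔
      t ∈ Set.Ioo (gridLower a b N m j) (gridUpper a b N m j) := by
  have hl : 0 < b j / N := div_pos (hb j) (by exact_mod_cast hN)
  unfold gridCoord gridLower gridUpper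
  rw [Set.mem_Ioo, Set.mem_Ioo, lt_sub_iff_add_lt, sub_lt_iff_lt_add, lt_div_iff₀ hl,
    div_lt_iff₀ hl]
  constructor <;> rintro ⟨h1, h2⟩ <;> constructor <;> linarith

theorem gridCoord_sub_mem_Icc (hb : ∀ j, 0 < b j) (hN : 0 < N) (j : Fin 3) (t : ℝ) :
    gridCoord a b N j t - (m j : ℕ) ∈ Set.Icc (-1 : ℝ) 1 ↔
      t ∈ Set.Icc (gridLower a b N m j) (gridUpper a b N m j) := by
  have hl : 0 < b j / N := div_pos (hb j) (by exact_mod_cast hN)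
  unfold gridCoord gridLower gridUpper
  rw [Set.mem_Icc, Set.mem_Icc, le_sub_iff_add_le, sub_le_iff_le_add, le_div_iff₀ hl,
    div_le_iff₀ hl]
  constructor <;> rintro ⟨h1, h2⟩ <;> constructor <;> linarith

theorem gridBump_eq_zero (hb : ∀ j, 0 < b j) (hN : 0 < N) {x : Fin 3 → ℝ} {j : Fin 3}
    (h : x j ∉ Set.Ioo (gridLower a b N m j) (gridUpper a b N m j)) : gridBump a b N m x = 0 :=
  Finset.prod_eq_zero (Finset.mem_univ j)
    (unitBump_eq_zero fun h' => h ((gridCoord_sub_mem_Ioo hb hN j (x j)).1 h'))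

theorem gridBump_eq_zero_of_notMem_Icc (hb : ∀ j, 0 < b j) (hN : 0 < N) {x : Fin 3 → ℝ}
    (h : x ∉ Set.Icc (gridLower a b N m) (gridUpper a b N m)) : gridBump a b N m x = 0 := by
  by_contra hne
  refine h (Set.mem_Icc.2 ⟨fun j => ?_, fun j => ?_⟩) <;> by_contra hj <;>
    refine hne (gridBump_eq_zero (j := j) hb hN fun hx => hj ?_)
  · exact hx.1.le
  · exact hx.2.le

theorem sum_gridBump (hb : ∀ j, 0 < b j) (hN : 0 < N) {x : Fin 3 → ℝ}
    (hx : ∀ j, x j ∈ Set.Icc (a j) (a j + b j)) : ∑ m, gridBump a b N m x = 1 := by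
  have hN' : (0 : ℝ) < N := by exact_mod_cast hN
  have e : ∀ j, ∑ m : Fin (N + 1), unitBump (gridCoord a b N j (x j) - (m : ℕ)) = 1 := fun j => by
    refine sum_unitBump N ⟨?_, ?_⟩
    · exact div_nonneg (by linarith [(hx j).1]) (div_nonneg (hb j).le hN'.le)
    · rw [gridCoord, div_le_iff₀ (div_pos (hb j) hN')]
      have := (hx j).2
      field_simp
      linarith
  unfold gridBump
  have := Finset.prod_univ_sum (fun _ : Fin 3 => (Finset.univ : Finset (Fin (N + 1))))
    (fun j m => unitBump (gridCoord a b N j (x j) - (m : ℕ)))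
  rw [Fintype.piFinset_univ] at this
  rw [← this]
  simp [e]

theorem continuous_gridBump : Continuous (gridBump a b N m) := by
  unfold gridBump gridCoord
  have : Continuous unitBump := (contDiff_unitBump (n := 0)).continuous
  fun_prop

/-- One-dimensional slices of a sum of grid bumps obey derivative bounds at the scale of the
grid. -/
theorem scaleBound_sum_gridBump (hb : ∀ j, 0 < b j) (hN : 0 < N) {C : ℝ} (hC : 1 ≤ C)
    (hbd : ∀ t, |unitBump t| ≤ C ∧ |deriv unitBump t| ≤ C ∧ |deriv (deriv unitBump) t| ≤ C)
    (s : Finset (Fin 3 → Fin (N + 1))) (y z : ℝ) :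
    ScaleBound (fun x => ((∑ m ∈ s, gridBump a b N m ![x, y, z] : ℝ) : ℂ)) (27 * C ^ 3)
      (b 0 / N) := by
  set l := b 0 / N with hl
  have hlp : 0 < l := div_pos (hb 0) (by exact_mod_cast hN)
  set w : (Fin 3 → Fin (N + 1)) → ℝ := fun m => unitBump (gridCoord a b N 1 y - (m 1 : ℕ)) *
    unitBump (gridCoord a b N 2 z - (m 2 : ℕ)) with hw
  have hc : ContDiff ℝ 2 unitBump := contDiff_unitBump (n := 2)
  have hc1 : ContDiff ℝ 1 (deriv unitBump) := ((contDiff_succ_iff_deriv (n := 1)).1 hc).2.2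
  have z0 : ∀ t, t ∉ Set.Ioo (-1 : ℝ) 1 → unitBump t = 0 := fun t ht => unitBump_eq_zero ht
  have z1 := deriv_real_eq_zero_of_notMem_Ioo (hc.of_le (by norm_num)) z0
  have z2 := deriv_real_eq_zero_of_notMem_Ioo hc1 z1
  have e0 : ∀ x, ∑ m ∈ s, gridBump a b N m ![x, y, z] =
      ∑ m ∈ s, unitBump ((x - a 0) / l - (m 0 : ℕ)) * w m := fun x => by
    refine Finset.sum_congr rfl fun m _ => ?_
    rw [gridBump, Fin.prod_univ_three, mul_assoc]
    rfl
  have hinner : ∀ (m : Fin 3 → Fin (N + 1)) (x : ℝ),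
      HasDerivAt (fun x => (x - a 0) / l - (m 0 : ℕ)) (1 / l) x := fun m x =>
    (((hasDerivAt_id x).sub_const _).div_const l).sub_const _
  have d1 : ∀ x, HasDerivAt (fun x => ∑ m ∈ s, unitBump ((x - a 0) / l - (m 0 : ℕ)) * w m)
      (∑ m ∈ s, deriv unitBump ((x - a 0) / l - (m 0 : ℕ)) * (1 / l) * w m) x := fun x =>
    HasDerivAt.fun_sum fun m _ => ((hc.differentiable (by norm_num) _).hasDerivAt.comp x
      (hinner m x)).mul_const _
  have d2 : ∀ x, HasDerivAt
      (fun x => ∑ m ∈ s, deriv unitBump ((x - a 0) / l - (m 0 : ℕ)) * (1 / l) * w m)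
      (∑ m ∈ s, deriv (deriv unitBump) ((x - a 0) / l - (m 0 : ℕ)) * (1 / l) * (1 / l) * w m) x :=
    fun x => HasDerivAt.fun_sum fun m _ => (((hc1.differentiable (by norm_num) _).hasDerivAt.comp x
      (hinner m x)).mul_const _).mul_const _
  have hsum : ∀ (g : ℝ → ℝ) (x : ℝ), (∀ t, |g t| ≤ C) → (∀ t, t ∉ Set.Ioo (-1 : ℝ) 1 → g t = 0) →
      ∑ m ∈ s, |g ((x - a 0) / l - (m 0 : ℕ))| * |w m| ≤ 27 * C ^ 3 := by
    intro g x hg hg0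
    -- Only the first factor of a grid bump is differentiated. Each of the three one-dimensional
    -- sums is at most `3 * C`, whence `27 * C ^ 3`.
    set G : Fin 3 → ℝ → ℝ := fun j => if j = 0 then g else unitBump with hG
    set T : Fin 3 → ℝ := ![(x - a 0) / l, gridCoord a b N 1 y, gridCoord a b N 2 z] with hT
    set h : Fin 3 → Fin (N + 1) → ℝ := fun j m => |G j (T j - (m : ℕ))| with hh
    have hGb : ∀ j t, |G j t| ≤ C := fun j t => by
      rcases eq_or_ne j 0 with hj | hj
      · simpa [hG, hj] using hg t
      · simpa [hG, hj] using (hbd t).1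
    have hG0 : ∀ j t, t ∉ Set.Ioo (-1 : ℝ) 1 → G j t = 0 := fun j t ht => by
      rcases eq_or_ne j 0 with hj | hj
      · simpa [hG, hj] using hg0 t ht
      · simpa [hG, hj] using z0 t ht
    have e : ∀ m : Fin 3 → Fin (N + 1),
        |g ((x - a 0) / l - (m 0 : ℕ))| * |w m| = ∏ j, h j (m j) := fun m => by
      rw [Fin.prod_univ_three, hw, abs_mul, mul_assoc]
      simp [hh, hG, hT]
    have hnn : ∀ j m, 0 ≤ h j m := fun j m => abs_nonneg _
    have hC0 : 0 ≤ C := by linarith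
    rw [Finset.sum_congr rfl fun m _ => e m]
    refine (sum_prod_le_prod hnn (B := fun _ => 3 * C) (fun j => sum_near_le N (T j)
      (g := fun t => |G j t|) hC0 (hGb j) fun t ht => by simp [hG0 j t ht]) s).trans (le_of_eq ?_)
    rw [Fin.prod_univ_three]; ring
  simp_rw [e0]
  have D1 : deriv (fun x => ((∑ m ∈ s, unitBump ((x - a 0) / l - (m 0 : ℕ)) * w m : ℝ) : ℂ)) =
      fun x => ((∑ m ∈ s, deriv unitBump ((x - a 0) / l - (m 0 : ℕ)) * (1 / l) * w m : ℝ) : ℂ) := by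
    ext x; exact (d1 x).ofReal_comp.deriv
  have D2 : deriv (deriv
      (fun x => ((∑ m ∈ s, unitBump ((x - a 0) / l - (m 0 : ℕ)) * w m : ℝ) : ℂ))) =
      fun x => ((∑ m ∈ s, deriv (deriv unitBump) ((x - a 0) / l - (m 0 : ℕ)) * (1 / l) * (1 / l) *
        w m : ℝ) : ℂ) := by
    rw [D1]; ext x; exact (d2 x).ofReal_comp.deriv
  refine ⟨?_, fun t => ?_, fun t => ?_, fun t => ?_⟩
  · refine Complex.ofRealCLM.contDiff.comp (ContDiff.sum fun m _ => ContDiff.mul ?_ contDiff_const)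
    exact hc.comp (by fun_prop)
  · rw [Complex.norm_real]
    refine (Finset.abs_sum_le_sum_abs _ _).trans ?_
    simp_rw [abs_mul]
    exact hsum unitBump t (fun t => (hbd t).1) z0
  · rw [D1, Complex.norm_real]
    refine (Finset.abs_sum_le_sum_abs _ _).trans ?_
    have e : ∀ m : Fin 3 → Fin (N + 1), |deriv unitBump ((t - a 0) / l - (m 0 : ℕ)) * (1 / l) * w m| =
        |deriv unitBump ((t - a 0) / l - (m 0 : ℕ))| * |w m| / l := fun m => by
      rw [abs_mul, abs_mul, abs_of_pos (one_div_pos.2 hlp)]; ring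
    simp_rw [e]
    rw [← Finset.sum_div]
    gcongr
    exact hsum (deriv unitBump) t (fun t => (hbd t).2.1) z1
  · rw [D2, Complex.norm_real]
    refine (Finset.abs_sum_le_sum_abs _ _).trans ?_
    have e : ∀ m : Fin 3 → Fin (N + 1), |deriv (deriv unitBump) ((t - a 0) / l - (m 0 : ℕ)) *
        (1 / l) * (1 / l) * w m| =
        |deriv (deriv unitBump) ((t - a 0) / l - (m 0 : ℕ))| * |w m| / l ^ 2 := fun m => by
      rw [abs_mul, abs_mul, abs_mul, abs_of_pos (one_div_pos.2 hlp)]; ring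
    simp_rw [e]
    rw [← Finset.sum_div]
    gcongr
    exact hsum (deriv (deriv unitBump)) t (fun t => (hbd t).2.2) z2

end grid

/-! ### Summation of the box estimates by discrete Loomis-Whitney -/

theorem sum_fin_three_fun {κ R : Type*} [Fintype κ] [AddCommMonoid R] (F : (Fin 3 → κ) → R) :
    ∑ m, F m = ∑ x, ∑ y, ∑ z, F ![x, y, z] := by
  let e : κ × κ × κ ≃ (Fin 3 → κ) :=
    { toFun := fun p => ![p.1, p.2.1, p.2.2]
      invFun := fun m => (m 0, m 1, m 2)
      left_inv := fun p => rfl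
      right_inv := fun m => by ext i; fin_cases i <;> rfl }
  rw [← e.sum_comp, Fintype.sum_prod_type]
  simp_rw [Fintype.sum_prod_type]
  rfl

theorem sum_fin_two_fun {κ R : Type*} [Fintype κ] [AddCommMonoid R] (F : (Fin 2 → κ) → R) :
    ∑ m, F m = ∑ x, ∑ y, F ![x, y] := by
  let e : κ × κ ≃ (Fin 2 → κ) :=
    { toFun := fun p => ![p.1, p.2]
      invFun := fun m => (m 0, m 1)
      left_inv := fun p => rfl
      right_inv := fun m => by ext i; fin_cases i <;> rfl }
  rw [← e.sum_comp, Fintype.sum_prod_type]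
  rfl

/-- The discrete Loomis-Whitney inequality. -/
theorem sum_prod_succAbove_le {n : ℕ} (X : Fin 3 → (Fin 2 → Fin n) → ℝ≥0∞) :
    ∑ m : Fin 3 → Fin n, ∏ j, X j (fun i => m (j.succAbove i)) ≤
      ∏ j, (∑ k, X j k ^ 2) ^ (1 / 2 : ℝ) := by
  have h := loomis_whitney_three (Measure.count : Measure (Fin n)) (Measure.count : Measure (Fin n))
    (Measure.count : Measure (Fin n)) (f := fun p => X 0 ![p.1, p.2]) (g := fun p => X 1 ![p.1, p.2])
    (h := fun p => X 2 ![p.1, p.2]) (measurable_of_countable _) (measurable_of_countable _)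
    (measurable_of_countable _)
  simp only [lintegral_count, tsum_fintype] at h
  rw [Fin.prod_univ_three, sum_fin_three_fun]
  simp only [sum_fin_two_fun (fun k => X _ k ^ 2)]
  refine le_trans (le_of_eq ?_) h
  refine Finset.sum_congr rfl fun x _ => Finset.sum_congr rfl fun y _ =>
    Finset.sum_congr rfl fun z _ => ?_
  rw [Fin.prod_univ_three]
  congr 3 <;> ext i <;> fin_cases i <;> rfl

theorem sum_rpow_three_quarters_le {ι : Type*} [Fintype ι] (X : ι → ℝ≥0∞) :
    ∑ i, X i ^ (3 / 4 : ℝ) ≤ (Fintype.card ι : ℝ≥0∞) ^ (1 / 4 : ℝ) * (∑ i, X i) ^ (3 / 4 : ℝ) := by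
  have h := ENNReal.inner_le_Lp_mul_Lq Finset.univ (fun i => X i ^ (3 / 4 : ℝ)) (fun _ => 1)
    (p := 4 / 3) (q := 4) ⟨by norm_num, by norm_num, by norm_num⟩
  simp only [mul_one, ← ENNReal.rpow_mul, ENNReal.one_rpow, Finset.sum_const, Finset.card_univ,
    nsmul_eq_mul] at h
  norm_num at h
  rw [mul_comm]
  norm_num
  exact h

/-- The planar box attached to a node of the grid, with the `j`-th coordinate omitted. -/
def gridFace (a b : Fin 3 → ℝ) (N : ℕ) (j : Fin 3) (k : Fin 2 → Fin (N + 1)) : Set (Fin 2 → ℝ) :=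
  {w | ∀ i, |gridCoord a b N (j.succAbove i) (w i) - (k i : ℕ)| ≤ 1}

theorem measurableSet_gridFace (a b : Fin 3 → ℝ) (N : ℕ) (j : Fin 3) (k : Fin 2 → Fin (N + 1)) :
    MeasurableSet (gridFace a b N j k) := by
  have : gridFace a b N j k =
      ⋂ i, {w | |gridCoord a b N (j.succAbove i) (w i) - (k i : ℕ)| ≤ 1} := by
    ext; simp [gridFace]
  rw [this]
  refine MeasurableSet.iInter fun i => measurableSet_le ?_ measurable_const
  unfold gridCoord
  fun_prop

theorem Icc_hatProj_eq_gridFace {a b : Fin 3 → ℝ} {N : ℕ} (hb : ∀ j, 0 < b j) (hN : 0 < N)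
    (m : Fin 3 → Fin (N + 1)) (j : Fin 3) :
    Set.Icc (hatProj j (gridLower a b N m)) (hatProj j (gridUpper a b N m)) =
      gridFace a b N j (fun i => m (j.succAbove i)) := by
  ext w
  have h : ∀ i, |gridCoord a b N (j.succAbove i) (w i) - (m (j.succAbove i) : ℕ)| ≤ 1 ↔
      w i ∈ Set.Icc (hatProj j (gridLower a b N m) i) (hatProj j (gridUpper a b N m) i) := fun i => by
    rw [abs_le]
    exact gridCoord_sub_mem_Icc hb hN (j.succAbove i) (w i)
  simp only [gridFace, Set.mem_ofPred_eq, h]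
  exact ⟨fun hw i => ⟨hw.1 i, hw.2 i⟩, fun hw => ⟨fun i => (hw i).1, fun i => (hw i).2⟩⟩

/-- A point of the plane lies in at most `3 · 3` faces, since in each coordinate at most three nodes
are within distance one. -/
theorem sum_setLIntegral_gridFace_le (a b : Fin 3 → ℝ) (N : ℕ) (j : Fin 3)
    {G : (Fin 2 → ℝ) → ℝ≥0∞} (hG : Measurable G) :
    ∑ k, ∫⁻ w in gridFace a b N j k, G w ≤ 9 * ∫⁻ w, G w := by
  classical
  simp_rw [← lintegral_indicator (measurableSet_gridFace a b N j _)]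
  rw [← lintegral_finsetSum _ fun k _ => hG.indicator (measurableSet_gridFace a b N j k),
    ← lintegral_const_mul _ hG]
  refine lintegral_mono fun w => ?_
  simp only [Set.indicator_apply]
  rw [← Finset.sum_filter, Finset.sum_const, nsmul_eq_mul]
  gcongr
  set t : Fin 2 → ℝ := fun i => gridCoord a b N (j.succAbove i) (w i)
  have hsub : (Finset.univ.filter fun k => w ∈ gridFace a b N j k) ⊆
      Fintype.piFinset fun i => Finset.univ.filter fun n : Fin (N + 1) => |t i - (n : ℕ)| ≤ 1 :=
    fun k hk => by
      rw [Fintype.mem_piFinset]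
      exact fun i => Finset.mem_filter.2 ⟨Finset.mem_univ _, (Finset.mem_filter.1 hk).2 i⟩
  have hcard := Finset.card_le_card hsub
  rw [Fintype.card_piFinset, Fin.prod_univ_two] at hcard
  have h3 : ∀ i, (Finset.univ.filter fun n : Fin (N + 1) => |t i - (n : ℕ)| ≤ 1).card ≤ 3 :=
    fun i => card_filter_near_le N (t i) _ fun m hm => (Finset.mem_filter.1 hm).2
  have := hcard.trans (Nat.mul_le_mul (h3 0) (h3 1))
  exact_mod_cast this

/-- Loomis-Whitney on the nodes asks for `ℓ²` norms of `X^{3/8}`, that is, sums of `X^{3/4}` over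
`(N + 1)²` faces. Hölder against the constant `1` loses `(N + 1)^{1/4}` for each of the three
functions after the square root, in total `(N + 1)^{3/4}`. The factor `729` is `9³`. -/
theorem sum_prod_gridFace_le (a b : Fin 3 → ℝ) (N : ℕ) {G : Fin 3 → (Fin 2 → ℝ) → ℝ≥0∞}
    (hG : ∀ j, Measurable (G j)) :
    ∑ m : Fin 3 → Fin (N + 1),
        ∏ j, (∫⁻ w in gridFace a b N j (fun i => m (j.succAbove i)), G j w) ^ (3 / 8 : ℝ) ≤
      ((N : ℝ≥0∞) + 1) ^ (3 / 4 : ℝ) * 729 * ∏ j, (∫⁻ w, G j w) ^ (3 / 8 : ℝ) := by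
  set X : Fin 3 → (Fin 2 → Fin (N + 1)) → ℝ≥0∞ := fun j k => ∫⁻ w in gridFace a b N j k, G j w
  refine (sum_prod_succAbove_le fun j k => X j k ^ (3 / 8 : ℝ)).trans ?_
  have hone : ∀ j, (∑ k, (X j k ^ (3 / 8 : ℝ)) ^ 2) ^ (1 / 2 : ℝ) ≤
      ((N : ℝ≥0∞) + 1) ^ (1 / 4 : ℝ) * 9 * (∫⁻ w, G j w) ^ (3 / 8 : ℝ) := fun j => by
    have e : ∀ k, (X j k ^ (3 / 8 : ℝ)) ^ 2 = X j k ^ (3 / 4 : ℝ) := fun k => by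
      rw [← ENNReal.rpow_natCast, ← ENNReal.rpow_mul]; norm_num
    simp_rw [e]
    have hcard : (Fintype.card (Fin 2 → Fin (N + 1)) : ℝ≥0∞) = ((N : ℝ≥0∞) + 1) ^ (2 : ℝ) := by
      simp
    have h9 : (9 : ℝ≥0∞) ^ (3 / 8 : ℝ) ≤ 9 := by
      conv_rhs => rw [← ENNReal.rpow_one 9]
      exact ENNReal.rpow_le_rpow_of_exponent_le (by norm_num) (by norm_num)
    calc _ ≤ ((((N : ℝ≥0∞) + 1) ^ (2 : ℝ)) ^ (1 / 4 : ℝ) *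
          (9 * ∫⁻ w, G j w) ^ (3 / 4 : ℝ)) ^ (1 / 2 : ℝ) := by
          gcongr
          refine (sum_rpow_three_quarters_le (X j)).trans ?_
          rw [hcard]
          gcongr
          exact sum_setLIntegral_gridFace_le a b N j (hG j)
      _ = ((N : ℝ≥0∞) + 1) ^ (1 / 4 : ℝ) * 9 ^ (3 / 8 : ℝ) * (∫⁻ w, G j w) ^ (3 / 8 : ℝ) := by
          rw [ENNReal.mul_rpow_of_nonneg _ _ (by norm_num), ← ENNReal.rpow_mul, ← ENNReal.rpow_mul,
            ← ENNReal.rpow_mul, mul_assoc, ← ENNReal.mul_rpow_of_nonneg _ _ (by norm_num)]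
          norm_num
      _ ≤ _ := by gcongr
  refine (Finset.prod_le_prod' fun j _ => hone j).trans (le_of_eq ?_)
  rw [Finset.prod_mul_distrib, Finset.prod_const, mul_pow, ← ENNReal.rpow_natCast,
    ← ENNReal.rpow_mul]
  norm_num

/-- The phase hypotheses on a set, at the length scale `w` in the first variable. -/
structure PhaseBound (S : (Fin 3 → ℝ) → ℝ) (Z : Set (Fin 3 → ℝ)) (μ K w : ℝ) : Prop where
  analyticAt : ∀ x ∈ Z, AnalyticAt ℝ S x
  lower : ∀ x ∈ Z, μ ≤ |mixedDeriv S x|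
  upper_one : ∀ x ∈ Z, |pderivAt 0 (mixedDeriv S) x| ≤ K * μ / w
  upper_two : ∀ x ∈ Z, |pderivAt 0 (pderivAt 0 (mixedDeriv S)) x| ≤ K * μ / w ^ 2

/-- The contribution of a family of grid boxes on which the phase is controlled. -/
theorem enorm_level_integral_le {S : (Fin 3 → ℝ) → ℝ} {Z : Set (Fin 3 → ℝ)} {a b : Fin 3 → ℝ}
    {N : ℕ} {lam μ K M C : ℝ} (hb : ∀ j, 0 < b j) (hN : 0 < N) (hlam : lam ≠ 0) (hμ : 0 < μ)
    (hK : 0 ≤ K) (hS : PhaseBound S Z μ K (b 0)) (hC : 1 ≤ C)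
    (hbd : ∀ t, |unitBump t| ≤ C ∧ |deriv unitBump t| ≤ C ∧ |deriv (deriv unitBump) t| ≤ C)
    {Ψ : (Fin 3 → ℝ) → ℂ} (hΨ : ∀ y z, ScaleBound (fun x => Ψ ![x, y, z]) M (b 0 / N))
    (hm : Measurable fun x => Complex.exp (Complex.I * lam * S x) * Ψ x)
    {s : Finset (Fin 3 → Fin (N + 1))}
    (hs : ∀ m ∈ s, Set.Icc (gridLower a b N m) (gridUpper a b N m) ⊆ Z)
    {f : Fin 3 → (Fin 2 → ℝ) → ℂ} (hf : ∀ j, Measurable (f j)) {B : ℝ}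
    (hB : ∀ j w, ‖f j w‖ ≤ B) :
    ‖∫ x, Complex.exp (Complex.I * lam * S x) *
        (Ψ x * ((∑ m ∈ s, gridBump a b N m x : ℝ) : ℂ)) * ∏ j, f j (hatProj j x)‖ₑ ≤
      8 * ENNReal.ofReal (2 * Real.pi * (768 * (1 + K) ^ 2 * (4 * (M * (27 * C ^ 3))) ^ 4) /
        (|lam| * μ)) ^ (1 / 4 : ℝ) *
        (((N : ℝ≥0∞) + 1) ^ (3 / 4 : ℝ) * 729 *
          ∏ j, (∫⁻ w, ‖f j w‖ₑ ^ (8 / 3 : ℝ)) ^ (3 / 8 : ℝ)) := by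
  have hN' : (1 : ℝ) ≤ N := by exact_mod_cast hN
  have hl : 0 < b 0 / N := div_pos (hb 0) (by linarith)
  have hlb : b 0 / N ≤ b 0 := div_le_self (hb 0).le hN'
  have hM : 0 ≤ M := (hΨ 0 0).nonneg
  have hMC : 0 ≤ 4 * (M * (27 * C ^ 3)) := by positivity
  set e : (Fin 3 → ℝ) → ℂ := fun x => Complex.exp (Complex.I * lam * S x)
  set F : (Fin 3 → Fin (N + 1)) → (Fin 3 → ℝ) → ℂ := fun m x =>
    e x * (Ψ x * (gridBump a b N m x : ℂ)) * ∏ j, f j (hatProj j x) with hF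
  set Q := ENNReal.ofReal (2 * Real.pi * (768 * (1 + K) ^ 2 * (4 * (M * (27 * C ^ 3))) ^ 4) /
        (|lam| * μ)) ^ (1 / 4 : ℝ)
  have hslice : ∀ m y z, ScaleBound (fun x => Ψ ![x, y, z] * (gridBump a b N m ![x, y, z] : ℂ))
      (4 * (M * (27 * C ^ 3))) (b 0 / N) := fun m y z => by
    have h := scaleBound_sum_gridBump (a := a) hb hN hC hbd {m} y z
    simp only [Finset.sum_singleton] at h
    exact (hΨ y z).mul h hl
  have hmm : ∀ m, Measurable fun x => e x * (Ψ x * (gridBump a b N m x : ℂ)) := fun m => by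
    have h2 : Measurable fun x => (gridBump a b N m x : ℂ) :=
      (Complex.continuous_ofReal.comp continuous_gridBump).measurable
    simp_rw [← mul_assoc]
    exact hm.mul h2
  have hprodm : Measurable fun x : Fin 3 → ℝ => ∏ j, f j (hatProj j x) :=
    Finset.measurable_prod _ fun j _ => (hf j).comp (measurable_hatProj j)
  have hvec : ∀ x : Fin 3 → ℝ, ![x 0, x 1, x 2] = x := fun x => by
    ext i; fin_cases i <;> rfl
  have hI : ∀ m, Integrable (F m) := fun m => by
    refine integrable_of_bound_of_subset_Icc (c := gridLower a b N m) (d := gridUpper a b N m)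
      (B := 4 * (M * (27 * C ^ 3)) * ∏ _j : Fin 3, B) ((hmm m).mul hprodm) (fun x => ?_)
      (fun x hx => by simp [hF, gridBump_eq_zero_of_notMem_Icc hb hN hx])
    rw [hF]
    rw [norm_mul, norm_prod, norm_mul, norm_exp_phase, one_mul]
    gcongr with j
    · have := (hslice m (x 1) (x 2)).bound_zero (x 0)
      rwa [hvec] at this
    · exact hB j _
  have hsum : ∫ x, e x * (Ψ x * ((∑ m ∈ s, gridBump a b N m x : ℝ) : ℂ)) *
      ∏ j, f j (hatProj j x) = ∑ m ∈ s, ∫ x, F m x := by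
    rw [← integral_finsetSum _ fun m _ => hI m]
    congr 1
    ext x
    rw [hF, ← Finset.sum_mul, ← Finset.mul_sum, ← Finset.mul_sum]
    push_cast
    rfl
  set W : (Fin 3 → Fin (N + 1)) → ℝ≥0∞ := fun m => ∏ j, (∫⁻ w in
    gridFace a b N j (fun i => m (j.succAbove i)), ‖f j w‖ₑ ^ (8 / 3 : ℝ)) ^ (3 / 8 : ℝ) with hW
  -- A grid box has half-width `b 0 / N` in the first variable. Since `b 0 / N ≤ b 0`, the
  -- derivative bounds on the phase at scale `b 0` imply those at the scale of the box.
  have hbox : ∀ m ∈ s, ‖∫ x, F m x‖ₑ ≤ 8 * Q * W m := by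
    intro m hms
    have h := enorm_box_integral_le (S := S) (c := gridLower a b N m) (d := gridUpper a b N m)
      (l := b 0 / N) (lam := lam) (μ := μ) (K := K) (M := 4 * (M * (27 * C ^ 3)))
      (by unfold gridLower gridUpper; ring) hl hlam hμ hK
      (fun x hx => hS.analyticAt x (hs m hms hx)) (fun x hx => hS.lower x (hs m hms hx))
      (fun x hx => (hS.upper_one x (hs m hms hx)).trans (by gcongr))
      (fun x hx => (hS.upper_two x (hs m hms hx)).trans (by gcongr))
      (α := fun x => Ψ x * (gridBump a b N m x : ℂ)) (hslice m)
      (fun x hx => by simp [gridBump_eq_zero_of_notMem_Icc hb hN hx])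
      (fun x hx => by simp [gridBump_eq_zero hb hN hx]) (hmm m) hf hB
    simp only [Icc_hatProj_eq_gridFace hb hN m] at h
    exact h
  rw [hsum]
  calc ‖∑ m ∈ s, ∫ x, F m x‖ₑ ≤ ∑ m ∈ s, ‖∫ x, F m x‖ₑ := enorm_sum_le _ _
    _ ≤ ∑ m ∈ s, 8 * Q * W m := Finset.sum_le_sum hbox
    _ = 8 * Q * ∑ m ∈ s, W m := (Finset.mul_sum _ _ _).symm
    _ ≤ 8 * Q * ∑ m, W m := by
        gcongr
        exact Finset.subset_univ s
    _ ≤ _ := by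
        gcongr
        exact sum_prod_gridFace_le a b N (G := fun j w => ‖f j w‖ₑ ^ (8 / 3 : ℝ))
          fun j => (hf j).enorm.pow_const _

/-- The fourth power of the amplitude in the orthogonality bound meets the exponent `1/4`, so the
estimate is linear in `M`. A gain of `1/N` in the amplitude therefore survives intact against the
loss `(N + 1)^{3/4}`. -/
theorem norm_level_integral_le {S : (Fin 3 → ℝ) → ℝ} {Z : Set (Fin 3 → ℝ)} {a b : Fin 3 → ℝ}
    {N : ℕ} {lam μ K M C : ℝ} (hb : ∀ j, 0 < b j) (hN : 0 < N) (hlam : lam ≠ 0) (hμ : 0 < μ)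
    (hK : 0 ≤ K) (hS : PhaseBound S Z μ K (b 0)) (hC : 1 ≤ C)
    (hbd : ∀ t, |unitBump t| ≤ C ∧ |deriv unitBump t| ≤ C ∧ |deriv (deriv unitBump) t| ≤ C)
    {Ψ : (Fin 3 → ℝ) → ℂ} (hΨ : ∀ y z, ScaleBound (fun x => Ψ ![x, y, z]) M (b 0 / N))
    (hm : Measurable fun x => Complex.exp (Complex.I * lam * S x) * Ψ x)
    {s : Finset (Fin 3 → Fin (N + 1))}
    (hs : ∀ m ∈ s, Set.Icc (gridLower a b N m) (gridUpper a b N m) ⊆ Z)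
    {f : Fin 3 → (Fin 2 → ℝ) → ℂ} (hf : ∀ j, Measurable (f j)) {B : ℝ}
    (hB : ∀ j w, ‖f j w‖ ≤ B) (hfin : ∀ j, ∫⁻ w, ‖f j w‖ₑ ^ (8 / 3 : ℝ) ≠ ⊤) :
    ‖∫ x, Complex.exp (Complex.I * lam * S x) *
        (Ψ x * ((∑ m ∈ s, gridBump a b N m x : ℝ) : ℂ)) * ∏ j, f j (hatProj j x)‖ ≤
      (5832 * (2 * Real.pi * (768 * (1 + K) ^ 2)) ^ (1 / 4 : ℝ) * (108 * C ^ 3)) * M *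
        ((N : ℝ) + 1) ^ (3 / 4 : ℝ) * (|lam| * μ) ^ (-(1 / 4) : ℝ) *
          ∏ j, ((∫⁻ w, ‖f j w‖ₑ ^ (8 / 3 : ℝ)) ^ (3 / 8 : ℝ)).toReal := by
  have hM : 0 ≤ M := (hΨ 0 0).nonneg
  have h := enorm_level_integral_le hb hN hlam hμ hK hS hC hbd hΨ hm hs hf hB
  have hq : (0 : ℝ) ≤ 1 / 4 := by norm_num
  have hθ : 0 < |lam| * μ := mul_pos (abs_pos.2 hlam) hμ
  have hP : ∏ j, (∫⁻ w, ‖f j w‖ₑ ^ (8 / 3 : ℝ)) ^ (3 / 8 : ℝ) ≠ ⊤ :=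
    ENNReal.prod_ne_top fun j _ => ENNReal.rpow_ne_top_of_nonneg (by norm_num) (hfin j)
  have hNt : ((N : ℝ≥0∞) + 1) ^ (3 / 4 : ℝ) ≠ ⊤ :=
    ENNReal.rpow_ne_top_of_nonneg (by norm_num) (by simp)
  have h' := ENNReal.toReal_mono (ENNReal.mul_ne_top (ENNReal.mul_ne_top (by simp)
    (ENNReal.rpow_ne_top_of_nonneg hq ENNReal.ofReal_ne_top))
    (ENNReal.mul_ne_top (ENNReal.mul_ne_top hNt (by simp)) hP)) h
  rw [toReal_enorm] at h'
  refine h'.trans (le_of_eq ?_)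
  simp only [ENNReal.toReal_mul, ← ENNReal.toReal_rpow, ENNReal.toReal_prod]
  rw [ENNReal.toReal_ofReal (by positivity), ENNReal.toReal_add (by simp) (by simp)]
  have e : (2 * Real.pi * (768 * (1 + K) ^ 2 * (4 * (M * (27 * C ^ 3))) ^ 4) /
      (|lam| * μ)) ^ (1 / 4 : ℝ) = (2 * Real.pi * (768 * (1 + K) ^ 2)) ^ (1 / 4 : ℝ) *
      (108 * C ^ 3 * M) * (|lam| * μ) ^ (-(1 / 4) : ℝ) := by
    rw [show 2 * Real.pi * (768 * (1 + K) ^ 2 * (4 * (M * (27 * C ^ 3))) ^ 4) /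
      (|lam| * μ) = (2 * Real.pi * (768 * (1 + K) ^ 2)) * (108 * C ^ 3 * M) ^ 4 *
        (|lam| * μ)⁻¹ by rw [div_eq_mul_inv]; ring,
      Real.mul_rpow (by positivity) (by positivity), Real.mul_rpow (by positivity) (by positivity),
      Real.inv_rpow hθ.le, ← Real.rpow_neg hθ.le,
      show ((108 * C ^ 3 * M) ^ 4) ^ (1 / 4 : ℝ) = 108 * C ^ 3 * M by
        rw [← Real.rpow_natCast _ 4, ← Real.rpow_mul (by positivity)]; norm_num]
  rw [e]
  simp
  ring

/-- Used to compare consecutive dyadic grids; the factor `4` is the square of the ratio two, coming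
from the second derivative. -/
theorem ScaleBound.rescale {A : ℝ → ℂ} {M l l' : ℝ} (h : ScaleBound A M l') (hl : 0 < l)
    (hl' : 0 < l') (hll : l ≤ 2 * l') : ScaleBound A (4 * M) l := by
  have hM := h.nonneg
  refine ⟨h.contDiff, fun t => (h.bound_zero t).trans (by linarith), fun t =>
    (h.bound_one t).trans ?_, fun t => (h.bound_two t).trans ?_⟩
  · rw [div_le_div_iff₀ hl' hl]
    nlinarith
  · rw [div_le_div_iff₀ (by positivity) (by positivity)]
    have : l ^ 2 ≤ (2 * l') ^ 2 := by gcongr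
    nlinarith

/-! ### Good and bad boxes, and the size of the cutoff on bad boxes -/

theorem hasDerivAt_slice_zero_complex {g : (Fin 3 → ℝ) → ℂ} {x y z : ℝ}
    (h : DifferentiableAt ℝ g ![x, y, z]) :
    HasDerivAt (fun t => g ![t, y, z]) (pderivAt 0 g ![x, y, z]) x := by
  have hc : HasDerivAt (fun t : ℝ => ![t, y, z]) (Pi.single 0 1 : Fin 3 → ℝ) x := by
    rw [hasDerivAt_pi]
    intro i
    fin_cases i
    · exact hasDerivAt_id x
    · exact hasDerivAt_const x y
    · exact hasDerivAt_const x z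
  exact h.hasFDerivAt.comp_hasDerivAt x hc

/-- Smooth cutoffs with bounded normalized partial derivatives in the first variable have slices
obeying `ScaleBound`. -/
theorem scaleBound_slice {ψ : (Fin 3 → ℝ) → ℂ} (hψ : ContDiff ℝ ∞ ψ) {C b : ℝ}
    (h : ∀ n ≤ 2, ∀ x, ‖((pderivAt 0)^[n] ψ) x‖ ≤ C * (b ^ n)⁻¹) (y z : ℝ) :
    ScaleBound (fun x => ψ ![x, y, z]) C b := by
  have hψ1 : ContDiff ℝ ∞ (pderivAt 0 ψ) :=
    (hψ.fderiv_right (m := ∞) (by simp)).clm_apply contDiff_const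
  have d1 : deriv (fun x => ψ ![x, y, z]) = fun x => pderivAt 0 ψ ![x, y, z] := by
    ext x
    exact (hasDerivAt_slice_zero_complex (hψ.differentiable (by simp) _)).deriv
  have d2 : deriv (deriv fun x => ψ ![x, y, z]) =
      fun x => pderivAt 0 (pderivAt 0 ψ) ![x, y, z] := by
    rw [d1]
    ext x
    exact (hasDerivAt_slice_zero_complex (hψ1.differentiable (by simp) _)).deriv
  refine ⟨?_, fun t => ?_, fun t => ?_, fun t => ?_⟩
  · refine (contDiff_infty.1 hψ 2).comp (contDiff_pi.2 fun i => ?_)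
    fin_cases i
    · exact contDiff_id
    · exact contDiff_const
    · exact contDiff_const
  · simpa using h 0 (by norm_num) ![t, y, z]
  · rw [d1, div_eq_mul_inv]
    simpa using h 1 (by norm_num) ![t, y, z]
  · rw [d2, div_eq_mul_inv]
    simpa using h 2 (by norm_num) ![t, y, z]

/-- The mean value inequality along the segment from `q` to `x`, with the derivative expanded in
coordinates so that each displacement is weighed at the scale of its own variable. -/
theorem norm_sub_le_sum_of_pderivAt_le {ψ : (Fin 3 → ℝ) → ℂ} (hψ : Differentiable ℝ ψ)
    {D : Fin 3 → ℝ} (h : ∀ j x, ‖pderivAt j ψ x‖ ≤ D j) (x q : Fin 3 → ℝ) :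
    ‖ψ x - ψ q‖ ≤ ∑ j, |x j - q j| * D j := by
  have hbd : ∀ p, ‖fderiv ℝ ψ p (x - q)‖ ≤ ∑ j, |x j - q j| * D j := fun p => by
    have e : fderiv ℝ ψ p (x - q) = ∑ j, (x j - q j) • pderivAt j ψ p := by
      conv_lhs => rw [pi_eq_sum_univ' (x - q)]
      rw [map_sum]
      refine Finset.sum_congr rfl fun j _ => ?_
      rw [map_smul]
      congr 2
    rw [e]
    refine (norm_sum_le _ _).trans (Finset.sum_le_sum fun j _ => ?_)
    rw [norm_smul, Real.norm_eq_abs]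
    gcongr
    exact h j p
  have hg : ∀ t : ℝ, HasDerivAt (fun t : ℝ => ψ (q + t • (x - q)))
      (fderiv ℝ ψ (q + t • (x - q)) (x - q)) t := fun t => by
    have hc : HasDerivAt (fun t : ℝ => q + t • (x - q)) (x - q) t := by
      simpa using ((hasDerivAt_id t).smul_const (x - q)).const_add q
    exact (hψ _).hasFDerivAt.comp_hasDerivAt t hc
  have := norm_image_sub_le_of_norm_deriv_le_segment_01'
    (f := fun t : ℝ => ψ (q + t • (x - q))) (fun t _ => (hg t).hasDerivWithinAt)
    (fun t _ => hbd _)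
  simpa using this

open Classical in
/-- The nodes of the grid whose box lies in `Z`. -/
noncomputable def goodNodes (Z : Set (Fin 3 → ℝ)) (a b : Fin 3 → ℝ) (N : ℕ) :
    Finset (Fin 3 → Fin (N + 1)) :=
  Finset.univ.filter fun m => Set.Icc (gridLower a b N m) (gridUpper a b N m) ⊆ Z

open Classical in
/-- The nodes of the grid whose box does not lie in `Z`. -/
noncomputable def badNodes (Z : Set (Fin 3 → ℝ)) (a b : Fin 3 → ℝ) (N : ℕ) :
    Finset (Fin 3 → Fin (N + 1)) :=
  Finset.univ.filter fun m => ¬ Set.Icc (gridLower a b N m) (gridUpper a b N m) ⊆ Z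

/-- The part of the grid partition of unity carried by boxes inside `Z`. -/
noncomputable def goodSum (Z : Set (Fin 3 → ℝ)) (a b : Fin 3 → ℝ) (N : ℕ) (x : Fin 3 → ℝ) : ℝ :=
  ∑ m ∈ goodNodes Z a b N, gridBump a b N m x

/-- The part of the grid partition of unity carried by boxes leaving `Z`. -/
noncomputable def badSum (Z : Set (Fin 3 → ℝ)) (a b : Fin 3 → ℝ) (N : ℕ) (x : Fin 3 → ℝ) : ℝ :=
  ∑ m ∈ badNodes Z a b N, gridBump a b N m x

section cutoff

variable {Z : Set (Fin 3 → ℝ)} {a b : Fin 3 → ℝ} {N : ℕ}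

theorem goodSum_add_badSum (hb : ∀ j, 0 < b j) (hN : 0 < N) {x : Fin 3 → ℝ}
    (hx : ∀ j, x j ∈ Set.Icc (a j) (a j + b j)) : goodSum Z a b N x + badSum Z a b N x = 1 := by
  classical
  rw [← sum_gridBump hb hN hx]
  exact Finset.sum_filter_add_sum_filter_not _ _ _

theorem continuous_goodSum : Continuous (goodSum Z a b N) :=
  continuous_finsetSum _ fun _ _ => continuous_gridBump

theorem continuous_badSum : Continuous (badSum Z a b N) :=
  continuous_finsetSum _ fun _ _ => continuous_gridBump

/-- A cutoff supported in `Z` is small on the boxes leaving `Z`. -/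
theorem norm_le_of_mem_badNodes (hb : ∀ j, 0 < b j) (hN : 0 < N) {ψ : (Fin 3 → ℝ) → ℂ}
    (hψ : Differentiable ℝ ψ) (hZ : ∀ x, x ∉ Z → ψ x = 0) {C₁ : ℝ} (hC₁ : 0 ≤ C₁)
    (h : ∀ j x, ‖pderivAt j ψ x‖ ≤ C₁ * (b j)⁻¹) {m : Fin 3 → Fin (N + 1)}
    (hm : m ∈ badNodes Z a b N) {x : Fin 3 → ℝ}
    (hx : x ∈ Set.Icc (gridLower a b N m) (gridUpper a b N m)) : ‖ψ x‖ ≤ 6 * C₁ / N := by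
  have hN' : (0 : ℝ) < N := by exact_mod_cast hN
  simp only [badNodes, Finset.mem_filter, Finset.mem_univ, true_and] at hm
  -- A bad box contains a zero `q` of `ψ`. The box has width `2 b_j / N` in direction `j`, so each
  -- of the three directions contributes at most `2 C₁ / N` to `|ψ x - ψ q|`.
  obtain ⟨q, hq, hqZ⟩ := Set.not_subset.1 hm
  have hle := norm_sub_le_sum_of_pderivAt_le hψ h x q
  rw [hZ q hqZ, sub_zero] at hle
  refine hle.trans ?_
  have hj : ∀ j, |x j - q j| * (C₁ * (b j)⁻¹) ≤ 2 * C₁ / N := fun j => by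
    have hbj := hb j
    have h1 := hx.1 j
    have h2 := hx.2 j
    have h3 := hq.1 j
    have h4 := hq.2 j
    have hd : gridUpper a b N m j - gridLower a b N m j = 2 * (b j / N) := by
      unfold gridUpper gridLower; ring
    have : |x j - q j| ≤ 2 * (b j / N) := abs_le.2 ⟨by linarith, by linarith⟩
    calc _ ≤ 2 * (b j / N) * (C₁ * (b j)⁻¹) := by gcongr
      _ = _ := by field_simp
  calc _ ≤ ∑ _j : Fin 3, 2 * C₁ / N := Finset.sum_le_sum fun j _ => hj j
    _ = _ := by simp; ring

theorem badSum_eq_zero (hb : ∀ j, 0 < b j) (hN : 0 < N) {x : Fin 3 → ℝ}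
    (h : ∀ m ∈ badNodes Z a b N, x ∉ Set.Icc (gridLower a b N m) (gridUpper a b N m)) :
    badSum Z a b N x = 0 :=
  Finset.sum_eq_zero fun m hm => gridBump_eq_zero_of_notMem_Icc hb hN (h m hm)

/-- On bad boxes `ψ` itself gains `1/N`. Its derivatives need no gain beyond the change of scale:
`C₁ / b₀` equals `(C₁/N) / (b₀/N)`, and `C₁ / b₀²` is at most `(C₁/N) / (b₀/N)²`. So at the scale of
the grid the whole amplitude is of size `1/N`. -/
theorem scaleBound_mul_badSum (hb : ∀ j, 0 < b j) (hN : 0 < N) {ψ : (Fin 3 → ℝ) → ℂ}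
    (hψ : ContDiff ℝ ∞ ψ) (hZ : ∀ x, x ∉ Z → ψ x = 0) {C₁ C : ℝ} (hC₁ : 0 ≤ C₁) (hC : 1 ≤ C)
    (hbd : ∀ t, |unitBump t| ≤ C ∧ |deriv unitBump t| ≤ C ∧ |deriv (deriv unitBump) t| ≤ C)
    (h : ∀ j x, ‖pderivAt j ψ x‖ ≤ C₁ * (b j)⁻¹)
    (h0 : ∀ n ≤ 2, ∀ x, ‖((pderivAt 0)^[n] ψ) x‖ ≤ C₁ * (b 0 ^ n)⁻¹) (y z : ℝ) :
    ScaleBound (fun x => ψ ![x, y, z] * (badSum Z a b N ![x, y, z] : ℂ))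
      (4 * (6 * C₁ / N * (27 * C ^ 3))) (b 0 / N) := by
  have hN' : (1 : ℝ) ≤ N := by exact_mod_cast hN
  have hl : 0 < b 0 / N := div_pos (hb 0) (by linarith)
  have hψs := scaleBound_slice hψ h0 y z
  have hBs : ScaleBound (fun x => (badSum Z a b N ![x, y, z] : ℂ)) (27 * C ^ 3) (b 0 / N) :=
    scaleBound_sum_gridBump hb hN hC hbd (badNodes Z a b N) y z
  refine ScaleBound.mul_of_forall hψs.contDiff hBs (by positivity) hl fun t => ?_
  by_cases ht : ∃ m ∈ badNodes Z a b N,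
      ![t, y, z] ∈ Set.Icc (gridLower a b N m) (gridUpper a b N m)
  · right
    obtain ⟨m, hm, hmt⟩ := ht
    have hb0 := hb 0
    refine ⟨norm_le_of_mem_badNodes hb hN (hψ.differentiable (by simp)) hZ hC₁ h hm hmt,
      (hψs.bound_one t).trans ?_, (hψs.bound_two t).trans ?_⟩
    · rw [show 6 * C₁ / N / (b 0 / N) = 6 * C₁ / b 0 by field_simp]
      gcongr; linarith
    · rw [show 6 * C₁ / N / (b 0 / N) ^ 2 = 6 * C₁ * N / b 0 ^ 2 by field_simp]
      gcongr; nlinarith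
  · left
    push Not at ht
    -- Off the finite union of closed bad boxes `badSum` vanishes in a neighbourhood, so it vanishes
    -- there together with its derivatives and no bound on `ψ` is required.
    have hcl : IsClosed (⋃ m ∈ badNodes Z a b N,
        Set.Icc (gridLower a b N m) (gridUpper a b N m)) :=
      Set.Finite.isClosed_biUnion (Finset.finite_toSet _) fun m _ => isClosed_Icc
    have hcont : Continuous fun t : ℝ => ![t, y, z] := by
      refine continuous_pi fun i => ?_
      fin_cases i
      · exact continuous_id
      · exact continuous_const
      · exact continuous_const
    have hopen := (hcl.isOpen_compl).preimage hcont
    have hev : (fun x => (badSum Z a b N ![x, y, z] : ℂ)) =ᶠ[nhds t] fun _ => 0 := by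
      have hmem : t ∈ (fun t : ℝ => ![t, y, z]) ⁻¹' (⋃ m ∈ badNodes Z a b N,
          Set.Icc (gridLower a b N m) (gridUpper a b N m))ᶜ := by
        simpa using ht
      filter_upwards [hopen.mem_nhds hmem] with w hw
      rw [badSum_eq_zero hb hN, Complex.ofReal_zero]
      intro m hm hmw
      exact hw (Set.mem_biUnion (Finset.mem_coe.2 hm) hmw)
    refine ⟨hev.eq_of_nhds, ?_, ?_⟩
    · rw [hev.deriv_eq]; simp
    · rw [hev.deriv.deriv_eq]; simp

/-- `S` is arbitrary off the support of `ψ`, possibly not measurable. The product is nevertheless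
continuous on the closed support and zero elsewhere. -/
theorem measurable_exp_mul {S : (Fin 3 → ℝ) → ℝ} {ψ : (Fin 3 → ℝ) → ℂ} (hψ : Continuous ψ)
    (lam : ℝ) (hS : ∀ x ∈ tsupport ψ, AnalyticAt ℝ S x) :
    Measurable fun x => Complex.exp (Complex.I * lam * S x) * ψ x := by
  classical
  have hc : ContinuousOn (fun x => Complex.exp (Complex.I * lam * S x) * ψ x) (tsupport ψ) := by
    have : ContinuousOn S (tsupport ψ) := fun x hx => (hS x hx).continuousAt.continuousWithinAt
    have h2 : ContinuousOn (fun x => (S x : ℂ)) (tsupport ψ) :=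
      Complex.continuous_ofReal.comp_continuousOn this
    exact (Complex.continuous_exp.comp_continuousOn (continuousOn_const.mul h2)).mul
      hψ.continuousOn
  have hm := ContinuousOn.measurable_piecewise (s := tsupport ψ) hc
    (continuousOn_const (c := (0 : ℂ))) (isClosed_tsupport ψ).measurableSet
  convert hm using 1
  ext x
  by_cases hx : x ∈ tsupport ψ
  · rw [Set.piecewise_eq_of_mem _ _ _ hx]
  · rw [Set.piecewise_eq_of_notMem _ _ _ hx, image_eq_zero_of_notMem_tsupport hx, mul_zero]

end cutoff

/-! ### Dyadic telescoping for bounded functions -/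

theorem geom_sum_le_inv_one_sub (r : ℝ) (h0 : 0 ≤ r) (h1 : r < 1) (n : ℕ) :
    ∑ k ∈ Finset.range n, r ^ k ≤ (1 - r)⁻¹ := by
  rw [← tsum_geometric_of_lt_one h0 h1]
  exact (summable_geometric_of_lt_one h0 h1).sum_le_tsum _ fun _ _ => by positivity

/-- The balance of one level: amplitude gain `N⁻¹` against summation loss `(N + 1)^{3/4}`, leaving
`N^{-1/4}` for `N = 2 ^ k`. -/
theorem inv_mul_add_one_rpow_le (k : ℕ) :
    ((2 ^ k : ℕ) : ℝ)⁻¹ * (((2 ^ k : ℕ) : ℝ) + 1) ^ (3 / 4 : ℝ) ≤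
      2 * ((2 : ℝ) ^ (-(1 / 4) : ℝ)) ^ k := by
  set N : ℝ := ((2 ^ k : ℕ) : ℝ) with hN
  have hN1 : 1 ≤ N := by
    rw [hN]; exact_mod_cast Nat.one_le_two_pow
  have hNp : 0 < N := by linarith
  have e : ((2 : ℝ) ^ (-(1 / 4) : ℝ)) ^ k = N ^ (-(1 / 4) : ℝ) := by
    rw [hN]
    push_cast
    rw [← Real.rpow_natCast, ← Real.rpow_natCast, ← Real.rpow_mul (by norm_num),
      ← Real.rpow_mul (by norm_num)]
    congr 1; ring
  rw [e]
  calc _ ≤ N⁻¹ * (2 * N) ^ (3 / 4 : ℝ) := by gcongr; linarith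
    _ = 2 ^ (3 / 4 : ℝ) * (N ^ (-1 : ℝ) * N ^ (3 / 4 : ℝ)) := by
      rw [Real.mul_rpow (by norm_num) hNp.le, Real.rpow_neg_one]; ring
    _ = 2 ^ (3 / 4 : ℝ) * N ^ (-(1 / 4) : ℝ) := by
      rw [← Real.rpow_add hNp]; norm_num
    _ ≤ 2 ^ (1 : ℝ) * N ^ (-(1 / 4) : ℝ) := by
      gcongr <;> norm_num
    _ = _ := by rw [Real.rpow_one]

/-- Geometric ratio of the contributions of successive grids. -/
noncomputable def gridRatio : ℝ := (2 : ℝ) ^ (-(1 / 4) : ℝ)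

theorem gridRatio_pos : 0 < gridRatio := by unfold gridRatio; positivity

theorem gridRatio_lt_one : gridRatio < 1 :=
  Real.rpow_lt_one_of_one_lt_of_neg (by norm_num) (by norm_num)

/-- The estimate for bounded functions. -/
theorem norm_integral_le_of_bounded {S : (Fin 3 → ℝ) → ℝ} {ψ : (Fin 3 → ℝ) → ℂ}
    {a b : Fin 3 → ℝ} {lam μ C₁ K C : ℝ} (hlam : lam ≠ 0) (hμ : 0 < μ) (hC₁ : 0 ≤ C₁) (hK : 0 ≤ K)
    (hψ : ContDiff ℝ ∞ ψ) (hS : PhaseBound S (tsupport ψ) μ K (b 0)) (hb : ∀ j, 0 < b j)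
    (hsupp : ∀ x ∈ tsupport ψ, ∀ j, x j ∈ Set.Icc (a j) (a j + b j))
    (h1 : ∀ j x, ‖pderivAt j ψ x‖ ≤ C₁ * (b j)⁻¹)
    (h0 : ∀ n ≤ 2, ∀ x, ‖((pderivAt 0)^[n] ψ) x‖ ≤ C₁ * (b 0 ^ n)⁻¹) (hC : 1 ≤ C)
    (hbd : ∀ t, |unitBump t| ≤ C ∧ |deriv unitBump t| ≤ C ∧ |deriv (deriv unitBump) t| ≤ C)
    {f : Fin 3 → (Fin 2 → ℝ) → ℂ} (hf : ∀ j, Measurable (f j)) {B : ℝ}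
    (hB : ∀ j w, ‖f j w‖ ≤ B) (hfin : ∀ j, ∫⁻ w, ‖f j w‖ₑ ^ (8 / 3 : ℝ) ≠ ⊤) :
    ‖∫ x, Complex.exp (Complex.I * lam * S x) * ψ x * ∏ j, f j (hatProj j x)‖ ≤
      (5832 * (2 * Real.pi * (768 * (1 + K) ^ 2)) ^ (1 / 4 : ℝ) * (108 * C ^ 3)) *
        (2 * C₁ + 20736 * C₁ * C ^ 3 * (1 - gridRatio)⁻¹) * (|lam| * μ) ^ (-(1 / 4) : ℝ) *
          ∏ j, ((∫⁻ w, ‖f j w‖ₑ ^ (8 / 3 : ℝ)) ^ (3 / 8 : ℝ)).toReal := by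
  set Z := tsupport ψ
  set e : (Fin 3 → ℝ) → ℂ := fun x => Complex.exp (Complex.I * lam * S x) with he
  set c := 5832 * (2 * Real.pi * (768 * (1 + K) ^ 2)) ^ (1 / 4 : ℝ) * (108 * C ^ 3) with hc
  set θ := (|lam| * μ) ^ (-(1 / 4) : ℝ) with hθ
  set R := ∏ j, ((∫⁻ w, ‖f j w‖ₑ ^ (8 / 3 : ℝ)) ^ (3 / 8 : ℝ)).toReal with hR
  have hc0 : 0 ≤ c := by positivity
  have hθ0 : 0 ≤ θ := by positivity
  have hR0 : 0 ≤ R := Finset.prod_nonneg fun j _ => ENNReal.toReal_nonneg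
  have hZ : ∀ x, x ∉ Z → ψ x = 0 := fun x hx => image_eq_zero_of_notMem_tsupport hx
  have hm := measurable_exp_mul hψ.continuous lam hS.analyticAt
  have hr0 := gridRatio_pos
  have hr1 := gridRatio_lt_one
  have hpow : ∀ k : ℕ, 0 < 2 ^ k := fun k => by positivity
  have hψb : ∀ x, ‖ψ x‖ ≤ C₁ := fun x => by simpa using h0 0 (by norm_num) x
  set F : ((Fin 3 → ℝ) → ℝ) → (Fin 3 → ℝ) → ℂ := fun χ x =>
    e x * (ψ x * (χ x : ℂ)) * ∏ j, f j (hatProj j x) with hF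
  have hprodm : Measurable fun x : Fin 3 → ℝ => ∏ j, f j (hatProj j x) :=
    Finset.measurable_prod _ fun j _ => (hf j).comp (measurable_hatProj j)
  have hbox : ∀ x, x ∉ Set.Icc a (a + b) → ψ x = 0 := fun x hx => hZ x fun h =>
    hx ⟨fun j => (hsupp x h j).1, fun j => (hsupp x h j).2⟩
  have hB0 : 0 ≤ B := (norm_nonneg _).trans (hB 0 0)
  have hprod : ∀ x, ∏ j, ‖f j (hatProj j x)‖ ≤ B ^ 3 := fun x => by
    calc _ ≤ ∏ _j : Fin 3, B :=
          Finset.prod_le_prod (fun j _ => norm_nonneg _) fun j _ => hB j _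
      _ = B ^ 3 := by simp
  have hI : ∀ χ : (Fin 3 → ℝ) → ℝ, Continuous χ → Integrable (F χ) := fun χ hχ => by
    obtain ⟨D, hD⟩ := (isCompact_Icc (a := a) (b := a + b)).exists_bound_of_continuousOn
      hχ.continuousOn
    have hm' : Measurable fun x => e x * (ψ x * (χ x : ℂ)) := by
      simp_rw [← mul_assoc]
      exact hm.mul (Complex.continuous_ofReal.comp hχ).measurable
    refine integrable_of_bound_of_subset_Icc (c := a) (d := a + b)
      (B := C₁ * max D 0 * B ^ 3) (hm'.mul hprodm) (fun x => ?_)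
      (fun x hx => by simp [hF, hbox x hx])
    by_cases hx : x ∈ Set.Icc a (a + b)
    · rw [norm_mul, norm_mul, norm_mul, norm_prod, norm_exp_phase, one_mul, Complex.norm_real]
      exact mul_le_mul (mul_le_mul (hψb x) ((hD x hx).trans (le_max_left _ _)) (norm_nonneg _) hC₁)
        (hprod x) (Finset.prod_nonneg fun j _ => norm_nonneg _) (by positivity)
    · simp only [hF, hbox x hx, zero_mul, mul_zero, norm_zero]
      positivity
  -- the telescoping identity
  set P : ℕ → (Fin 3 → ℝ) → ℝ := fun k => goodSum Z a b (2 ^ k) with hP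
  set Q : ℕ → (Fin 3 → ℝ) → ℝ := fun k => badSum Z a b (2 ^ k) with hQ
  have hPc : ∀ k, Continuous (P k) := fun k => continuous_goodSum
  have hQc : ∀ k, Continuous (Q k) := fun k => continuous_badSum
  have hPQ : ∀ k x, ψ x * ((P k x : ℂ) + (Q k x : ℂ)) = ψ x := fun k x => by
    by_cases hx : x ∈ Z
    · have := goodSum_add_badSum (Z := Z) hb (hpow k) (hsupp x hx)
      rw [← Complex.ofReal_add, hP, hQ, this, Complex.ofReal_one, mul_one]
    · rw [hZ x hx, zero_mul]
  -- Multiply `P (k + 1)` by `P k + Q k` and `P k` by `P (k + 1) + Q (k + 1)`, both equal to `1` on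
  -- the support, and subtract: the products `P k * P (k + 1)` cancel. What remains always pairs a
  -- bad factor, making the amplitude small, with a good factor at a neighbouring level, making the
  -- boxes admissible.
  have hstep : ∀ k, ∫ x, F (P (k + 1)) x = (∫ x, F (P k) x) +
      ((∫ x, F (fun x => Q k x * P (k + 1) x) x) - ∫ x, F (fun x => Q (k + 1) x * P k x) x) := by
    intro k
    have i1 : Integrable (F fun x => Q k x * P (k + 1) x) := hI _ ((hQc k).mul (hPc (k + 1)))
    have i2 : Integrable (F fun x => Q (k + 1) x * P k x) := hI _ ((hQc (k + 1)).mul (hPc k))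
    refine Eq.trans ?_ ((integral_add (hI _ (hPc k)) (i1.sub i2)).trans
      (congrArg _ (integral_sub i1 i2)))
    congr 1
    ext x
    simp only [hF, Complex.ofReal_mul, Pi.sub_apply]
    have e1 := hPQ k x
    have e2 := hPQ (k + 1) x
    linear_combination (e x * (∏ j, f j (hatProj j x))) * ((P k x : ℂ) * e2 - (P (k + 1) x : ℂ) * e1)
  -- the two contributions of a level
  have hlevel : ∀ k k', k ≤ k' + 1 → k' ≤ k + 1 →
      ‖∫ x, F (fun x => Q k' x * P k x) x‖ ≤ c * (5184 * C₁ * C ^ 3) * (2 * gridRatio ^ k) * θ * R := by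
    intro k k' h12 h21
    have hN : (0 : ℝ) < ((2 ^ k : ℕ) : ℝ) := by exact_mod_cast hpow k
    have hN' : (0 : ℝ) < ((2 ^ k' : ℕ) : ℝ) := by exact_mod_cast hpow k'
    have hN1 : ((2 ^ k : ℕ) : ℝ) ≤ 2 * ((2 ^ k' : ℕ) : ℝ) := by
      have : 2 ^ k ≤ 2 ^ (k' + 1) := Nat.pow_le_pow_right (by norm_num) h12
      rw [pow_succ, mul_comm] at this
      exact_mod_cast this
    have hN2 : ((2 ^ k' : ℕ) : ℝ) ≤ 2 * ((2 ^ k : ℕ) : ℝ) := by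
      have : 2 ^ k' ≤ 2 ^ (k + 1) := Nat.pow_le_pow_right (by norm_num) h21
      rw [pow_succ, mul_comm] at this
      exact_mod_cast this
    have hb0 := hb 0
    have hsl : ∀ y z, ScaleBound (fun x => ψ ![x, y, z] * (Q k' ![x, y, z] : ℂ))
        (4 * (4 * (6 * C₁ / ((2 ^ k' : ℕ) : ℝ) * (27 * C ^ 3)))) (b 0 / ((2 ^ k : ℕ) : ℝ)) :=
      fun y z => by
        refine (scaleBound_mul_badSum hb (hpow k') hψ hZ hC₁ hC hbd h1 h0 y z).rescale
          (by positivity) (by positivity) ?_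
        rw [← mul_div_assoc, div_le_div_iff₀ hN hN']
        nlinarith
    have hm' : Measurable fun x => e x * (ψ x * (Q k' x : ℂ)) := by
      simp_rw [← mul_assoc]
      exact hm.mul (Complex.continuous_ofReal.comp (hQc k')).measurable
    have h := norm_level_integral_le (a := a) hb (hpow k) hlam hμ hK hS hC hbd
      (Ψ := fun x => ψ x * (Q k' x : ℂ)) hsl hm' (s := goodNodes Z a b (2 ^ k))
      (fun m hm => by simpa [goodNodes] using hm) hf hB hfin
    have eF : ∀ x, F (fun x => Q k' x * P k x) x = e x * (ψ x * (Q k' x : ℂ) *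
        ((∑ m ∈ goodNodes Z a b (2 ^ k), gridBump a b (2 ^ k) m x : ℝ) : ℂ)) *
        ∏ j, f j (hatProj j x) := fun x => by
      simp only [hF, hP, goodSum]
      rw [Complex.ofReal_mul, mul_assoc (ψ x)]
    simp_rw [eF]
    refine h.trans ?_
    rw [← hc, ← hθ, ← hR]
    -- The product of constants is `2592`; passing from level `k'` to the neighbouring level `k`
    -- costs one more factor of two.
    have hM : 4 * (4 * (6 * C₁ / ((2 ^ k' : ℕ) : ℝ) * (27 * C ^ 3))) ≤
        5184 * C₁ * C ^ 3 * ((2 ^ k : ℕ) : ℝ)⁻¹ := by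
      have : (((2 ^ k' : ℕ) : ℝ))⁻¹ ≤ 2 * (((2 ^ k : ℕ) : ℝ))⁻¹ := by
        rw [← div_eq_mul_inv, inv_eq_one_div, div_le_div_iff₀ hN' hN]
        linarith
      calc _ = 2592 * C₁ * C ^ 3 * (((2 ^ k' : ℕ) : ℝ))⁻¹ := by rw [div_eq_mul_inv]; ring
        _ ≤ 2592 * C₁ * C ^ 3 * (2 * (((2 ^ k : ℕ) : ℝ))⁻¹) := by gcongr
        _ = _ := by ring
    calc _ ≤ c * (5184 * C₁ * C ^ 3 * ((2 ^ k : ℕ) : ℝ)⁻¹) *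
          (((2 ^ k : ℕ) : ℝ) + 1) ^ (3 / 4 : ℝ) * θ * R := by gcongr
      _ = c * (5184 * C₁ * C ^ 3) * (((2 ^ k : ℕ) : ℝ)⁻¹ *
          (((2 ^ k : ℕ) : ℝ) + 1) ^ (3 / 4 : ℝ)) * θ * R := by ring
      _ ≤ _ := by
        have h2 := mul_le_mul_of_nonneg_left (inv_mul_add_one_rpow_le k)
          (show 0 ≤ c * (5184 * C₁ * C ^ 3) by positivity)
        exact mul_le_mul_of_nonneg_right (mul_le_mul_of_nonneg_right h2 hθ0) hR0
  have hzero : ‖∫ x, F (P 0) x‖ ≤ c * (2 * C₁) * θ * R := by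
    have h := norm_level_integral_le (a := a) hb (hpow 0) hlam hμ hK hS hC hbd (Ψ := ψ) (M := C₁)
      (by simpa using scaleBound_slice hψ h0) hm (s := goodNodes Z a b (2 ^ 0))
      (fun m hm => by simpa [goodNodes] using hm) hf hB hfin
    refine h.trans ?_
    rw [← hc, ← hθ, ← hR]
    have h2 := inv_mul_add_one_rpow_le 0
    simp only [pow_zero, Nat.cast_one, inv_one, one_mul, mul_one] at h2
    calc _ = c * (C₁ * ((1 : ℝ) + 1) ^ (3 / 4 : ℝ)) * θ * R := by
          simp only [pow_zero, Nat.cast_one]; ring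
      _ ≤ c * (C₁ * 2) * θ * R := by gcongr
      _ = _ := by ring
  -- Each step adds two products, each at most `2 * gridRatio ^ n` times the common constant; hence
  -- the factor `4`.
  have hpartial : ∀ n, ‖∫ x, F (P n) x‖ ≤ c * (2 * C₁) * θ * R +
      c * (5184 * C₁ * C ^ 3) * θ * R * 4 * ∑ k ∈ Finset.range n, gridRatio ^ k := by
    intro n
    induction n with
    | zero => simpa using hzero
    | succ n ih =>
      rw [hstep, Finset.sum_range_succ]
      have hA := hlevel (n + 1) n (by lia) (by lia)
      have hB := hlevel n (n + 1) (by lia) (by lia)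
      have hmono : gridRatio ^ (n + 1) ≤ gridRatio ^ n :=
        pow_le_pow_of_le_one hr0.le hr1.le (by lia)
      have hA' : ‖∫ x, F (fun x => Q n x * P (n + 1) x) x‖ ≤
          c * (5184 * C₁ * C ^ 3) * (2 * gridRatio ^ n) * θ * R := hA.trans (by gcongr)
      have := (norm_add_le (∫ x, F (P n) x) ((∫ x, F (fun x => Q n x * P (n + 1) x) x) -
        ∫ x, F (fun x => Q (n + 1) x * P n x) x)).trans (add_le_add ih (norm_sub_le _ _))
      linarith
  -- passing to the limit
  set vol := (volume : Measure (Fin 3 → ℝ)).real (Set.Icc a (a + b))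
  -- This bound involves `B` and the volume of the slab box, quantities that must not enter the
  -- final constant. It is used only for its limit zero as `n → ∞`.
  have hrest : ∀ n, ‖∫ x, F (Q n) x‖ ≤
      24 * C₁ * 27 * C ^ 3 * B ^ 3 * vol * ((1 / 2 : ℝ)) ^ n := by
    intro n
    rw [← setIntegral_eq_integral_of_forall_compl_eq_zero (s := Set.Icc a (a + b))
      fun x hx => by simp [hF, hbox x hx]]
    have hN' : (0 : ℝ) < ((2 ^ n : ℕ) : ℝ) := by exact_mod_cast hpow n
    refine (norm_setIntegral_le_of_norm_le_const (C := 4 * (6 * C₁ / ((2 ^ n : ℕ) : ℝ) *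
      (27 * C ^ 3)) * B ^ 3) isCompact_Icc.measure_lt_top fun x _ => ?_).trans (le_of_eq ?_)
    · rw [hF]
      rw [norm_mul, norm_prod, norm_mul, norm_exp_phase, one_mul]
      have hs := (scaleBound_mul_badSum (a := a) hb (hpow n) hψ hZ hC₁ hC hbd h1 h0 (x 1)
        (x 2)).bound_zero (x 0)
      rw [show ![x 0, x 1, x 2] = x by ext i; fin_cases i <;> rfl] at hs
      exact mul_le_mul hs (hprod x) (Finset.prod_nonneg fun j _ => norm_nonneg _) (by positivity)
    · push_cast
      rw [one_div, inv_pow]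
      field_simp
      ring
  have hall : ∀ n, ‖∫ x, e x * ψ x * ∏ j, f j (hatProj j x)‖ ≤
      c * (2 * C₁ + 20736 * C₁ * C ^ 3 * (1 - gridRatio)⁻¹) * θ * R +
        24 * C₁ * 27 * C ^ 3 * B ^ 3 * vol * ((1 / 2 : ℝ)) ^ n := by
    intro n
    have hsplit : ∫ x, e x * ψ x * ∏ j, f j (hatProj j x) =
        (∫ x, F (P n) x) + ∫ x, F (Q n) x := by
      rw [← integral_add (hI _ (hPc n)) (hI _ (hQc n))]
      congr 1
      ext x
      simp only [hF]
      linear_combination (-(e x * (∏ j, f j (hatProj j x)))) * hPQ n x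
    rw [hsplit]
    refine (norm_add_le _ _).trans (add_le_add ((hpartial n).trans ?_) (hrest n))
    calc _ ≤ c * (2 * C₁) * θ * R +
          c * (5184 * C₁ * C ^ 3) * θ * R * 4 * (1 - gridRatio)⁻¹ := by
          gcongr
          exact geom_sum_le_inv_one_sub _ hr0.le hr1 n
      _ = _ := by ring
  have hlim : Filter.Tendsto (fun n : ℕ =>
      c * (2 * C₁ + 20736 * C₁ * C ^ 3 * (1 - gridRatio)⁻¹) * θ * R +
        24 * C₁ * 27 * C ^ 3 * B ^ 3 * vol * ((1 / 2 : ℝ)) ^ n) Filter.atTop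
      (nhds (c * (2 * C₁ + 20736 * C₁ * C ^ 3 * (1 - gridRatio)⁻¹) * θ * R +
        24 * C₁ * 27 * C ^ 3 * B ^ 3 * vol * 0)) :=
    ((tendsto_pow_atTop_nhds_zero_of_lt_one (by norm_num) (by norm_num)).const_mul _).const_add _
  rw [mul_zero, add_zero] at hlim
  exact ge_of_tendsto' hlim hall

/-! ### Absolute convergence and passage to general `L^{8/3}` functions -/

/-- The Loomis-Whitney inequality in `ℝ³`. -/
theorem lintegral_prod_hatProj_le {G : Fin 3 → (Fin 2 → ℝ) → ℝ≥0∞} (hG : ∀ j, Measurable (G j)) :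
    ∫⁻ x, ∏ j, G j (hatProj j x) ≤ ∏ j, (∫⁻ w, G j w ^ 2) ^ (1 / 2 : ℝ) := by
  have hm : Measurable fun x : Fin 3 → ℝ => ∏ j, G j (hatProj j x) :=
    Finset.measurable_prod _ fun j _ => (hG j).comp (measurable_hatProj j)
  have hv : ∀ j, Measurable fun p : ℝ × ℝ => G j ![p.1, p.2] := fun j =>
    (hG j).comp (measurable_vec_two measurable_fst measurable_snd)
  rw [lintegral_fin_three hm]
  simp_rw [Fin.prod_univ_three, hatProj_zero, hatProj_one, hatProj_two]
  rw [lintegral_fin_two ((hG 0).pow_const 2), lintegral_fin_two ((hG 1).pow_const 2),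
    lintegral_fin_two ((hG 2).pow_const 2)]
  exact loomis_whitney_three volume volume volume (hv 0) (hv 1) (hv 2)

/-- The preimage of a planar null set under a coordinate projection is null, so the form depends
only on the almost everywhere classes of the `f j`. -/
theorem quasiMeasurePreserving_hatProj {n : ℕ} (j : Fin (n + 1)) :
    Measure.QuasiMeasurePreserving (hatProj j) volume volume :=
  Measure.quasiMeasurePreserving_snd.comp
    (volume_preserving_piFinSuccAbove (fun _ : Fin (n + 1) => ℝ) j).quasiMeasurePreserving

theorem oscIntegrand_congr_ae {n : ℕ} (lam : ℝ) (S : (Fin (n + 1) → ℝ) → ℝ)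
    (ψ : (Fin (n + 1) → ℝ) → ℂ) {f g : Fin (n + 1) → (Fin n → ℝ) → ℂ}
    (h : ∀ j, f j =ᵐ[volume] g j) :
    oscIntegrand lam S ψ f =ᵐ[volume] oscIntegrand lam S ψ g := by
  have := ae_all_iff.2 fun j => (quasiMeasurePreserving_hatProj j).ae_eq_comp (h j)
  filter_upwards [this] with x hx
  simp only [oscIntegrand]
  congr 1
  exact Finset.prod_congr rfl fun j _ => hx j

theorem setLIntegral_sq_lt_top {α : Type*} [MeasurableSpace α] {ν : Measure α} {s : Set α}
    (hs : ν s ≠ ⊤) {g : α → ℂ} (hg : MemLp g (8 / 3) ν) : ∫⁻ w in s, ‖g w‖ₑ ^ 2 ∂ν < ⊤ := by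
  have : IsFiniteMeasure (ν.restrict s) := ⟨by simpa using hs.lt_top⟩
  have h2 : MemLp g 2 (ν.restrict s) := (hg.restrict s).mono_exponent (by
    rw [ENNReal.le_div_iff_mul_le (by norm_num) (by norm_num)]; norm_num)
  have := lintegral_rpow_enorm_lt_top_of_eLpNorm_lt_top (by norm_num) (by norm_num) h2.2
  simpa using this

/-- No oscillation is used: restrict each `g j` to the projection of the box and apply
Loomis-Whitney, the restricted functions being square integrable because `2 ≤ 8/3` on a set of
finite measure. -/
theorem integrable_oscIntegrand_of_measurable {S : (Fin 3 → ℝ) → ℝ} {ψ : (Fin 3 → ℝ) → ℂ}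
    {a b : Fin 3 → ℝ} {lam C₁ : ℝ} (hm : Measurable fun x => Complex.exp (Complex.I * lam * S x) * ψ x)
    (hψ : ∀ x, ‖ψ x‖ ≤ C₁) (hψ0 : ∀ x, x ∉ Set.Icc a b → ψ x = 0)
    {g : Fin 3 → (Fin 2 → ℝ) → ℂ} (hg : ∀ j, Measurable (g j))
    (hgL : ∀ j, MemLp (g j) (8 / 3) volume) : Integrable (oscIntegrand lam S ψ g) := by
  set G : Fin 3 → (Fin 2 → ℝ) → ℝ≥0∞ := fun j =>
    (Set.Icc (hatProj j a) (hatProj j b)).indicator fun w => ‖g j w‖ₑ with hG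
  have hGm : ∀ j, Measurable (G j) := fun j => (hg j).enorm.indicator measurableSet_Icc
  have hprodm : Measurable fun x : Fin 3 → ℝ => ∏ j, g j (hatProj j x) :=
    Finset.measurable_prod _ fun j _ => (hg j).comp (measurable_hatProj j)
  refine ⟨(hm.mul hprodm).aestronglyMeasurable, ?_⟩
  have hle : ∀ x, ‖oscIntegrand lam S ψ g x‖ₑ ≤
      ENNReal.ofReal C₁ * ∏ j, G j (hatProj j x) := fun x => by
    by_cases hx : x ∈ Set.Icc a b
    · have hGx : ∀ j, G j (hatProj j x) = ‖g j (hatProj j x)‖ₑ := fun j => by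
        have hmem : hatProj j x ∈ Set.Icc (hatProj j a) (hatProj j b) :=
          ⟨fun i => hx.1 _, fun i => hx.2 _⟩
        exact Set.indicator_of_mem hmem _
      simp_rw [hGx]
      rw [← ofReal_norm, oscIntegrand, norm_mul, norm_mul, norm_exp_phase, one_mul, norm_prod,
        ENNReal.ofReal_mul (norm_nonneg _), ENNReal.ofReal_prod_of_nonneg fun j _ => norm_nonneg _]
      simp_rw [ofReal_norm (g _ _)]
      gcongr
      exact hψ x
    · simp [oscIntegrand, hψ0 x hx]
  refine (lintegral_mono hle).trans_lt ?_
  rw [lintegral_const_mul' _ _ ENNReal.ofReal_ne_top]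
  refine ENNReal.mul_lt_top ENNReal.ofReal_lt_top ((lintegral_prod_hatProj_le hGm).trans_lt ?_)
  refine ENNReal.prod_lt_top fun j _ => ENNReal.rpow_lt_top_of_nonneg (by norm_num) (ne_of_lt ?_)
  have e : ∀ w, G j w ^ 2 = (Set.Icc (hatProj j a) (hatProj j b)).indicator
      (fun w => ‖g j w‖ₑ ^ 2) w := fun w => by
    by_cases hw : w ∈ Set.Icc (hatProj j a) (hatProj j b)
    · simp [hG, hw]
    · simp [hG, hw]
  simp_rw [e]
  rw [lintegral_indicator measurableSet_Icc]
  exact setLIntegral_sq_lt_top isCompact_Icc.measure_lt_top.ne (hgL j)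

theorem eLpNorm_eight_thirds {α : Type*} [MeasurableSpace α] (ν : Measure α) (f : α → ℂ) :
    eLpNorm f (8 / 3) ν = (∫⁻ w, ‖f w‖ₑ ^ (8 / 3 : ℝ) ∂ν) ^ (3 / 8 : ℝ) := by
  have h : (8 / 3 : ℝ≥0∞).toReal = 8 / 3 := by simp
  rw [eLpNorm_eq_lintegral_rpow_enorm_toReal (by simp) (ENNReal.div_ne_top (by simp) (by simp)), h]
  norm_num

/-- A trilinear bound valid for the truncations of `g` passes to `g`. -/
theorem norm_oscForm_le_of_truncation {S : (Fin 3 → ℝ) → ℝ} {ψ : (Fin 3 → ℝ) → ℂ} {lam A : ℝ}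
    (hA : 0 ≤ A) {g : Fin 3 → (Fin 2 → ℝ) → ℂ} (hg : ∀ j, Measurable (g j))
    (hgL : ∀ j, MemLp (g j) (8 / 3) volume) (hI : Integrable (oscIntegrand lam S ψ g))
    (hm : Measurable fun x => Complex.exp (Complex.I * lam * S x) * ψ x)
    (h : ∀ f : Fin 3 → (Fin 2 → ℝ) → ℂ, (∀ j, Measurable (f j)) →
      (∃ B : ℝ, ∀ j w, ‖f j w‖ ≤ B) → (∀ j, eLpNorm (f j) (8 / 3) volume ≠ ⊤) →
      ‖oscForm lam S ψ f‖ ≤ A * ∏ j, (eLpNorm (f j) (8 / 3) volume).toReal) :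
    ‖oscForm lam S ψ g‖ ≤ A * ∏ j, (eLpNorm (g j) (8 / 3) volume).toReal := by
  classical
  set t : ℕ → Fin 3 → (Fin 2 → ℝ) → ℂ := fun n j w => if ‖g j w‖ ≤ n then g j w else 0 with ht
  have htm : ∀ n j, Measurable (t n j) := fun n j =>
    Measurable.ite (measurableSet_le (hg j).norm measurable_const) (hg j) measurable_const
  have htle : ∀ n j w, ‖t n j w‖ ≤ ‖g j w‖ := fun n j w => by
    simp only [ht]
    split_ifs
    · exact le_rfl
    · simp
  have htL : ∀ n j, eLpNorm (t n j) (8 / 3) volume ≤ eLpNorm (g j) (8 / 3) volume := fun n j =>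
    eLpNorm_mono (htle n j)
  have hbound : ∀ n, ‖oscForm lam S ψ (t n)‖ ≤
      A * ∏ j, (eLpNorm (g j) (8 / 3) volume).toReal := fun n => by
    refine (h (t n) (htm n) ⟨n, fun j w => ?_⟩ fun j => ?_).trans ?_
    · simp only [ht]
      split_ifs with hw
      · exact hw
      · simp
    · exact ((htL n j).trans_lt (hgL j).2).ne
    · exact mul_le_mul_of_nonneg_left (Finset.prod_le_prod (fun j _ => ENNReal.toReal_nonneg)
        fun j _ => ENNReal.toReal_mono (hgL j).2.ne (htL n j)) hA
  -- Dominated convergence with the absolute value of the full integrand as majorant. At each point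
  -- the truncations are eventually equal to `g`, so pointwise convergence is trivial.
  have hlim : Filter.Tendsto (fun n => oscForm lam S ψ (t n)) Filter.atTop
      (nhds (oscForm lam S ψ g)) := by
    refine tendsto_integral_of_dominated_convergence (fun x => ‖oscIntegrand lam S ψ g x‖)
      (fun n => (hm.mul (Finset.measurable_prod _ fun j _ =>
        (htm n j).comp (measurable_hatProj j))).aestronglyMeasurable) hI.norm
      (fun n => Filter.Eventually.of_forall fun x => ?_) (Filter.Eventually.of_forall fun x => ?_)
    · simp only [oscIntegrand, norm_mul, norm_prod]
      exact mul_le_mul_of_nonneg_left (Finset.prod_le_prod (fun j _ => norm_nonneg _)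
        fun j _ => htle n j _) (by positivity)
    · refine tendsto_const_nhds.mul (tendsto_finsetProd _ fun j _ => ?_)
      refine tendsto_const_nhds.congr' ?_
      filter_upwards [Filter.eventually_ge_atTop ⌈‖g j (hatProj j x)‖⌉₊] with n hn
      simp only [ht]
      rw [if_pos (Nat.ceil_le.1 hn)]
  exact le_of_tendsto' hlim.norm hbound

theorem mainTheorem9 (C₁ C₂ : ℝ) (hC₁ : 0 < C₁) (hC₂ : 0 < C₂) :
    ∃ C : ℝ, 0 < C ∧
      ∀ (lam μ : ℝ) (b : Fin 3 → ℝ) (S : (Fin 3 → ℝ) → ℝ) (ψ : (Fin 3 → ℝ) → ℂ),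
        lam ≠ 0 → 0 < μ →
        ContDiff ℝ ∞ ψ → HasCompactSupport ψ →
        AnalyticOnNhd ℝ S (tsupport ψ) →
        (∀ j : Fin 3, LocalEstimateHyp S ψ j μ (b j) C₁ C₂) →
        ∀ f : Fin 3 → (Fin 2 → ℝ) → ℂ,
          (∀ j, MemLp (f j) (8 / 3) volume) →
          Integrable (oscIntegrand lam S ψ f) volume ∧
          ‖oscForm lam S ψ f‖ ≤
            C * (|lam| * μ) ^ (-(1 / 4) : ℝ) *
              ∏ j : Fin 3, (eLpNorm (f j) (8 / 3) volume).toReal := by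
  obtain ⟨C, hC, hbd⟩ := exists_unitBump_bound
  have hr := sub_pos.2 gridRatio_lt_one
  have hπ := Real.pi_pos
  have hC0 : 0 < C := by linarith
  refine ⟨(5832 * (2 * Real.pi * (768 * (1 + C₂) ^ 2)) ^ (1 / 4 : ℝ) * (108 * C ^ 3)) *
    (2 * C₁ + 20736 * C₁ * C ^ 3 * (1 - gridRatio)⁻¹), by positivity, ?_⟩
  intro lam μ b S ψ hlam hμ hψ _ hS hloc f hf
  choose a ha using fun j => (hloc j).supported
  have hb : ∀ j, 0 < b j := fun j => (hloc j).width_pos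
  have hP : PhaseBound S (tsupport ψ) μ C₂ (b 0) :=
    ⟨hS, (hloc 0).mixed_lower, (hloc 0).mixed_upper_one, (hloc 0).mixed_upper_two⟩
  have hψb : ∀ x, ‖ψ x‖ ≤ C₁ := fun x => by simpa using (hloc 0).cutoff_bound 0 (by norm_num) x
  have hψ0 : ∀ x, x ∉ Set.Icc a (a + b) → ψ x = 0 := fun x hx =>
    image_eq_zero_of_notMem_tsupport fun h =>
      hx ⟨fun j => (ha j x h).1, fun j => (ha j x h).2⟩
  have hm := measurable_exp_mul hψ.continuous lam hS
  -- Membership in `L^{8/3}` gives measurability only up to null sets; Borel representatives make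
  -- truncations and slices measurable.
  set g : Fin 3 → (Fin 2 → ℝ) → ℂ := fun j => (hf j).1.mk (f j)
  have hfg : ∀ j, f j =ᵐ[volume] g j := fun j => (hf j).1.ae_eq_mk
  have hg : ∀ j, Measurable (g j) := fun j => (hf j).1.stronglyMeasurable_mk.measurable
  have hgL : ∀ j, MemLp (g j) (8 / 3) volume := fun j => (memLp_congr_ae (hfg j)).1 (hf j)
  have hosc := oscIntegrand_congr_ae lam S ψ hfg
  have hI := integrable_oscIntegrand_of_measurable hm hψb hψ0 hg hgL
  refine ⟨(integrable_congr hosc).2 hI, ?_⟩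
  rw [show oscForm lam S ψ f = oscForm lam S ψ g from integral_congr_ae hosc]
  simp_rw [fun j => eLpNorm_congr_ae (p := 8 / 3) (hfg j)]
  refine norm_oscForm_le_of_truncation (by positivity) hg hgL hI hm ?_
  rintro h hhm ⟨B, hB⟩ hfin
  simp_rw [eLpNorm_eight_thirds] at hfin ⊢
  refine norm_integral_le_of_bounded hlam hμ hC₁.le hC₂.le hψ hP hb
    (fun x hx j => ha j x hx) (fun j x => ?_) (hloc 0).cutoff_bound hC hbd hhm hB fun j htop => ?_
  · simpa using (hloc j).cutoff_bound 1 (by norm_num) x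
  · exact hfin j (by rw [htop, ENNReal.top_rpow_of_pos (by norm_num)])
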